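/- **Setting.** Let $d\in\mathbb N$ and $\tfrac12\le\theta<1$. $\mathcal S_\theta(\mathbb R^d)=\bigcup_{C>0}\mathcal S_{\theta,C}(\mathbb R^d)$ is the Gelfand–Shilov space, where $\mathcal S_{\theta,C}$ is the Banach space of all $f\in C^\infty(\mathbb R^d)$ with $\|f\|_C=\sup_{\alpha,\beta,x}C^{-|\alpha|-|\beta|}(\alpha!\,\beta!)^{-\theta}|x^\alpha\partial^\beta f(x)|<\infty$. $\mathcal S'_\theta(\mathbb R^d)$ is the space of linear forms $u$ on $\mathcal S_\theta(\mathbb R^d)$ such that for every $\varepsilon>0$ there is $K_\varepsilon$ with $|\langle u,f\rangle|\le K_\varepsilon\|f\|_\varepsilon$ for all $f$, with the weak topology; a function $F\in\mathcal S_\theta$ is identified with $g\mapsto\int Fg$. For $u\in\mathcal S'_\theta(\mathbb R^d)$ and $z\in\mathbb C^d$ put $$Tu(z)=2^{-d/2}\pi^{-3d/4}\big\langle u_y,e^{i\langle z,y\rangle-\frac12|y|^2}\big\rangle,\qquad \Phi(z)=\tfrac12|\operatorname{Im}z|^2 .$$ A point $(x_0,\xi_0)\in T^*\mathbb R^d\setminus\{0\}$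 is not in the wave front set $\mathrm{WF}(u)$ iff there are an open conic neighbourhood $L\subset\mathbb C^d$ of $-\xi_0-ix_0$ and $\varepsilon,C>0$ with $|Tu(z)|\le Ce^{-\varepsilon|z|^{1/\theta}+\Phi(z)}$ for all $z\in L$. For a closed sub-cone $\Gamma$ of $T^*\mathbb R^d\setminus\{0\}$ let $\mathcal S'_{\theta,\Gamma}(\mathbb R^d)=\{u\in\mathcal S'_\theta(\mathbb R^d):\mathrm{WF}(u)\subset\Gamma\}$; $u_n\to u$ in $\mathcal S'_{\theta,\Gamma}$ means that $u_n\to u$ weakly and that for every nonzero $(x_0,\xi_0)\notin\Gamma$ there are an open conic neighbourhood $L$ of $-\xi_0-ix_0$ and $\varepsilon,C>0$ with $|T(u_n-u)(z)|\le Ce^{-\varepsilon|z|^{1/\theta}+\Phi(z)}$ for all $n$ and all $z\in L$. Continuity of maps between these spaces is meant with respect to this convergence of sequences. Let $\delta(x)=(x,x)$, $\mathbb R^d\to\mathbb R^{2d}$. For a closed cone $\Gamma\subset T^*\mathbb R^{2d}\setminus\{0\}$ that contains no point $(0,(\xi,-\xi))$, let $\delta^*\Gamma=\{(x,\xi+\eta):((x,x),(\xi,\eta))\in\Gamma\}$;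 for $t\in\mathcal S'_{\theta,\Gamma}(\mathbb R^{2d})$ the pull-back $\delta^*t$ is the value at $t$ of a continuous map $\mathcal S'_{\theta,\Gamma}(\mathbb R^{2d})\to\mathcal S'_{\theta,\delta^*\Gamma}(\mathbb R^d)$ that extends $F\mapsto F\circ\delta$, $F\in\mathcal S_\theta(\mathbb R^{2d})$. The product is $u\cdot v=\delta^*(u\otimes v)$, where $u\otimes v\in\mathcal S'_\theta(\mathbb R^{2d})$ satisfies $\langle u\otimes v,f\otimes g\rangle=\langle u,f\rangle\langle v,g\rangle$ for $f,g\in\mathcal S_\theta(\mathbb R^d)$. With the unitary Fourier transform $\mathcal F$ on $\mathcal S'_\theta(\mathbb R^d)$, the convolution is defined by $\mathcal F(u*v)=(2\pi)^{d/2}\,\mathcal Fu\cdot\mathcal Fv$. A product or convolution is called well defined if exactly one ultradistribution satisfies the respective definition (for all choices of $\Gamma\supset\mathrm{WF}(t)$ and of the extension together). **Corollary (products and convolutions).** (a) Let $\Gamma_1,\Gamma_2\subset T^*\mathbb R^d\setminus\{0\}$ be closed cones such that $(0,\xi)\in\Gamma_1$ implies $(0,-\xi)\notin\Gamma_2$.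 For all $u\in\mathcal S'_{\theta,\Gamma_1}(\mathbb R^d)$, $v\in\mathcal S'_{\theta,\Gamma_2}(\mathbb R^d)$ the product $u\cdot v\in\mathcal S'_\theta(\mathbb R^d)$ is well defined and $$\mathrm{WF}(u\cdot v)\subset\Gamma_3=\{(x,\xi+\eta):(x,\xi)\in\Gamma_1,\ (x,\eta)\in\Gamma_2\}\cup\Gamma_1\cup\Gamma_2 .$$ More precisely, with $\Gamma=\big((\Gamma_1\cup\{0\})\times(\Gamma_2\cup\{0\})\big)\setminus\{0\}\subset T^*\mathbb R^{2d}\setminus\{0\}$, the product is a continuous map $\mathcal S'_{\theta,\Gamma_1}(\mathbb R^d)\times\mathcal S'_{\theta,\Gamma_2}(\mathbb R^d)\to\mathcal S'_{\theta,\delta^*\Gamma}(\mathbb R^d)$: if $u_n\to u$ in $\mathcal S'_{\theta,\Gamma_1}$ and $v_n\to v$ in $\mathcal S'_{\theta,\Gamma_2}$, then $u_n\cdot v_n\to u\cdot v$ in $\mathcal S'_{\theta,\delta^*\Gamma}$. (b) Let $u,v\in\mathcal S'_\theta(\mathbb R^d)$ be such that $(\xi,0)\in\mathrm{WF}(u)$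 implies $(-\xi,0)\notin\mathrm{WF}(v)$. Then the convolution $u*v\in\mathcal S'_\theta(\mathbb R^d)$ is well defined and $$\mathrm{WF}(u*v)\subset\{(x+y,\xi):(x,\xi)\in\mathrm{WF}(u)\cup\{0\},\ (y,\xi)\in\mathrm{WF}(v)\cup\{0\}\}\setminus\{0\}.$$ Similarly to (a), if $\Gamma_1,\Gamma_2$ are closed cones such that $(\xi,0)\in\Gamma_1$ implies $(-\xi,0)\notin\Gamma_2$, then $u_n\to u$ in $\mathcal S'_{\theta,\Gamma_1}$ and $v_n\to v$ in $\mathcal S'_{\theta,\Gamma_2}$ imply $u_n*v_n\to u*v$ in $\mathcal S'_{\theta,\Gamma_4}$, where $\Gamma_4=\{(x+y,\xi):(x,\xi)\in\Gamma_1\cup\{0\},\ (y,\xi)\in\Gamma_2\cup\{0\}\}\setminus\{0\}$. -/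

import Mathlib

open scoped ContDiff Topology

noncomputable section

namespace GelfandShilov

variable {ι : Type} [Fintype ι] [DecidableEq ι]

/-- Configuration space `ℝ^ι` with the Euclidean norm. -/
abbrev Conf (ι : Type) [Fintype ι] : Type := EuclideanSpace ℝ ι

/-- The cotangent space `T^*ℝ^ι`, points `(x, ξ)`. -/
abbrev Phase (ι : Type) [Fintype ι] : Type := Conf ι × Conf ι

/-! ### Gelfand-Shilov functions -/

/-- `α! = ∏ i, (α i)!` for a multi-index `α`. -/
def multiFactorial (α : ι → ℕ) : ℝ := ∏ i, ((α i).factorial : ℝ)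

/-- `x^α = ∏ i, (x i)^(α i)`. -/
def monomialAt (α : ι → ℕ) (x : Conf ι) : ℝ := ∏ i, x i ^ α i

/-- The multi-index `β` of a word `w = (i₁, …, iₙ)`: `β i` counts the occurrences of `i`. -/
def wordIndex {n : ℕ} (w : Fin n → ι) : ι → ℕ :=
  fun i => (Finset.univ.filter fun k => w k = i).card

/-- `∂_{i₁} ⋯ ∂_{iₙ} f (x)` for a word `w = (i₁, …, iₙ)`. For smooth `f` this is `∂^β f (x)` with
`β = wordIndex w`, and `|β| = n`; every multi-index `β` is the index of some word. -/
def wordDeriv {n : ℕ} (w : Fin n → ι) (f : Conf ι → ℂ) (x : Conf ι) : ℂ :=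
  iteratedFDeriv ℝ n f x fun k => EuclideanSpace.single (w k) (1 : ℝ)

/-- The norm of `f` in the Banach space `S^θ_{θ,C}` is at most `M`, i.e.
`|x^α ∂^β f(x)| ≤ M C^{|α|+|β|} (α!)^θ (β!)^θ` for all `α`, `β`, `x`. -/
def NormLE (θ C M : ℝ) (f : Conf ι → ℂ) : Prop :=
  ∀ (α : ι → ℕ) (n : ℕ) (w : Fin n → ι) (x : Conf ι),
    |monomialAt α x| * ‖wordDeriv w f x‖ ≤
      M * C ^ ((∑ i, α i) + n) * multiFactorial α ^ θ * multiFactorial (wordIndex w) ^ θ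

theorem one_le_multiFactorial (α : ι → ℕ) : 1 ≤ multiFactorial α := by
  have h : 1 ≤ ∏ i, (α i).factorial := Finset.prod_pos fun i _ => Nat.factorial_pos _
  unfold multiFactorial
  exact_mod_cast h

theorem NormLE.nonneg {θ C M : ℝ} {f : Conf ι → ℂ} (h : NormLE θ C M f) : 0 ≤ M := by
  have h0 := h 0 0 Fin.elim0 0
  have e : wordIndex (Fin.elim0 : Fin 0 → ι) = 0 := by
    funext i
    simp [wordIndex]
  have e0 : multiFactorial (0 : ι → ℕ) = 1 := by simp [multiFactorial]
  rw [e, e0] at h0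
  simp only [Pi.zero_apply, Finset.sum_const_zero, add_zero, pow_zero, mul_one,
    Real.one_rpow] at h0
  exact le_trans (by positivity) h0

theorem NormLE.mono {θ C C' M : ℝ} {f : Conf ι → ℂ} (h : NormLE θ C M f) (hC : 0 < C)
    (hCC : C ≤ C') : NormLE θ C' M f := by
  intro α n w x
  refine (h α n w x).trans ?_
  have h1 : 0 ≤ M := h.nonneg
  have h2 := (zero_le_one.trans (one_le_multiFactorial α))
  have h3 := (zero_le_one.trans (one_le_multiFactorial (wordIndex w)))
  gcongr

theorem NormLE.add {θ C M N : ℝ} {f g : Conf ι → ℂ} (hf : NormLE θ C M f) (hg : NormLE θ C N g)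
    (sf : ContDiff ℝ ∞ f) (sg : ContDiff ℝ ∞ g) : NormLE θ C (M + N) (f + g) := by
  intro α n w x
  have e : wordDeriv w (f + g) x = wordDeriv w f x + wordDeriv w g x := by
    unfold wordDeriv
    rw [iteratedFDeriv_add_apply (sf.contDiffAt.of_le (by exact_mod_cast le_top))
      (sg.contDiffAt.of_le (by exact_mod_cast le_top))]
    rfl
  rw [e]
  calc |monomialAt α x| * ‖wordDeriv w f x + wordDeriv w g x‖
      ≤ |monomialAt α x| * (‖wordDeriv w f x‖ + ‖wordDeriv w g x‖) := by
        gcongr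
        exact norm_add_le _ _
    _ = |monomialAt α x| * ‖wordDeriv w f x‖ + |monomialAt α x| * ‖wordDeriv w g x‖ := by ring
    _ ≤ _ := add_le_add (hf α n w x) (hg α n w x)
    _ = _ := by ring

theorem NormLE.smul {θ C M : ℝ} {f : Conf ι → ℂ} (hf : NormLE θ C M f) (c : ℂ)
    (sf : ContDiff ℝ ∞ f) : NormLE θ C (‖c‖ * M) (c • f) := by
  intro α n w x
  have e : wordDeriv w (c • f) x = c * wordDeriv w f x := by
    unfold wordDeriv
    rw [iteratedFDeriv_const_smul_apply (sf.contDiffAt.of_le (by exact_mod_cast le_top))]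
    rfl
  rw [e, norm_mul]
  calc |monomialAt α x| * (‖c‖ * ‖wordDeriv w f x‖)
      = ‖c‖ * (|monomialAt α x| * ‖wordDeriv w f x‖) := by ring
    _ ≤ ‖c‖ * _ := mul_le_mul_of_nonneg_left (hf α n w x) (norm_nonneg c)
    _ = _ := by ring

/-- The Gelfand-Shilov space `S_θ(ℝ^ι) = ⋃_{C>0} S^θ_{θ,C}(ℝ^ι)`. -/
def GS (θ : ℝ) (ι : Type) [Fintype ι] [DecidableEq ι] : Submodule ℂ (Conf ι → ℂ) where
  carrier := {f | ContDiff ℝ ∞ f ∧ ∃ C > 0, ∃ M, NormLE θ C M f}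
  zero_mem' := by
    refine ⟨contDiff_const, 1, one_pos, 0, fun α n w x => ?_⟩
    have e : wordDeriv w (0 : Conf ι → ℂ) x = 0 := by
      unfold wordDeriv
      rw [iteratedFDeriv_zero]
      rfl
    simp [e]
  add_mem' := by
    rintro f g ⟨sf, C, hC, M, hf⟩ ⟨sg, D, hD, N, hg⟩
    exact ⟨sf.add sg, max C D, lt_max_of_lt_left hC, M + N,
      (hf.mono hC (le_max_left _ _)).add (hg.mono hD (le_max_right _ _)) sf sg⟩
  smul_mem' := by
    rintro c f ⟨sf, C, hC, M, hf⟩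
    exact ⟨contDiff_const.smul sf, C, hC, ‖c‖ * M, hf.smul c sf⟩

/-- The space `S'_θ(ℝ^ι)` of tempered ultradistributions: linear forms on `S_θ` that are bounded
for the norm of `S^θ_{θ,ε}`, for every `ε > 0`. -/
def GSDual (θ : ℝ) (ι : Type) [Fintype ι] [DecidableEq ι] : Submodule ℂ (GS θ ι →ₗ[ℂ] ℂ) where
  carrier := {u | ∀ ε > 0, ∃ K : ℝ, ∀ (f : GS θ ι) (M : ℝ),
    NormLE θ ε M (f : Conf ι → ℂ) → ‖u f‖ ≤ K * M}
  zero_mem' := fun ε _ => ⟨0, fun f M _ => by simp⟩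
  add_mem' := by
    intro u v hu hv ε hε
    obtain ⟨K, hK⟩ := hu ε hε
    obtain ⟨L, hL⟩ := hv ε hε
    refine ⟨K + L, fun f M h => ?_⟩
    rw [LinearMap.add_apply, add_mul]
    exact (norm_add_le _ _).trans (add_le_add (hK f M h) (hL f M h))
  smul_mem' := by
    intro c u hu ε hε
    obtain ⟨K, hK⟩ := hu ε hε
    refine ⟨‖c‖ * K, fun f M h => ?_⟩
    rw [LinearMap.smul_apply, norm_smul, mul_assoc]
    exact mul_le_mul_of_nonneg_left (hK f M h) (norm_nonneg c)

open Classical in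
/-- The pairing `⟨u, g⟩` for a function `g` that belongs to `S_θ` (and `0` for other `g`). -/
def pairing {θ : ℝ} (u : GSDual θ ι) (g : Conf ι → ℂ) : ℂ :=
  if h : g ∈ GS θ ι then u.1 ⟨g, h⟩ else 0

/-- The ultradistribution `u` is the function `F`: `⟨u, g⟩ = ∫ F g` for all `g ∈ S_θ`. -/
def IsFunction {θ : ℝ} (u : GSDual θ ι) (F : Conf ι → ℂ) : Prop :=
  ∀ g : GS θ ι, u.1 g = ∫ x, F x * (g : Conf ι → ℂ) x

/-! ### FBI transform, wave front set and the spaces `S'_{θ,Γ}` -/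

/-- The standard phase `φ(z,y) = ⟨z,y⟩ + (i/2)|y|²`. -/
def phase (z : EuclideanSpace ℂ ι) (y : Conf ι) : ℂ :=
  ∑ j, z j * (y j : ℂ) + Complex.I / 2 * ((‖y‖ ^ 2 : ℝ) : ℂ)

/-- The FBI (Bargmann) transform `T_φ u(z) = c_φ ⟨u_y, e^{iφ(z,y)}⟩` with
`c_φ = 2^{-d/2} π^{-3d/4}`. For `θ ≥ 1/2` the function `e^{iφ(z,·)}` belongs to `S_θ`. -/
def fbi {θ : ℝ} (u : GSDual θ ι) (z : EuclideanSpace ℂ ι) : ℂ :=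
  (((2 : ℝ) ^ (-(Fintype.card ι : ℝ) / 2) * Real.pi ^ (-(3 * (Fintype.card ι : ℝ)) / 4) : ℝ) : ℂ) *
    pairing u fun y => Complex.exp (Complex.I * phase z y)

/-- The weight `Φ(z) = max_y (-Im φ(z,y)) = |Im z|²/2`. -/
def weight (z : EuclideanSpace ℂ ι) : ℝ := (∑ j, (z j).im ^ 2) / 2

/-- `χ^b_φ(x,ξ) = -ξ - ix`. -/
def toComplex (p : Phase ι) : EuclideanSpace ℂ ι :=
  WithLp.toLp 2 fun j => -(p.2 j : ℂ) - Complex.I * (p.1 j : ℂ)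

/-- `L` is an open conic neighbourhood of `z₀` in `ℂ^ι`. -/
def IsConicNhd (L : Set (EuclideanSpace ℂ ι)) (z₀ : EuclideanSpace ℂ ι) : Prop :=
  IsOpen L ∧ z₀ ∈ L ∧ ∀ z ∈ L, ∀ t : ℝ, 0 < t → (t : ℂ) • z ∈ L

/-- The global wave front set `WF^θ_gl(u) ⊆ T^*ℝ^ι ∖ 0`. -/
def WF {θ : ℝ} (u : GSDual θ ι) : Set (Phase ι) :=
  {p | p ≠ 0 ∧ ¬ ∃ L, IsConicNhd L (toComplex p) ∧ ∃ ε > 0, ∃ C : ℝ, ∀ z ∈ L,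
    ‖fbi u z‖ ≤ C * Real.exp (-ε * ‖z‖ ^ (1 / θ) + weight z)}

/-- `Γ` is a closed sub-cone of `T^*ℝ^ι ∖ 0` (closed relative to `T^*ℝ^ι ∖ 0`). -/
def IsClosedCone (Γ : Set (Phase ι)) : Prop :=
  0 ∉ Γ ∧ (∀ p ∈ Γ, ∀ t : ℝ, 0 < t → t • p ∈ Γ) ∧ closure Γ ⊆ Γ ∪ {0}

/-- The space `S'_{θ,Γ}(ℝ^ι)`. -/
def DualWF (θ : ℝ) (Γ : Set (Phase ι)) : Set (GSDual θ ι) := {u | WF u ⊆ Γ}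

/-- Convergence `uₙ → u` in `S'_{θ,Γ}`, i.e. `uₙ - u → 0` weakly in `S'_θ`, with exponential
bounds on the FBI transforms that are locally uniform off `Γ` and uniform in `n`. -/
def TendstoWF {θ : ℝ} (Γ : Set (Phase ι)) (un : ℕ → GSDual θ ι) (u : GSDual θ ι) : Prop :=
  (∀ n, un n ∈ DualWF θ Γ) ∧ u ∈ DualWF θ Γ ∧
  (∀ f : GS θ ι, Filter.Tendsto (fun n => (un n).1 f) Filter.atTop (𝓝 (u.1 f))) ∧
  ∀ p : Phase ι, p ≠ 0 → p ∉ Γ → ∃ L, IsConicNhd L (toComplex p) ∧ ∃ ε > 0, ∃ C : ℝ,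
    ∀ n, ∀ z ∈ L, ‖fbi (un n - u) z‖ ≤ C * Real.exp (-ε * ‖z‖ ^ (1 / θ) + weight z)

/-! ### Tensor products and the pull-back to the diagonal -/

/-- The point `(x, y)` of `ℝ^d × ℝ^d = ℝ^{2d}`. -/
def pair (x y : Conf ι) : Conf (ι ⊕ ι) := WithLp.toLp 2 (Sum.elim x y)

/-- `t = u ⊗ v`: the ultradistribution with `⟨t, f ⊗ g⟩ = ⟨u, f⟩ ⟨v, g⟩` for `f, g ∈ S_θ`. -/
def IsTensor {θ : ℝ} (u v : GSDual θ ι) (t : GSDual θ (ι ⊕ ι)) : Prop :=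
  ∀ (f g : GS θ ι) (h : GS θ (ι ⊕ ι)),
    (∀ x y, (h : Conf (ι ⊕ ι) → ℂ) (pair x y) = (f : Conf ι → ℂ) x * (g : Conf ι → ℂ) y) →
      t.1 h = u.1 f * v.1 g

/-- `((Γ₁ ∪ {0}) × (Γ₂ ∪ {0})) ∖ {(0,0)}` as a subset of `T^*ℝ^{2d}`. -/
def tensorCone (Γ₁ Γ₂ : Set (Phase ι)) : Set (Phase (ι ⊕ ι)) :=
  {q | ∃ x y ξ η : Conf ι, (x, ξ) ∈ Γ₁ ∪ {0} ∧ (y, η) ∈ Γ₂ ∪ {0} ∧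
    q = (pair x y, pair ξ η)} \ {0}

/-- `δ^*Γ = {(x, ξ + η) : ((x, x), (ξ, η)) ∈ Γ}` for the diagonal map `δ(x) = (x, x)`, whose
transpose is `(ξ, η) ↦ ξ + η`. -/
def diagCone (Γ : Set (Phase (ι ⊕ ι))) : Set (Phase ι) :=
  {p | ∃ x ξ η : Conf ι, (pair x x, pair ξ η) ∈ Γ ∧ p = (x, ξ + η)}

/-- `P` restricts on `S'_{θ,Γ}(ℝ^{2d})` to a (sequentially) continuous map
`S'_{θ,Γ}(ℝ^{2d}) → S'_{θ,δ^*Γ}(ℝ^d)` that extends the pull-back `F ↦ F ∘ δ` of functions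
`F ∈ S_θ(ℝ^{2d})`. -/
def IsDiagExtension {θ : ℝ} (Γ : Set (Phase (ι ⊕ ι))) (P : GSDual θ (ι ⊕ ι) → GSDual θ ι) : Prop :=
  (∀ t ∈ DualWF θ Γ, P t ∈ DualWF θ (diagCone Γ)) ∧
  (∀ tn t, TendstoWF Γ tn t → TendstoWF (diagCone Γ) (fun n => P (tn n)) (P t)) ∧
  ∀ F ∈ GS θ (ι ⊕ ι), ∀ t ∈ DualWF θ Γ, IsFunction t F → IsFunction (P t) fun x => F (pair x x)

/-- `w = δ^*t`: the value at `t` of a continuous extension of `F ↦ F ∘ δ` to `S'_{θ,Γ}(ℝ^{2d})`, for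
some closed cone `Γ` that contains `WF(t)` and no point `(0, (ξ, η))` with `ξ + η = 0`. -/
def IsDiagPullback {θ : ℝ} (t : GSDual θ (ι ⊕ ι)) (w : GSDual θ ι) : Prop :=
  ∃ Γ : Set (Phase (ι ⊕ ι)), IsClosedCone Γ ∧ (∀ ξ η : Conf ι, ξ + η = 0 → (0, pair ξ η) ∉ Γ) ∧
    t ∈ DualWF θ Γ ∧ ∃ P, IsDiagExtension Γ P ∧ P t = w

/-- `w = u · v`, defined as `δ^*(u ⊗ v)`. -/
def IsProduct {θ : ℝ} (u v w : GSDual θ ι) : Prop :=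
  ∃ t, IsTensor u v t ∧ IsDiagPullback t w

/-- `{(x, ξ + η) : (x, ξ) ∈ Γ₁, (x, η) ∈ Γ₂} ∪ Γ₁ ∪ Γ₂`. -/
def productCone (Γ₁ Γ₂ : Set (Phase ι)) : Set (Phase ι) :=
  {p | ∃ x ξ η : Conf ι, (x, ξ) ∈ Γ₁ ∧ (x, η) ∈ Γ₂ ∧ p = (x, ξ + η)} ∪ Γ₁ ∪ Γ₂

/-! ### Convolution -/

/-- The unitary Fourier transform `(2π)^{-d/2} ∫ e^{-i⟨x,ξ⟩} f(x) dx`. -/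
def fourierFun (f : Conf ι → ℂ) (ξ : Conf ι) : ℂ :=
  (((2 * Real.pi) ^ (-(Fintype.card ι : ℝ) / 2) : ℝ) : ℂ) *
    ∫ x, Complex.exp (-Complex.I * ((inner ℝ x ξ : ℝ) : ℂ)) * f x

/-- `û = 𝓕u`, i.e. `⟨û, f⟩ = ⟨u, 𝓕f⟩` for all `f ∈ S_θ` (`𝓕` maps `S_θ` into itself). -/
def IsFourier {θ : ℝ} (u uhat : GSDual θ ι) : Prop :=
  ∀ f : GS θ ι, uhat.1 f = pairing u (fourierFun (f : Conf ι → ℂ))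

/-- `w = u ∗ v`, defined by `𝓕w = (2π)^{d/2} 𝓕u · 𝓕v`. -/
def IsConvolution {θ : ℝ} (u v w : GSDual θ ι) : Prop :=
  ∃ uhat vhat p : GSDual θ ι, IsFourier u uhat ∧ IsFourier v vhat ∧ IsProduct uhat vhat p ∧
    IsFourier w ((((2 * Real.pi) ^ ((Fintype.card ι : ℝ) / 2) : ℝ) : ℂ) • p)

/-- `{(x + y, ξ) : (x, ξ) ∈ Γ₁ ∪ {0}, (y, ξ) ∈ Γ₂ ∪ {0}}` without the origin. -/
def convolutionCone (Γ₁ Γ₂ : Set (Phase ι)) : Set (Phase ι) :=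
  {p | ∃ x y ξ : Conf ι, (x, ξ) ∈ Γ₁ ∪ {0} ∧ (y, ξ) ∈ Γ₂ ∪ {0} ∧ p = (x + y, ξ)} \ {0}

end GelfandShilov

end

set_option linter.unusedSectionVars false

open MeasureTheory

noncomputable section

namespace GelfandShilov

/-! ### Elementary inequalities -/

/-! For `z = toComplex p` with `p = (x, ξ)`, completing the square shows that `e^{iφ(z,·)}` is
`e^{Φ(z)}` times the Gaussian wave packet `gaborAtom p`. The weight cancels, and the wave front set
consists of the nonzero `p` near which `stft u p = ⟨u, g_p⟩` fails to decay like `exp(-ε|p|^{1/θ})`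
in a cone (`exists_fbi_bound_iff`). The whole theorem thus becomes a statement about functions on
phase space.

The dictionary is as follows. Elements of `S_θ` have Gabor coefficients decaying like
`exp(-ε|p|^{1/θ})` for some `ε` (`norm_coeff_le`), ultradistributions have transforms growing slower
than `exp(ε|p|^{1/θ})` for every `ε` (`moderate_stft`), and `⟨u, f⟩` is an integral of the
coefficients of `f` against `stft u` (`apply_eq_integral`). Conversely every measurable `W` of
moderate growth defines an ultradistribution `ofModel`, whose transform is at most `|W|` convolved
with a Gaussian. Convergence in `S'_{θ,Γ}` becomes pointwise convergence with a common moderate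
majorant that decays off `Γ`; the majorant comes from Banach–Steinhaus (`TendstoWF.modelTendsto`,
`tendstoWF_ofModel`).

The transform of `u ⊗ v` is the product of the transforms, hence decays off `tensorCone`. In the
Gabor picture the pull-back to the diagonal has a kernel bounded by a Gaussian in `A p - B q`, with
`A p = (x₁, x₂, ξ₁ + ξ₂)` and `B q = (x, x, ξ)`. A compactness argument on unit directions
(`kernel_le_exp`, `kernel_le_exp_cone`) shows that the integral converges if the model decays along
`ker A`, the conormal directions of the diagonal, and that it decays near `q` if the model decays on
the fibre `A p = B q`. This gives existence, the cone `diagCone Γ` and continuity at once.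
Uniqueness holds because truncating `stft t` to balls approximates `t` in `S'_{θ,Γ}` by elements of
`S_θ`.

The Fourier transform maps atoms to atoms at points rotated by `(x, ξ) ↦ (-ξ, x)`, so the results on
convolutions are those on products, conjugated by this rotation. -/

theorem pow_le_factorial_rpow_mul_exp {θ ε r : ℝ} (hθ : 0 < θ) (hε : 0 < ε) (hr : 0 ≤ r) (n : ℕ) :
    r ^ n ≤ ((θ / ε) ^ θ) ^ n * (n.factorial : ℝ) ^ θ * Real.exp (ε * r ^ (1 / θ)) := by
  -- With this `a` the claim is the `θ`-th power of `a ^ n ≤ n! * exp a`, because `a * θ` is the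
  -- exponent wanted.
  set a := ε / θ * r ^ (1 / θ) with ha
  have ha0 : 0 ≤ a := by positivity
  have h1 : a ^ n ≤ n.factorial * Real.exp a := by
    have := Real.pow_div_factorial_le_exp a ha0 n
    rwa [div_le_iff₀ (by positivity), mul_comm] at this
  have h2 := Real.rpow_le_rpow (by positivity) h1 hθ.le
  rw [Real.mul_rpow (by positivity) (by positivity), ← Real.exp_mul] at h2
  have h3 : a * θ = ε * r ^ (1 / θ) := by rw [ha]; field_simp
  have h4 : r ^ n = ((θ / ε) ^ θ) ^ n * (a ^ n) ^ θ := by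
    have : (a ^ n) ^ θ = (a ^ θ) ^ n := by
      rw [← Real.rpow_natCast, ← Real.rpow_mul ha0, mul_comm, Real.rpow_mul ha0, Real.rpow_natCast]
    rw [this, ← mul_pow, ha, ← Real.mul_rpow (by positivity) (by positivity)]
    congr 1
    rw [show θ / ε * (ε / θ * r ^ (1 / θ)) = r ^ (1 / θ) by field_simp, ← Real.rpow_mul hr]
    rw [one_div_mul_cancel hθ.ne', Real.rpow_one]
  rw [h4, mul_assoc]
  rw [h3] at h2
  gcongr

theorem rpow_sum_le_sum_rpow {θ : ℝ} (hθ : 0 < θ) (hθ' : θ ≤ 1) (a : ℕ → ℝ) (ha : ∀ n, 0 ≤ a n)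
    (m : ℕ) : (∑ n ∈ Finset.range m, a n) ^ θ ≤ ∑ n ∈ Finset.range m, a n ^ θ := by
  induction m with
  | zero => simp [Real.zero_rpow hθ.ne']
  | succ m ih =>
    rw [Finset.sum_range_succ, Finset.sum_range_succ]
    refine (Real.rpow_add_le_add_rpow (Finset.sum_nonneg fun i _ => ha i) (ha m) hθ.le hθ').trans ?_
    gcongr

/-- Factorial bounds give exponential decay: with `b ^ θ = r / (2 * C)` the hypothesis reads `(b ^ n
/ n!) ^ θ * a ≤ M / 2 ^ n`, and subadditivity of `t ↦ t ^ θ` turns the sum of these bounds into one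
for `(exp b) ^ θ * a`. -/
theorem le_exp_of_forall_pow_mul_le {θ C M r a : ℝ} (hθ : 0 < θ) (hθ' : θ ≤ 1) (hC : 0 < C)
    (hr : 0 ≤ r) (ha : 0 ≤ a)
    (h : ∀ n : ℕ, r ^ n * a ≤ M * C ^ n * (n.factorial : ℝ) ^ θ) :
    a ≤ 2 * M * Real.exp (-(θ * (r / (2 * C)) ^ (1 / θ))) := by
  have hM : 0 ≤ M := by simpa using ha.trans (by simpa using h 0)
  set b := (r / (2 * C)) ^ (1 / θ) with hb
  have hb0 : 0 ≤ b := by positivity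
  have hbθ : b ^ θ = r / (2 * C) := by
    rw [hb, ← Real.rpow_mul (by positivity), one_div_mul_cancel hθ.ne', Real.rpow_one]
  have key : ∀ m : ℕ, (∑ n ∈ Finset.range m, b ^ n / n.factorial) ^ θ * a ≤ 2 * M := by
    intro m
    calc (∑ n ∈ Finset.range m, b ^ n / n.factorial) ^ θ * a
        ≤ (∑ n ∈ Finset.range m, (b ^ n / n.factorial) ^ θ) * a := by
          gcongr
          exact rpow_sum_le_sum_rpow hθ hθ' _ (fun n => by positivity) m
      _ = ∑ n ∈ Finset.range m, (b ^ n / n.factorial) ^ θ * a := by rw [Finset.sum_mul]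
      _ ≤ ∑ n ∈ Finset.range m, M * (1 / 2 : ℝ) ^ n := by
          refine Finset.sum_le_sum fun n _ => ?_
          have e : (b ^ n / n.factorial) ^ θ = (r / (2 * C)) ^ n / (n.factorial : ℝ) ^ θ := by
            rw [Real.div_rpow (by positivity) (by positivity), ← hbθ, ← Real.rpow_natCast,
              ← Real.rpow_natCast, ← Real.rpow_mul hb0, ← Real.rpow_mul hb0, mul_comm]
          have hf : 0 < (n.factorial : ℝ) ^ θ := by positivity
          rw [e, div_pow, mul_pow, one_div, inv_pow, div_div, div_mul_eq_mul_div,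
            div_le_iff₀ (by positivity)]
          calc r ^ n * a ≤ _ := h n
            _ = _ := by field_simp
      _ = M * ∑ n ∈ Finset.range m, (1 / 2 : ℝ) ^ n := by rw [Finset.mul_sum]
      _ ≤ M * 2 := by
          gcongr
          exact sum_geometric_two_le m
      _ = _ := mul_comm _ _
  have lim : Filter.Tendsto (fun m : ℕ => (∑ n ∈ Finset.range m, b ^ n / n.factorial) ^ θ * a)
      Filter.atTop (𝓝 (Real.exp b ^ θ * a)) := by
    refine Filter.Tendsto.mul_const _ (Filter.Tendsto.rpow_const ?_ (Or.inr hθ.le))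
    have := (NormedSpace.expSeries_div_hasSum_exp (𝔸 := ℝ) b).tendsto_sum_nat
    rwa [← Real.exp_eq_exp_ℝ] at this
  have := le_of_tendsto' lim key
  rw [← Real.exp_mul, mul_comm b θ] at this
  rw [Real.exp_neg, ← div_eq_mul_inv, le_div_iff₀ (Real.exp_pos _), mul_comm]
  exact this

/-- Used with `s = 1 / θ`: as `θ ≥ 1 / 2`, a small multiple of `r ^ (1 / θ)` is absorbed by a
Gaussian exponent. -/
theorem rpow_le_one_add_sq {r s : ℝ} (hr : 0 ≤ r) (hs : 0 ≤ s) (hs' : s ≤ 2) :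
    r ^ s ≤ 1 + r ^ 2 := by
  rcases le_total r 1 with h | h
  · exact (Real.rpow_le_one hr h hs).trans (by nlinarith)
  · have := Real.rpow_le_rpow_of_exponent_le h hs'
    rw [Real.rpow_two] at this
    linarith

/-- The constant `4` bounds `2 ^ s`; it is the source of the factors `4` and `8` lost whenever an
exponential weight is moved from one point to another. -/
theorem add_rpow_le_four_mul {a b s : ℝ} (ha : 0 ≤ a) (hb : 0 ≤ b) (hs : 0 ≤ s) (hs' : s ≤ 2) :
    (a + b) ^ s ≤ 4 * (a ^ s + b ^ s) := by
  have h2 : (2 : ℝ) ^ s ≤ 4 := by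
    have := Real.rpow_le_rpow_of_exponent_le (x := 2) (by norm_num) hs'
    rw [Real.rpow_two] at this
    linarith
  have ha' : 0 ≤ a ^ s := by positivity
  have hb' : 0 ≤ b ^ s := by positivity
  rcases le_total a b with h | h
  · calc (a + b) ^ s ≤ (2 * b) ^ s := by gcongr; linarith
      _ = 2 ^ s * b ^ s := Real.mul_rpow (by norm_num) hb
      _ ≤ 4 * b ^ s := by gcongr
      _ ≤ _ := by linarith
  · calc (a + b) ^ s ≤ (2 * a) ^ s := by gcongr; linarith
      _ = 2 ^ s * a ^ s := Real.mul_rpow (by norm_num) ha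
      _ ≤ 4 * a ^ s := by gcongr
      _ ≤ _ := by linarith

theorem le_one_add_rpow {r s : ℝ} (hr : 0 ≤ r) (hs : 1 ≤ s) : r ≤ 1 + r ^ s := by
  rcases le_total r 1 with h | h
  · have : 0 ≤ r ^ s := by positivity
    linarith
  · have := Real.rpow_le_rpow_of_exponent_le h hs
    rw [Real.rpow_one] at this
    linarith

/-- The admissible range of the Gelfand-Shilov index. -/
abbrev Admissible (θ : ℝ) : Prop := θ ∈ Set.Ico (1 / 2 : ℝ) 1

theorem Admissible.pos {θ : ℝ} (hθ : Admissible θ) : 0 < θ := by linarith [hθ.1]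

theorem Admissible.one_le_inv {θ : ℝ} (hθ : Admissible θ) : 1 ≤ 1 / θ := by
  rw [le_div_iff₀ hθ.pos]
  linarith [hθ.2]

theorem Admissible.inv_le_two {θ : ℝ} (hθ : Admissible θ) : 1 / θ ≤ 2 := by
  rw [div_le_iff₀ hθ.pos]
  linarith [hθ.1]

theorem Admissible.inv_nonneg {θ : ℝ} (hθ : Admissible θ) : 0 ≤ 1 / θ := by
  linarith [hθ.one_le_inv]

theorem continuous_exp_mul_norm_rpow {E : Type*} [NormedAddCommGroup E] {θ : ℝ}
    (hθ : Admissible θ) (ε : ℝ) : Continuous fun p : E => Real.exp (ε * ‖p‖ ^ (1 / θ)) :=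
  Real.continuous_exp.comp
    (continuous_const.mul (continuous_norm.rpow_const fun _ => Or.inr hθ.inv_nonneg))

/-! ### Integrability of stretched exponentials -/

section Integrability

variable {E : Type*} [NormedAddCommGroup E] [NormedSpace ℝ E] [FiniteDimensional ℝ E]
  [MeasurableSpace E] [BorelSpace E] (μ : Measure E) [μ.IsAddHaarMeasure]

theorem integrable_exp_neg_mul_norm {ε : ℝ} (hε : 0 < ε) :
    Integrable (fun p : E => Real.exp (-ε * ‖p‖)) μ := by
  set m := Module.finrank ℝ E + 1
  have h := (integrable_one_add_norm (E := E) (μ := μ) (r := (m : ℝ))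
    (by simp [m])).const_mul ((m.factorial : ℝ) / ε ^ m * Real.exp ε)
  refine h.mono' (by fun_prop) (Filter.Eventually.of_forall fun p => ?_)
  have h1 : 0 < 1 + ‖p‖ := by positivity
  have h2 := Real.pow_div_factorial_le_exp (ε * (1 + ‖p‖)) (by positivity) m
  rw [Real.norm_of_nonneg (by positivity), Real.rpow_neg h1.le, Real.rpow_natCast, neg_mul,
    Real.exp_neg, ← div_eq_mul_inv, le_div_iff₀ (by positivity), inv_mul_le_iff₀ (by positivity)]
  rw [div_le_iff₀ (by positivity), mul_pow, mul_add, Real.exp_add, mul_one] at h2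
  calc (1 + ‖p‖) ^ m = (ε ^ m * (1 + ‖p‖) ^ m) / ε ^ m := by field_simp
    _ ≤ (Real.exp ε * Real.exp (ε * ‖p‖) * m.factorial) / ε ^ m := by gcongr
    _ = _ := by ring

theorem integrable_exp_neg_mul_norm_rpow {θ ε : ℝ} (hθ : Admissible θ) (hε : 0 < ε) :
    Integrable (fun p : E => Real.exp (-ε * ‖p‖ ^ (1 / θ))) μ := by
  refine ((integrable_exp_neg_mul_norm μ hε).const_mul (Real.exp ε)).mono'
    ?_ (Filter.Eventually.of_forall fun p => ?_)
  · exact (continuous_exp_mul_norm_rpow hθ (-ε)).aestronglyMeasurable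
  · rw [Real.norm_of_nonneg (by positivity), ← Real.exp_add]
    gcongr
    nlinarith [le_one_add_rpow (norm_nonneg p) hθ.one_le_inv]

theorem integrable_exp_neg_mul_norm_sq {ε : ℝ} (hε : 0 < ε) :
    Integrable (fun p : E => Real.exp (-ε * ‖p‖ ^ 2)) μ := by
  have h := integrable_exp_neg_mul_norm_rpow μ (E := E) (θ := 1 / 2) ⟨le_rfl, by norm_num⟩ hε
  simpa using h

end Integrability

variable {ι : Type} [Fintype ι] [DecidableEq ι]

/-! ### The norms of `S_θ` in terms of Fréchet derivatives -/

/-- Each new index costs a binomial coefficient, at most a power of two. The purpose is to compare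
`|β|!`, natural for Fréchet derivatives, with `β!`, which enters `NormLE`. -/
theorem factorial_sum_le (α : ι → ℕ) (s : Finset ι) :
    ((∑ i ∈ s, α i).factorial : ℝ) ≤
      ((2 : ℝ) ^ s.card) ^ (∑ i ∈ s, α i) * ∏ i ∈ s, ((α i).factorial : ℝ) := by
  induction s using Finset.induction_on with
  | empty => simp
  | insert a s ha ih =>
    rw [Finset.sum_insert ha, Finset.prod_insert ha, Finset.card_insert_of_notMem ha]
    set b := ∑ i ∈ s, α i
    set P := ∏ i ∈ s, ((α i).factorial : ℝ)
    have h1 : (α a + b).factorial = (α a + b).choose (α a) * (α a).factorial * b.factorial := by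
      rw [← Nat.add_choose_mul_factorial_mul_factorial, Nat.choose_symm_add]
    have h2 : ((α a + b).choose (α a) : ℝ) ≤ 2 ^ (α a + b) := by
      exact_mod_cast Nat.choose_le_two_pow _ _
    rw [h1]
    push_cast
    calc ((α a + b).choose (α a) : ℝ) * (α a).factorial * b.factorial
        ≤ 2 ^ (α a + b) * (α a).factorial * (((2 : ℝ) ^ s.card) ^ b * P) := by gcongr
      _ ≤ 2 ^ (α a + b) * (α a).factorial * (((2 : ℝ) ^ s.card) ^ (α a + b) * P) := by
          have h3 : ((2 : ℝ) ^ s.card) ^ b ≤ ((2 : ℝ) ^ s.card) ^ (α a + b) :=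
            pow_le_pow_right₀ (one_le_pow₀ (by norm_num)) (by omega)
          have hP : 0 ≤ P := Finset.prod_nonneg fun i _ => by positivity
          gcongr
      _ = _ := by rw [pow_succ, mul_pow]; ring

theorem sum_wordIndex {n : ℕ} (w : Fin n → ι) : ∑ i, wordIndex w i = n := by
  unfold wordIndex
  rw [← Finset.card_eq_sum_card_fiberwise (fun _ _ => Finset.mem_coe.2 (Finset.mem_univ _))]
  simp

theorem multiFactorial_le (α : ι → ℕ) : multiFactorial α ≤ ((∑ i, α i).factorial : ℝ) := by
  unfold multiFactorial
  exact_mod_cast Nat.le_of_dvd (Nat.factorial_pos _) (Nat.prod_factorial_dvd_factorial_sum _ _)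

theorem factorial_le_multiFactorial (α : ι → ℕ) {n : ℕ} (hn : ∑ i, α i = n) :
    (n.factorial : ℝ) ≤ ((2 : ℝ) ^ Fintype.card ι) ^ n * multiFactorial α := by
  have := factorial_sum_le α Finset.univ
  rwa [hn] at this

/-- Expanding every argument in the standard basis gives one term for each word, and no coordinate
exceeds the norm. -/
theorem norm_le_sum_words {n : ℕ} (m : ContinuousMultilinearMap ℝ (fun _ : Fin n => Conf ι) ℂ)
    {B : ℝ} (hB : 0 ≤ B)
    (h : ∀ w : Fin n → ι, ‖m fun k => EuclideanSpace.single (w k) (1 : ℝ)‖ ≤ B) :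
    ‖m‖ ≤ (Fintype.card ι : ℝ) ^ n * B := by
  refine m.opNorm_le_bound (by positivity) fun v => ?_
  have hv : v = fun k => ∑ j, v k j • EuclideanSpace.single j (1 : ℝ) := by
    funext k
    ext i
    simp [Pi.single_apply]
  conv_lhs => rw [hv]
  change ‖m.toMultilinearMap _‖ ≤ _
  rw [MultilinearMap.map_sum]
  refine (norm_sum_le _ _).trans ?_
  have hb : ∀ r : Fin n → ι,
      ‖m.toMultilinearMap fun k => v k (r k) • EuclideanSpace.single (r k) (1 : ℝ)‖ ≤
        B * ∏ k, ‖v k‖ := by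
    intro r
    rw [MultilinearMap.map_smul_univ, norm_smul, mul_comm, norm_prod]
    gcongr with k
    · exact h r
    · exact EuclideanSpace.norm_eq (v k) ▸ Real.le_sqrt_of_sq_le
        (Finset.single_le_sum (f := fun i => ‖v k i‖ ^ 2) (fun _ _ => by positivity)
          (Finset.mem_univ _))
  refine (Finset.sum_le_sum fun r _ => hb r).trans ?_
  simp [mul_assoc]

theorem abs_monomialAt_le (α : ι → ℕ) (x : Conf ι) : |monomialAt α x| ≤ ‖x‖ ^ ∑ i, α i := by
  unfold monomialAt
  rw [Finset.abs_prod, ← Finset.prod_pow_eq_pow_sum]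
  gcongr with i
  rw [abs_pow]
  gcongr
  exact PiLp.norm_apply_le x i

theorem norm_wordDeriv_le {n : ℕ} (w : Fin n → ι) (f : Conf ι → ℂ) (x : Conf ι) :
    ‖wordDeriv w f x‖ ≤ ‖iteratedFDeriv ℝ n f x‖ := by
  unfold wordDeriv
  refine (ContinuousMultilinearMap.le_opNorm _ _).trans ?_
  simp

/-- Powers of `‖y‖` and Fréchet derivatives are easier to estimate than monomials and partial
derivatives; passing to the latter changes the scale `C` but not `M`. -/
theorem normLE_of_iteratedFDeriv {θ C M : ℝ} {f : Conf ι → ℂ} (hθ : 0 < θ) (hC : 0 < C)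
    (hM : 0 ≤ M)
    (h : ∀ (k n : ℕ) (y : Conf ι), ‖y‖ ^ k * ‖iteratedFDeriv ℝ n f y‖ ≤
      M * C ^ (k + n) * (k.factorial : ℝ) ^ θ * (n.factorial : ℝ) ^ θ) :
    NormLE θ (((2 : ℝ) ^ Fintype.card ι) ^ θ * C) M f := by
  intro α n w x
  have key : ∀ (β : ι → ℕ) (m : ℕ), ∑ i, β i = m →
      (m.factorial : ℝ) ^ θ ≤ (((2 : ℝ) ^ Fintype.card ι) ^ θ) ^ m * multiFactorial β ^ θ := by
    intro β m hm
    have h0 := zero_le_one.trans (one_le_multiFactorial β)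
    refine (Real.rpow_le_rpow (by positivity) (factorial_le_multiFactorial β hm) hθ.le).trans ?_
    rw [Real.mul_rpow (by positivity) h0, ← Real.rpow_pow_comm (by positivity)]
  have h1 := key α _ rfl
  have h2 := key (wordIndex w) _ (sum_wordIndex w)
  have h0 := zero_le_one.trans (one_le_multiFactorial α)
  calc |monomialAt α x| * ‖wordDeriv w f x‖
      ≤ ‖x‖ ^ (∑ i, α i) * ‖iteratedFDeriv ℝ n f x‖ := by
        gcongr
        · exact abs_monomialAt_le α x
        · exact norm_wordDeriv_le w f x
    _ ≤ _ := h _ _ _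
    _ ≤ M * C ^ ((∑ i, α i) + n) *
        ((((2 : ℝ) ^ Fintype.card ι) ^ θ) ^ (∑ i, α i) * multiFactorial α ^ θ) *
        ((((2 : ℝ) ^ Fintype.card ι) ^ θ) ^ n * multiFactorial (wordIndex w) ^ θ) := by
        gcongr
    _ = _ := by rw [mul_pow, pow_add, pow_add]; ring

theorem NormLE.norm_iteratedFDeriv_le {θ C M : ℝ} {f : Conf ι → ℂ} (h : NormLE θ C M f)
    (hθ : 0 < θ) (hC : 0 < C) (n : ℕ) (y : Conf ι) :
    ‖iteratedFDeriv ℝ n f y‖ ≤ M * (Fintype.card ι * C) ^ n * (n.factorial : ℝ) ^ θ := by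
  have hM := h.nonneg
  have := norm_le_sum_words (iteratedFDeriv ℝ n f y) (B := M * C ^ n * (n.factorial : ℝ) ^ θ)
    (by positivity) fun w => by
      have h0 := h 0 n w y
      have e0 : multiFactorial (0 : ι → ℕ) = 1 := by simp [multiFactorial]
      have e1 : monomialAt (0 : ι → ℕ) y = 1 := by simp [monomialAt]
      simp only [e0, e1, Pi.zero_apply, Finset.sum_const_zero, zero_add, abs_one, one_mul,
        Real.one_rpow, mul_one] at h0
      refine h0.trans ?_
      have h1 := multiFactorial_le (wordIndex w)
      rw [sum_wordIndex] at h1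
      have h2 := zero_le_one.trans (one_le_multiFactorial (wordIndex w))
      gcongr
  refine this.trans (le_of_eq ?_)
  rw [mul_pow]
  ring

theorem NormLE.norm_apply_le {θ C M : ℝ} {f : Conf ι → ℂ} (h : NormLE θ C M f)
    (hθ : Admissible θ) (hC : 0 < C) (y : Conf ι) :
    ‖f y‖ ≤ 2 * M * Real.exp
      (-(θ * (1 / (2 * C * (Fintype.card ι + 1))) ^ (1 / θ)) * ‖y‖ ^ (1 / θ)) := by
  have hM := h.nonneg
  have hw : ∀ α : ι → ℕ, |monomialAt α y| * ‖f y‖ ≤ M * C ^ (∑ i, α i) * multiFactorial α ^ θ := by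
    intro α
    have h0 := h α 0 Fin.elim0 y
    have e : wordIndex (Fin.elim0 : Fin 0 → ι) = 0 := by
      funext i
      simp [wordIndex]
    have e0 : multiFactorial (0 : ι → ℕ) = 1 := by simp [multiFactorial]
    rw [e, e0] at h0
    simpa [wordDeriv] using h0
  -- In dimension zero there is no largest coordinate; there `‖y‖ = 0` and the exponential equals
  -- `1`.
  by_cases hι : IsEmpty ι
  · have hy : y = 0 := Subsingleton.elim _ _
    have h0 := hw 0
    have e0 : multiFactorial (0 : ι → ℕ) = 1 := by simp [multiFactorial]
    have e1 : monomialAt (0 : ι → ℕ) y = 1 := by simp [monomialAt]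
    simp only [e0, e1] at h0
    have hs : (0 : ℝ) ^ θ⁻¹ = 0 := Real.zero_rpow (inv_ne_zero hθ.pos.ne')
    simp [hy, hs] at h0 ⊢
    linarith
  rw [not_isEmpty_iff] at hι
  -- The largest coordinate is comparable to the norm, so the pure powers of `y j` suffice.
  obtain ⟨j, -, hj⟩ := Finset.exists_max_image (Finset.univ : Finset ι) (fun i => |y i|)
    Finset.univ_nonempty
  have hyj : ‖y‖ ≤ (Fintype.card ι + 1) * |y j| := by
    have h1 : ‖y‖ ≤ ∑ i, |y i| := by
      rw [EuclideanSpace.norm_eq]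
      refine Real.sqrt_le_iff.2 ⟨by positivity, ?_⟩
      simp only [Real.norm_eq_abs]
      exact Finset.sum_sq_le_sq_sum_of_nonneg fun i _ => abs_nonneg _
    have h2 : ∑ i, |y i| ≤ ∑ _i : ι, |y j| := Finset.sum_le_sum fun i hi => hj i hi
    simp at h2
    nlinarith [abs_nonneg (y j)]
  have key := le_exp_of_forall_pow_mul_le (r := |y j|) (a := ‖f y‖) (M := M) hθ.pos hθ.2.le hC
    (abs_nonneg _) (norm_nonneg _) fun n => by
      have h0 := hw (Pi.single j n)
      have e0 : multiFactorial (Pi.single j n : ι → ℕ) = n.factorial := by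
        unfold multiFactorial
        rw [Finset.prod_eq_single j] <;> simp +contextual
      have e1 : monomialAt (Pi.single j n : ι → ℕ) y = y j ^ n := by
        unfold monomialAt
        rw [Finset.prod_eq_single j] <;> simp +contextual
      rw [e0, e1, abs_pow] at h0
      simpa using h0
  refine key.trans ?_
  gcongr
  rw [neg_mul, neg_le_neg_iff, mul_assoc, ← Real.mul_rpow (by positivity) (by positivity)]
  have := hθ.pos
  have h3 : 1 / (2 * C * (Fintype.card ι + 1)) * ‖y‖ ≤ |y j| / (2 * C) := by
    rw [div_mul_eq_mul_div, one_mul, div_le_div_iff₀ (by positivity) (by positivity)]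
    calc ‖y‖ * (2 * C) ≤ ((Fintype.card ι + 1) * |y j|) * (2 * C) := by gcongr
      _ = _ := by ring
  gcongr

/-! ### Gabor atoms -/

/-- The Gaussian wave packet `y ↦ exp (-|y-x|²/2 - i⟨ξ,y⟩)` at the phase space point `(x, ξ)`. -/
def gaborAtom (p : Phase ι) (y : Conf ι) : ℂ :=
  Complex.exp (-((‖y - p.1‖ ^ 2 / 2 : ℝ) : ℂ) - Complex.I * ((inner ℝ p.2 y : ℝ) : ℂ))

theorem norm_gaborAtom (p : Phase ι) (y : Conf ι) :
    ‖gaborAtom p y‖ = Real.exp (-(‖y - p.1‖ ^ 2 / 2)) := by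
  rw [gaborAtom, Complex.norm_exp, Complex.sub_re, Complex.neg_re, Complex.ofReal_re,
    Complex.re_mul_ofReal, Complex.I_re, zero_mul, sub_zero]

theorem norm_gaborAtom_le_one (p : Phase ι) (y : Conf ι) : ‖gaborAtom p y‖ ≤ 1 := by
  rw [norm_gaborAtom, Real.exp_le_one_iff]
  have := sq_nonneg ‖y - p.1‖
  linarith

theorem contDiff_gaborAtom :
    ContDiff ℝ ∞ (fun q : Phase ι × Conf ι => gaborAtom q.1 q.2) := by
  unfold gaborAtom
  refine ContDiff.cexp (ContDiff.sub (ContDiff.neg ?_) (contDiff_const.mul ?_))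
  · exact Complex.ofRealCLM.contDiff.comp
      (((contDiff_snd.sub (contDiff_fst.comp contDiff_fst)).norm_sq ℝ).div_const 2)
  · exact Complex.ofRealCLM.contDiff.comp ((contDiff_snd.comp contDiff_fst).inner ℝ contDiff_snd)

theorem contDiff_gaborAtom_apply (p : Phase ι) : ContDiff ℝ ∞ (gaborAtom p) :=
  ContDiff.comp (g := fun q : Phase ι × Conf ι => gaborAtom q.1 q.2) (f := fun y => (p, y))
    contDiff_gaborAtom (contDiff_const.prodMk contDiff_id)

theorem continuous_gaborAtom : Continuous (fun q : Phase ι × Conf ι => gaborAtom q.1 q.2) :=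
  contDiff_gaborAtom.continuous

/-- The logarithmic derivative of a Gabor atom. -/
def gaborSlope (p : Phase ι) (y : Conf ι) : Conf ι →L[ℝ] ℂ :=
  -(Complex.ofRealCLM ∘L innerSL ℝ (y - p.1)) - Complex.I • (Complex.ofRealCLM ∘L innerSL ℝ p.2)

theorem hasFDerivAt_gaborAtom (p : Phase ι) (y : Conf ι) :
    HasFDerivAt (gaborAtom p) (gaborAtom p y • gaborSlope p y) y := by
  have h1 : HasFDerivAt (fun y : Conf ι => ‖y - p.1‖ ^ 2 / 2) (innerSL ℝ (y - p.1)) y := by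
    have := ((hasFDerivAt_id y).sub_const p.1).norm_sq.mul_const (1 / 2 : ℝ)
    simp only [id, ← div_eq_mul_one_div] at this
    refine this.congr_fderiv ?_
    ext v
    simp
  have h2 : HasFDerivAt (fun y : Conf ι => (inner ℝ p.2 y : ℝ)) (innerSL ℝ p.2) y :=
    (innerSL ℝ p.2).hasFDerivAt
  have h3 := ((Complex.ofRealCLM.hasFDerivAt.comp y h1).neg.sub
    ((Complex.ofRealCLM.hasFDerivAt.comp y h2).const_smul Complex.I)).cexp
  exact h3

theorem norm_gaborSlope_le (p : Phase ι) (y : Conf ι) :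
    ‖gaborSlope p y‖ ≤ ‖y - p.1‖ + ‖p.2‖ := by
  have h : ∀ v : Conf ι, ‖Complex.ofRealCLM ∘L innerSL ℝ v‖ ≤ ‖v‖ := fun v => by
    refine (ContinuousLinearMap.opNorm_comp_le _ _).trans ?_
    simp
  unfold gaborSlope
  refine (norm_sub_le _ _).trans ?_
  rw [norm_neg, norm_smul, Complex.norm_I, one_mul]
  exact add_le_add (h _) (h _)

/-- The linear part of `gaborSlope`. -/
def gaborSlopeLinear (ι : Type) [Fintype ι] [DecidableEq ι] : Conf ι →L[ℝ] Conf ι →L[ℝ] ℂ :=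
  -((ContinuousLinearMap.compL ℝ (Conf ι) ℝ ℂ Complex.ofRealCLM) ∘L innerSL ℝ)

theorem norm_gaborSlopeLinear_le : ‖gaborSlopeLinear ι‖ ≤ 1 := by
  refine ContinuousLinearMap.opNorm_le_bound _ zero_le_one fun v => ?_
  change ‖-(Complex.ofRealCLM ∘L innerSL ℝ v)‖ ≤ _
  rw [norm_neg]
  refine (ContinuousLinearMap.opNorm_comp_le _ _).trans ?_
  simp

theorem gaborSlope_eq (p : Phase ι) : gaborSlope p = fun y => gaborSlopeLinear ι y +
      (Complex.ofRealCLM ∘L innerSL ℝ p.1 - Complex.I • (Complex.ofRealCLM ∘L innerSL ℝ p.2)) := by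
  funext y
  ext v
  have : (innerSL ℝ (y - p.1) : Conf ι → ℝ) v = inner ℝ y v - inner ℝ p.1 v :=
    inner_sub_left y p.1 v
  change -(((innerSL ℝ (y - p.1) v : ℝ)) : ℂ) - Complex.I * ((inner ℝ p.2 v : ℝ) : ℂ) =
    -((inner ℝ y v : ℝ) : ℂ) + (((inner ℝ p.1 v : ℝ) : ℂ) - Complex.I * ((inner ℝ p.2 v : ℝ) : ℂ))
  rw [this]
  push_cast
  ring

theorem hasFDerivAt_gaborSlope (p : Phase ι) (y : Conf ι) :
    HasFDerivAt (gaborSlope p) (gaborSlopeLinear ι) y := by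
  rw [gaborSlope_eq]
  exact (gaborSlopeLinear ι).hasFDerivAt.add_const _

theorem contDiff_gaborSlope (p : Phase ι) : ContDiff ℝ ∞ (gaborSlope p) := by
  rw [gaborSlope_eq]
  exact (gaborSlopeLinear ι).contDiff.add contDiff_const

theorem norm_iteratedFDeriv_gaborSlope_one (p : Phase ι) (y : Conf ι) :
    ‖iteratedFDeriv ℝ 1 (gaborSlope p) y‖ ≤ 1 := by
  rw [show (1 : ℕ) = 0 + 1 from rfl, ← norm_iteratedFDeriv_fderiv, norm_iteratedFDeriv_zero,
    (hasFDerivAt_gaborSlope p y).fderiv]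
  exact norm_gaborSlopeLinear_le

theorem norm_iteratedFDeriv_gaborSlope_add_two (p : Phase ι) (y : Conf ι) (n : ℕ) :
    ‖iteratedFDeriv ℝ (n + 2) (gaborSlope p) y‖ = 0 := by
  rw [show n + 2 = (n + 1) + 1 from rfl, ← norm_iteratedFDeriv_fderiv]
  have : fderiv ℝ (gaborSlope p) = fun _ => gaborSlopeLinear ι :=
    funext fun y => (hasFDerivAt_gaborSlope p y).fderiv
  rw [this, iteratedFDeriv_const_of_ne (by omega)]
  simp

/-- In the Leibniz rule for the derivative `g · slope` only two terms survive, since the slope is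
affine in `y`. This is a Hermite-type recurrence. -/
theorem norm_iteratedFDeriv_gaborAtom_add_two (p : Phase ι) (y : Conf ι) (n : ℕ) :
    ‖iteratedFDeriv ℝ (n + 2) (gaborAtom p) y‖ ≤
      (‖y - p.1‖ + ‖p.2‖) * ‖iteratedFDeriv ℝ (n + 1) (gaborAtom p) y‖ +
        (n + 1) * ‖iteratedFDeriv ℝ n (gaborAtom p) y‖ := by
  have hfd : fderiv ℝ (gaborAtom p) = fun y => gaborAtom p y • gaborSlope p y :=
    funext fun y => (hasFDerivAt_gaborAtom p y).fderiv
  rw [show n + 2 = (n + 1) + 1 from rfl, ← norm_iteratedFDeriv_fderiv, hfd]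
  refine (norm_iteratedFDeriv_smul_le (contDiff_gaborAtom_apply p) (contDiff_gaborSlope p) y
    (n := n + 1) (by exact_mod_cast le_top)).trans ?_
  rw [Finset.sum_range_succ, Finset.sum_range_succ, Finset.sum_eq_zero]
  · rw [show n + 1 - n = 1 by omega, show n + 1 - (n + 1) = 0 by omega, Nat.choose_self,
      norm_iteratedFDeriv_zero, Nat.choose_succ_self_right]
    have h1 := norm_iteratedFDeriv_gaborSlope_one p y
    have h2 := norm_gaborSlope_le p y
    push_cast
    calc 0 + ((n : ℝ) + 1) * ‖iteratedFDeriv ℝ n (gaborAtom p) y‖ *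
          ‖iteratedFDeriv ℝ 1 (gaborSlope p) y‖ +
          1 * ‖iteratedFDeriv ℝ (n + 1) (gaborAtom p) y‖ * ‖gaborSlope p y‖
        ≤ 0 + ((n : ℝ) + 1) * ‖iteratedFDeriv ℝ n (gaborAtom p) y‖ * 1 +
          1 * ‖iteratedFDeriv ℝ (n + 1) (gaborAtom p) y‖ * (‖y - p.1‖ + ‖p.2‖) := by
          gcongr
      _ = _ := by ring
  · intro i hi
    obtain ⟨m, hm⟩ : ∃ m, n + 1 - i = m + 2 := ⟨n - 1 - i, by have := Finset.mem_range.1 hi; omega⟩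
    rw [hm, norm_iteratedFDeriv_gaborSlope_add_two, mul_zero]

theorem norm_iteratedFDeriv_gaborAtom_one (p : Phase ι) (y : Conf ι) :
    ‖iteratedFDeriv ℝ 1 (gaborAtom p) y‖ ≤ ‖gaborAtom p y‖ * (‖y - p.1‖ + ‖p.2‖) := by
  rw [show (1 : ℕ) = 0 + 1 from rfl, ← norm_iteratedFDeriv_fderiv, norm_iteratedFDeriv_zero,
    (hasFDerivAt_gaborAtom p y).fderiv, norm_smul]
  gcongr
  exact norm_gaborSlope_le p y

/-- The majorant is compatible with the recurrence because `l * (l + r) + r ^ 2 ≤ (l + r) ^ 2` for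
`r = √(n + 1)`. -/
theorem le_mul_add_sqrt_pow {a : ℕ → ℝ} {G l : ℝ} (hG : 0 ≤ G) (hl : 0 ≤ l) (h0 : a 0 ≤ G)
    (h1 : a 1 ≤ G * l) (h2 : ∀ n, a (n + 2) ≤ l * a (n + 1) + (n + 1) * a n) (n : ℕ) :
    a n ≤ G * (l + √n) ^ n := by
  induction n using Nat.twoStepInduction with
  | zero => simpa using h0
  | one =>
    refine h1.trans ?_
    rw [pow_one]
    gcongr
    linarith [Real.sqrt_nonneg ((1 : ℕ) : ℝ)]
  | more n ih0 ih1 =>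
    set r := √((n : ℝ) + 1) with hr
    have hr2 : (n : ℝ) + 1 = r ^ 2 := (Real.sq_sqrt (by positivity)).symm
    have hr0 : 0 ≤ r := Real.sqrt_nonneg _
    have hn : √(n : ℝ) ≤ r := Real.sqrt_le_sqrt (by linarith)
    have hn' : r ≤ √((n + 2 : ℕ) : ℝ) := Real.sqrt_le_sqrt (by push_cast; linarith)
    push_cast at ih1
    rw [← hr] at ih1
    calc a (n + 2) ≤ l * a (n + 1) + (n + 1) * a n := h2 n
      _ ≤ l * (G * (l + r) ^ (n + 1)) + (n + 1) * (G * (l + √n) ^ n) := by gcongr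
      _ ≤ l * (G * (l + r) ^ (n + 1)) + (n + 1) * (G * (l + r) ^ n) := by gcongr
      _ = G * (l + r) ^ n * (l * (l + r) + r ^ 2) := by rw [hr2]; ring
      _ ≤ G * (l + r) ^ n * (l + r) ^ 2 := by
          gcongr
          nlinarith [mul_nonneg hl hr0]
      _ = G * (l + r) ^ (n + 2) := by ring
      _ ≤ _ := by gcongr

theorem norm_iteratedFDeriv_gaborAtom_le (p : Phase ι) (y : Conf ι) (n : ℕ) :
    ‖iteratedFDeriv ℝ n (gaborAtom p) y‖ ≤
      ‖gaborAtom p y‖ * (‖y - p.1‖ + ‖p.2‖ + √n) ^ n :=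
  le_mul_add_sqrt_pow (a := fun n => ‖iteratedFDeriv ℝ n (gaborAtom p) y‖) (norm_nonneg _)
    (by positivity) (by simp)
    (norm_iteratedFDeriv_gaborAtom_one p y) (norm_iteratedFDeriv_gaborAtom_add_two p y) n

/-- Either `l` or `√n` dominates. In the second case `(√n) ^ n ≤ exp n * (n!) ^ (1 / 2)`, and `θ ≥ 1
/ 2` allows the exponent `θ`: this is why Gaussians belong to `S_θ`. -/
theorem add_sqrt_pow_le {θ ε : ℝ} (hθ : Admissible θ) (hε : 0 < ε) : ∃ C > 0, ∀ l : ℝ, 0 ≤ l →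
    ∀ n : ℕ, (l + √n) ^ n ≤ 2 * C ^ n * (n.factorial : ℝ) ^ θ * Real.exp (ε * l ^ (1 / θ)) := by
  have hθ0 := hθ.pos
  set c := (θ / ε) ^ θ with hc
  have hc0 : 0 < c := by positivity
  refine ⟨2 * (c + Real.exp 1), by positivity, fun l hl n => ?_⟩
  have h1 := pow_le_factorial_rpow_mul_exp hθ0 hε hl n
  rw [← hc] at h1
  have hfac : (1 : ℝ) ≤ n.factorial := by exact_mod_cast Nat.factorial_pos n
  have h2 : (√n) ^ n ≤ Real.exp 1 ^ n * (n.factorial : ℝ) ^ θ := by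
    have h3 := Real.pow_div_factorial_le_exp (n : ℝ) (by positivity) n
    rw [div_le_iff₀ (by positivity)] at h3
    calc (√n) ^ n = √((n : ℝ) ^ n) := by
          rw [Real.sqrt_eq_rpow, Real.sqrt_eq_rpow, Real.rpow_pow_comm (by positivity)]
      _ ≤ √(Real.exp n * n.factorial) := Real.sqrt_le_sqrt h3
      _ = √(Real.exp n) * √(n.factorial : ℝ) := Real.sqrt_mul (by positivity) _
      _ ≤ Real.exp n * (n.factorial : ℝ) ^ θ := by
          have he : 1 ≤ Real.exp (n : ℝ) := Real.one_le_exp (by positivity)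
          have h4 : √(Real.exp n) ≤ Real.exp n := by
            rw [Real.sqrt_le_left (by positivity)]
            nlinarith
          rw [Real.sqrt_eq_rpow (n.factorial : ℝ)]
          have h5 := Real.rpow_le_rpow_of_exponent_le hfac hθ.1
          gcongr
      _ = _ := by rw [← Real.exp_nat_mul, mul_one]
  have hE : 1 ≤ Real.exp (ε * l ^ (1 / θ)) := Real.one_le_exp (by positivity)
  have h6 : (l + √n) ^ n ≤ 2 ^ n * (l ^ n + (√n) ^ n) := by
    have hs := Real.sqrt_nonneg (n : ℝ)
    rcases le_total l (√n) with h | h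
    · calc (l + √n) ^ n ≤ (2 * √n) ^ n := by gcongr; linarith
        _ = 2 ^ n * (√n) ^ n := mul_pow _ _ _
        _ ≤ _ := by gcongr; linarith [pow_nonneg hl n]
    · calc (l + √n) ^ n ≤ (2 * l) ^ n := by gcongr; linarith
        _ = 2 ^ n * l ^ n := mul_pow _ _ _
        _ ≤ _ := by gcongr; linarith [pow_nonneg hs n]
  set F := (n.factorial : ℝ) ^ θ
  have hF : 0 ≤ F := by positivity
  set X := Real.exp (ε * l ^ (1 / θ))
  calc (l + √n) ^ n ≤ 2 ^ n * (l ^ n + (√n) ^ n) := h6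
    _ ≤ 2 ^ n * (c ^ n * F * X + Real.exp 1 ^ n * F * X) := by
        gcongr
        refine h2.trans ?_
        exact le_mul_of_one_le_right (by positivity) hE
    _ ≤ 2 ^ n * ((c + Real.exp 1) ^ n * F * X + (c + Real.exp 1) ^ n * F * X) := by
        have h7 : 0 < Real.exp 1 := Real.exp_pos 1
        have h8 : c ≤ c + Real.exp 1 := by linarith
        have h9 : Real.exp 1 ≤ c + Real.exp 1 := by linarith
        gcongr
    _ = _ := by rw [mul_pow]; ring

theorem norm_fst_rpow_le {θ : ℝ} (hθ : Admissible θ) (p : Phase ι) :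
    ‖p.1‖ ^ (1 / θ) ≤ ‖p‖ ^ (1 / θ) :=
  Real.rpow_le_rpow (norm_nonneg _) (norm_fst_le p) hθ.inv_nonneg

theorem norm_snd_rpow_le {θ : ℝ} (hθ : Admissible θ) (p : Phase ι) :
    ‖p.2‖ ^ (1 / θ) ≤ ‖p‖ ^ (1 / θ) :=
  Real.rpow_le_rpow (norm_nonneg _) (norm_snd_le p) hθ.inv_nonneg

/-- What matters is that `C` does not depend on `p`. Half of the Gaussian exponent of the atom is
spent on the powers of `y` and on the derivatives. -/
theorem pow_mul_norm_iteratedFDeriv_gaborAtom_le {θ ε : ℝ} (hθ : Admissible θ) (hε : 0 < ε) :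
    ∃ C > 0, ∀ (p : Phase ι) (k n : ℕ) (y : Conf ι),
      ‖y‖ ^ k * ‖iteratedFDeriv ℝ n (gaborAtom p) y‖ ≤
        2 * Real.exp 1 * Real.exp (ε * ‖p‖ ^ (1 / θ)) * Real.exp (-(1 / 4) * ‖y - p.1‖ ^ 2) *
          C ^ (k + n) * (k.factorial : ℝ) ^ θ * (n.factorial : ℝ) ^ θ := by
  -- The two weights below add up to at most `8 ‖p‖ ^ s + 8 (1 + ‖y - p.1‖ ^ 2)`; now `8 η ≤ ε`, and
  -- `8 η ≤ 1 / 4` leaves a quarter of the square.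
  set η := min (ε / 8) (1 / 32) with hη
  have hη0 : 0 < η := by positivity
  have hθ0 := hθ.pos
  obtain ⟨C, hC, h⟩ := add_sqrt_pow_le hθ hη0
  set c := (θ / η) ^ θ with hc
  have hc0 : 0 < c := by positivity
  refine ⟨max C c, by positivity, fun p k n y => ?_⟩
  set s := 1 / θ with hs
  have hs0 : 0 ≤ s := hθ.inv_nonneg
  have hs2 : s ≤ 2 := hθ.inv_le_two
  have hexp : Real.exp (η * ‖y‖ ^ s) * Real.exp (η * (‖y - p.1‖ + ‖p.2‖) ^ s) *
      ‖gaborAtom p y‖ ≤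
      Real.exp 1 * Real.exp (ε * ‖p‖ ^ s) * Real.exp (-(1 / 4) * ‖y - p.1‖ ^ 2) := by
    rw [norm_gaborAtom, ← Real.exp_add, ← Real.exp_add, ← Real.exp_add, ← Real.exp_add,
      Real.exp_le_exp]
    have h1 : ‖y‖ ^ s ≤ 4 * (‖y - p.1‖ ^ s + ‖p.1‖ ^ s) := by
      refine le_trans ?_ (add_rpow_le_four_mul (norm_nonneg _) (norm_nonneg _) hs0 hs2)
      gcongr
      calc ‖y‖ = ‖(y - p.1) + p.1‖ := by simp
        _ ≤ _ := norm_add_le _ _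
    have h2 := add_rpow_le_four_mul (norm_nonneg (y - p.1)) (norm_nonneg p.2) hs0 hs2
    have h3 := rpow_le_one_add_sq (norm_nonneg (y - p.1)) hs0 hs2
    have h4 := norm_fst_rpow_le hθ p
    have h5 := norm_snd_rpow_le hθ p
    rw [← hs] at h4 h5
    have h6 : η ≤ ε / 8 := min_le_left _ _
    have h7 : η ≤ 1 / 32 := min_le_right _ _
    have h8 : 0 ≤ ‖p‖ ^ s := by positivity
    have h9 : ‖y‖ ^ s + (‖y - p.1‖ + ‖p.2‖) ^ s ≤ 8 * ‖p‖ ^ s + 8 * (1 + ‖y - p.1‖ ^ 2) := by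
      linarith
    have h10 := mul_le_mul_of_nonneg_left h9 hη0.le
    have h11 : η * ‖p‖ ^ s ≤ ε / 8 * ‖p‖ ^ s := by gcongr
    have h12 : η * (1 + ‖y - p.1‖ ^ 2) ≤ 1 / 32 * (1 + ‖y - p.1‖ ^ 2) := by gcongr
    linarith
  have h1 := pow_le_factorial_rpow_mul_exp hθ0 hη0 (norm_nonneg y) k
  have h2 := h (‖y - p.1‖ + ‖p.2‖) (by positivity) n
  have h3 := norm_iteratedFDeriv_gaborAtom_le p y n
  rw [← hc] at h1
  have hC1 : C ^ n ≤ max C c ^ n := by gcongr; exact le_max_left _ _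
  have hC2 : c ^ k ≤ max C c ^ k := by gcongr; exact le_max_right _ _
  set Fk := (k.factorial : ℝ) ^ θ
  set Fn := (n.factorial : ℝ) ^ θ
  have hFk : 0 ≤ Fk := by positivity
  have hFn : 0 ≤ Fn := by positivity
  calc ‖y‖ ^ k * ‖iteratedFDeriv ℝ n (gaborAtom p) y‖
      ≤ (c ^ k * Fk * Real.exp (η * ‖y‖ ^ s)) * (‖gaborAtom p y‖ *
        (2 * C ^ n * Fn * Real.exp (η * (‖y - p.1‖ + ‖p.2‖) ^ s))) := by
        gcongr
        exact h3.trans (by gcongr)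
    _ = 2 * (c ^ k * C ^ n) * Fk * Fn * (Real.exp (η * ‖y‖ ^ s) *
          Real.exp (η * (‖y - p.1‖ + ‖p.2‖) ^ s) * ‖gaborAtom p y‖) := by ring
    _ ≤ 2 * (max C c ^ k * max C c ^ n) * Fk * Fn *
        (Real.exp 1 * Real.exp (ε * ‖p‖ ^ s) * Real.exp (-(1 / 4) * ‖y - p.1‖ ^ 2)) := by gcongr
    _ = _ := by rw [pow_add]; ring

/-- The scale is uniform in `p`, so testing an ultradistribution on atoms gives growth below every
`exp (ε ‖p‖ ^ (1 / θ))`. -/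
theorem normLE_gaborAtom {θ ε : ℝ} (hθ : Admissible θ) (hε : 0 < ε) : ∃ C > 0, ∀ p : Phase ι,
    NormLE θ C (2 * Real.exp 1 * Real.exp (ε * ‖p‖ ^ (1 / θ))) (gaborAtom p) := by
  obtain ⟨C, hC, h⟩ := pow_mul_norm_iteratedFDeriv_gaborAtom_le (ι := ι) hθ hε
  refine ⟨_, by positivity, fun p => normLE_of_iteratedFDeriv hθ.pos hC (by positivity)
    fun k n y => (h p k n y).trans ?_⟩
  have h2 : Real.exp (-(1 / 4) * ‖y - p.1‖ ^ 2) ≤ 1 := by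
    rw [Real.exp_le_one_iff]
    have := sq_nonneg ‖y - p.1‖
    linarith
  gcongr ?_ * _ * _ * _
  exact mul_le_of_le_one_right (by positivity) h2

theorem gaborAtom_mem {θ : ℝ} (hθ : Admissible θ) (p : Phase ι) : gaborAtom p ∈ GS θ ι := by
  obtain ⟨C, hC, h⟩ := normLE_gaborAtom (ι := ι) hθ one_pos
  exact ⟨contDiff_gaborAtom_apply p, C, hC, _, h p⟩

/-! ### Superpositions of Gabor atoms -/

/-- The superposition `∫ G(p) g_p dp` of Gabor atoms. -/
def synth (G : Phase ι → ℂ) (y : Conf ι) : ℂ := ∫ p, G p * gaborAtom p y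

/-! ### Differentiation under the integral sign -/

theorem continuous_fderiv_parametric {A B F : Type*} [NormedAddCommGroup A] [NormedSpace ℝ A]
    [NormedAddCommGroup B] [NormedSpace ℝ B] [NormedAddCommGroup F] [NormedSpace ℝ F]
    {f : A → B → F} (hf : ContDiff ℝ ∞ (fun q : A × B => f q.1 q.2)) (y : B) :
    Continuous fun a => fderiv ℝ (f a) y :=
  (ContDiff.fderiv (f := f) (g := fun _ => y) (n := ∞) (m := ∞) hf contDiff_const
    (by simp)).continuous

section Parametric

variable {A B F : Type*} [NormedAddCommGroup A]
  [NormedSpace ℝ A] [MeasurableSpace A] [BorelSpace A] [FiniteDimensional ℝ A]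
  [NormedAddCommGroup B] [NormedSpace ℝ B] [NormedAddCommGroup F] [NormedSpace ℝ F]
  [NormedSpace ℂ F] {μ : Measure A} {f : A → B → F} {G : A → ℂ} {bound : A → ℝ}

theorem integrable_smul_fderiv_parametric (hf : ContDiff ℝ ∞ (fun q : A × B => f q.1 q.2))
    (hm : AEStronglyMeasurable G μ) (hb : Integrable bound μ)
    (h : ∀ a y, ‖G a‖ * ‖fderiv ℝ (f a) y‖ ≤ bound a) (y : B) :
    Integrable (fun a => G a • fderiv ℝ (f a) y) μ :=
  hb.mono' (hm.smul (continuous_fderiv_parametric hf y).aestronglyMeasurable)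
    (Filter.Eventually.of_forall fun a => by rw [norm_smul]; exact h a y)

theorem integrable_smul_fderiv_apply_parametric (hf : ContDiff ℝ ∞ (fun q : A × B => f q.1 q.2))
    (hm : AEStronglyMeasurable G μ) (hb : Integrable bound μ)
    (h : ∀ a y, ‖G a‖ * ‖fderiv ℝ (f a) y‖ ≤ bound a) (y v : B) :
    Integrable (fun a => G a • fderiv ℝ (f a) y v) μ :=
  (integrable_smul_fderiv_parametric hf hm hb h y).apply_continuousLinearMap v

theorem integral_smul_fderiv_apply_parametric [CompleteSpace F]
    (hf : ContDiff ℝ ∞ (fun q : A × B => f q.1 q.2))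
    (hm : AEStronglyMeasurable G μ) (hb : Integrable bound μ)
    (h : ∀ a y, ‖G a‖ * ‖fderiv ℝ (f a) y‖ ≤ bound a) (y v : B) :
    (∫ a, G a • fderiv ℝ (f a) y ∂μ) v = ∫ a, G a • fderiv ℝ (f a) y v ∂μ :=
  ContinuousLinearMap.integral_apply (integrable_smul_fderiv_parametric hf hm hb h y) v

theorem hasFDerivAt_integral_smul_parametric
    (hf : ContDiff ℝ ∞ (fun q : A × B => f q.1 q.2)) (hm : AEStronglyMeasurable G μ)
    (hi : ∀ y, Integrable (fun a => G a • f a y) μ) (hb : Integrable bound μ)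
    (h : ∀ a y, ‖G a‖ * ‖fderiv ℝ (f a) y‖ ≤ bound a) (y : B) :
    HasFDerivAt (fun y => ∫ a, G a • f a y ∂μ) (∫ a, G a • fderiv ℝ (f a) y ∂μ) y := by
  refine hasFDerivAt_integral_of_dominated_of_fderiv_le (s := Set.univ)
    (F' := fun y a => G a • fderiv ℝ (f a) y) (bound := bound) Filter.univ_mem
    (Filter.Eventually.of_forall fun y => (hi y).aestronglyMeasurable) (hi y)
    (integrable_smul_fderiv_parametric hf hm hb h y).aestronglyMeasurable
    (Filter.Eventually.of_forall fun a y _ => ?_) hb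
    (Filter.Eventually.of_forall fun a y _ => ?_)
  · rw [norm_smul]
    exact h a y
  · refine HasFDerivAt.const_smul (DifferentiableAt.hasFDerivAt ?_) (G a)
    have : ContDiff ℝ ∞ (f a) := ContDiff.comp (g := fun q : A × B => f q.1 q.2)
      (f := fun y => (a, y)) hf (contDiff_const.prodMk contDiff_id)
    exact this.differentiable (by simp) y

end Parametric

/-- Joint smoothness makes the derivatives of atoms measurable in `p` and allows one more
differentiation under the integral. -/
theorem contDiff_iteratedFDeriv_parametric {A B F : Type*} [NormedAddCommGroup A] [NormedSpace ℝ A]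
    [NormedAddCommGroup B] [NormedSpace ℝ B] [NormedAddCommGroup F] [NormedSpace ℝ F]
    {f : A → B → F} (hf : ContDiff ℝ ∞ (fun q : A × B => f q.1 q.2)) (n : ℕ) :
    ContDiff ℝ ∞ (fun q : A × B => iteratedFDeriv ℝ n (f q.1) q.2) := by
  induction n with
  | zero =>
    have : (fun q : A × B => iteratedFDeriv ℝ 0 (f q.1) q.2) = fun q : A × B =>
        (continuousMultilinearCurryFin0 ℝ B F).symm (f q.1 q.2) := by
      funext q
      rw [iteratedFDeriv_zero_eq_comp]
      rfl
    rw [this]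
    exact (continuousMultilinearCurryFin0 ℝ B F).symm.contDiff.comp hf
  | succ n ih =>
    have h := ContDiff.fderiv (f := fun q : A × B => iteratedFDeriv ℝ n (f q.1)) (g := Prod.snd)
      (n := ∞) (m := ∞) (ih.comp ((contDiff_fst.comp contDiff_fst).prodMk contDiff_snd))
      contDiff_snd (by simp)
    exact h.continuousLinearMap_comp
      ((continuousMultilinearCurryLeftEquiv ℝ (fun _ : Fin (n + 1) ↦ B) F).symm :
        _ →L[ℝ] ContinuousMultilinearMap ℝ (fun _ : Fin (n + 1) => B) F)

theorem continuous_iteratedFDeriv_gaborAtom (n : ℕ) (y : Conf ι) :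
    Continuous fun p : Phase ι => iteratedFDeriv ℝ n (gaborAtom p) y :=
  Continuous.comp (g := fun q : Phase ι × Conf ι => iteratedFDeriv ℝ n (gaborAtom q.1) q.2)
    (f := fun p => (p, y))
    (contDiff_iteratedFDeriv_parametric (contDiff_gaborAtom (ι := ι)) n).continuous
    (Continuous.prodMk continuous_id continuous_const)

theorem norm_iteratedFDeriv_gaborAtom_le_exp {θ ε : ℝ} (hθ : Admissible θ) (hε : 0 < ε) (n : ℕ) :
    ∃ K, ∀ (p : Phase ι) (y : Conf ι),
      ‖iteratedFDeriv ℝ n (gaborAtom p) y‖ ≤ K * Real.exp (ε * ‖p‖ ^ (1 / θ)) := by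
  obtain ⟨C, hC, h⟩ := pow_mul_norm_iteratedFDeriv_gaborAtom_le (ι := ι) hθ hε
  refine ⟨2 * Real.exp 1 * C ^ n * (n.factorial : ℝ) ^ θ, fun p y => ?_⟩
  have h1 := h p 0 n y
  simp only [pow_zero, one_mul, Nat.factorial_zero, Nat.cast_one, Real.one_rpow, zero_add] at h1
  refine h1.trans ?_
  have h2 : Real.exp (-(1 / 4) * ‖y - p.1‖ ^ 2) ≤ 1 := by
    rw [Real.exp_le_one_iff]
    have := sq_nonneg ‖y - p.1‖
    linarith
  calc _ ≤ 2 * Real.exp 1 * Real.exp (ε * ‖p‖ ^ (1 / θ)) * 1 * C ^ n * 1 *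
        (n.factorial : ℝ) ^ θ := by gcongr
    _ = _ := by ring

section Synth

variable {θ ε : ℝ} {G : Phase ι → ℂ}

theorem integrable_smul_iteratedFDeriv_gaborAtom (hθ : Admissible θ) (hε : 0 < ε)
    (hm : AEStronglyMeasurable G volume)
    (hG : Integrable fun p => ‖G p‖ * Real.exp (ε * ‖p‖ ^ (1 / θ))) (n : ℕ) (y : Conf ι) :
    Integrable fun p => G p • iteratedFDeriv ℝ n (gaborAtom p) y := by
  obtain ⟨K, hK⟩ := norm_iteratedFDeriv_gaborAtom_le_exp (ι := ι) hθ hε n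
  refine (hG.const_mul K).mono'
    (hm.smul (continuous_iteratedFDeriv_gaborAtom n y).aestronglyMeasurable)
    (Filter.Eventually.of_forall fun p => ?_)
  rw [norm_smul]
  calc ‖G p‖ * ‖iteratedFDeriv ℝ n (gaborAtom p) y‖
      ≤ ‖G p‖ * (K * Real.exp (ε * ‖p‖ ^ (1 / θ))) := by gcongr; exact hK p y
    _ = _ := by ring

theorem hasFDerivAt_integral_iteratedFDeriv_gaborAtom (hθ : Admissible θ) (hε : 0 < ε)
    (hm : AEStronglyMeasurable G volume)
    (hG : Integrable fun p => ‖G p‖ * Real.exp (ε * ‖p‖ ^ (1 / θ))) (n : ℕ) (y : Conf ι) :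
    HasFDerivAt (fun y => ∫ p, G p • iteratedFDeriv ℝ n (gaborAtom p) y)
      (∫ p, G p • fderiv ℝ (iteratedFDeriv ℝ n (gaborAtom p)) y) y := by
  obtain ⟨K, hK⟩ := norm_iteratedFDeriv_gaborAtom_le_exp (ι := ι) hθ hε (n + 1)
  refine hasFDerivAt_integral_smul_parametric
    (contDiff_iteratedFDeriv_parametric (contDiff_gaborAtom (ι := ι)) n) hm
    (integrable_smul_iteratedFDeriv_gaborAtom hθ hε hm hG n) (hG.const_mul K) (fun p y => ?_) y
  rw [norm_fderiv_iteratedFDeriv]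
  calc ‖G p‖ * ‖iteratedFDeriv ℝ (n + 1) (gaborAtom p) y‖
      ≤ ‖G p‖ * (K * Real.exp (ε * ‖p‖ ^ (1 / θ))) := by gcongr; exact hK p y
    _ = _ := by ring

theorem iteratedFDeriv_synth (hθ : Admissible θ) (hε : 0 < ε)
    (hm : AEStronglyMeasurable G volume)
    (hG : Integrable fun p => ‖G p‖ * Real.exp (ε * ‖p‖ ^ (1 / θ))) (n : ℕ) :
    iteratedFDeriv ℝ n (synth G) = fun y => ∫ p, G p • iteratedFDeriv ℝ n (gaborAtom p) y := by
  induction n with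
  | zero =>
    funext y
    ext m
    have := integrable_smul_iteratedFDeriv_gaborAtom hθ hε hm hG 0 y
    rw [iteratedFDeriv_zero_apply, ContinuousMultilinearMap.integral_apply this]
    simp [synth]
  | succ n ih =>
    funext y
    obtain ⟨K, hK⟩ := norm_iteratedFDeriv_gaborAtom_le_exp (ι := ι) hθ hε (n + 1)
    have hf := contDiff_iteratedFDeriv_parametric (contDiff_gaborAtom (ι := ι)) n
    have hb : ∀ p y, ‖G p‖ * ‖fderiv ℝ (iteratedFDeriv ℝ n (gaborAtom p)) y‖ ≤
        K * (‖G p‖ * Real.exp (ε * ‖p‖ ^ (1 / θ))) := by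
      intro p y
      rw [norm_fderiv_iteratedFDeriv]
      calc ‖G p‖ * ‖iteratedFDeriv ℝ (n + 1) (gaborAtom p) y‖
          ≤ ‖G p‖ * (K * Real.exp (ε * ‖p‖ ^ (1 / θ))) := by gcongr; exact hK p y
        _ = _ := by ring
    ext v
    rw [iteratedFDeriv_succ_apply_left, ih,
      (hasFDerivAt_integral_iteratedFDeriv_gaborAtom hθ hε hm hG n y).fderiv,
      integral_smul_fderiv_apply_parametric hf hm (hG.const_mul K) hb,
      ContinuousMultilinearMap.integral_apply
        (integrable_smul_fderiv_apply_parametric hf hm (hG.const_mul K) hb y (v 0)),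
      ContinuousMultilinearMap.integral_apply
        (integrable_smul_iteratedFDeriv_gaborAtom hθ hε hm hG (n + 1) y)]
    rfl

theorem contDiff_synth (hθ : Admissible θ) (hε : 0 < ε)
    (hm : AEStronglyMeasurable G volume)
    (hG : Integrable fun p => ‖G p‖ * Real.exp (ε * ‖p‖ ^ (1 / θ))) :
    ContDiff ℝ ∞ (synth G) := by
  refine contDiff_of_differentiable_iteratedFDeriv fun n _ => ?_
  rw [iteratedFDeriv_synth hθ hε hm hG n]
  exact fun y => (hasFDerivAt_integral_iteratedFDeriv_gaborAtom hθ hε hm hG n y).differentiableAt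

end Synth

/-- The atom bound has a scale independent of `p` and therefore passes through the integral: a
weighted `L¹` norm of `G` controls a norm of `S_θ`. -/
theorem normLE_synth {θ ε : ℝ} (hθ : Admissible θ) (hε : 0 < ε) : ∃ C > 0, ∀ G : Phase ι → ℂ,
    AEStronglyMeasurable G volume → Integrable (fun p => ‖G p‖ * Real.exp (ε * ‖p‖ ^ (1 / θ))) →
    NormLE θ C (2 * Real.exp 1 * ∫ p, ‖G p‖ * Real.exp (ε * ‖p‖ ^ (1 / θ))) (synth G) := by
  obtain ⟨C, hC, h⟩ := pow_mul_norm_iteratedFDeriv_gaborAtom_le (ι := ι) hθ hε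
  refine ⟨_, by positivity, fun G hm hG => normLE_of_iteratedFDeriv hθ.pos hC
    (mul_nonneg (by positivity) (integral_nonneg fun p => by positivity)) fun k n y => ?_⟩
  rw [iteratedFDeriv_synth hθ hε hm hG n]
  have hi := integrable_smul_iteratedFDeriv_gaborAtom hθ hε hm hG n y
  set D := 2 * Real.exp 1 * C ^ (k + n) * (k.factorial : ℝ) ^ θ * (n.factorial : ℝ) ^ θ with hD
  calc ‖y‖ ^ k * ‖∫ p, G p • iteratedFDeriv ℝ n (gaborAtom p) y‖
      ≤ ‖y‖ ^ k * ∫ p, ‖G p • iteratedFDeriv ℝ n (gaborAtom p) y‖ := by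
        gcongr
        exact norm_integral_le_integral_norm _
    _ = ∫ p, ‖y‖ ^ k * ‖G p • iteratedFDeriv ℝ n (gaborAtom p) y‖ := by
        rw [integral_const_mul]
    _ ≤ ∫ p, D * (‖G p‖ * Real.exp (ε * ‖p‖ ^ (1 / θ))) := by
        refine integral_mono (hi.norm.const_mul _) (hG.const_mul _) fun p => ?_
        have h2 : Real.exp (-(1 / 4) * ‖y - p.1‖ ^ 2) ≤ 1 := by
          rw [Real.exp_le_one_iff]
          have := sq_nonneg ‖y - p.1‖
          linarith
        simp only [norm_smul]
        calc ‖y‖ ^ k * (‖G p‖ * ‖iteratedFDeriv ℝ n (gaborAtom p) y‖)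
            = ‖G p‖ * (‖y‖ ^ k * ‖iteratedFDeriv ℝ n (gaborAtom p) y‖) := by ring
          _ ≤ ‖G p‖ * _ := mul_le_mul_of_nonneg_left (h p k n y) (norm_nonneg _)
          _ ≤ ‖G p‖ * (2 * Real.exp 1 * Real.exp (ε * ‖p‖ ^ (1 / θ)) * 1 *
              C ^ (k + n) * (k.factorial : ℝ) ^ θ * (n.factorial : ℝ) ^ θ) := by gcongr
          _ = _ := by rw [hD]; ring
    _ = _ := by rw [integral_const_mul, hD]; ring

theorem synth_mem {θ ε : ℝ} (hθ : Admissible θ) (hε : 0 < ε) {G : Phase ι → ℂ}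
    (hm : AEStronglyMeasurable G volume)
    (hG : Integrable fun p => ‖G p‖ * Real.exp (ε * ‖p‖ ^ (1 / θ))) : synth G ∈ GS θ ι := by
  obtain ⟨C, hC, h⟩ := normLE_synth (ι := ι) hθ hε
  exact ⟨contDiff_synth hθ hε hm hG, C, hC, _, h G hm hG⟩

instance : (volume : Measure (Phase ι)).IsAddHaarMeasure :=
  inferInstanceAs ((volume : Measure (Conf ι)).prod (volume : Measure (Conf ι))).IsAddHaarMeasure

/-! ### Gabor coefficients of functions -/

/-- The coefficient `∫ f conj(g_p)` of `f` with respect to the Gabor atom at `p`. -/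
def coeff (f : Conf ι → ℂ) (p : Phase ι) : ℂ := ∫ y, f y * starRingEnd ℂ (gaborAtom p y)

theorem conj_gaborAtom (p : Phase ι) (y : Conf ι) :
    starRingEnd ℂ (gaborAtom p y) = gaborAtom (p.1, -p.2) y := by
  simp only [gaborAtom, ← Complex.exp_conj, map_sub, map_neg, map_mul, Complex.conj_ofReal,
    Complex.conj_I, inner_neg_left, Complex.ofReal_neg]
  ring_nf

theorem gaborAtom_eq_mul (p : Phase ι) (y : Conf ι) :
    gaborAtom p y = Complex.exp (-Complex.I * ((inner ℝ p.2 y : ℝ) : ℂ)) * gaborAtom (p.1, 0) y := by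
  simp only [gaborAtom, ← Complex.exp_add, inner_zero_left, Complex.ofReal_zero]
  ring_nf

theorem conj_gaborAtom_eq_mul (p : Phase ι) (y : Conf ι) :
    starRingEnd ℂ (gaborAtom p y) =
      Complex.exp (Complex.I * ((inner ℝ p.2 y : ℝ) : ℂ)) * gaborAtom (p.1, 0) y := by
  rw [conj_gaborAtom, gaborAtom_eq_mul]
  simp

theorem integrable_norm_gaborAtom (p : Phase ι) : Integrable (gaborAtom p) := by
  have h := (integrable_exp_neg_mul_norm_sq (E := Conf ι) volume (ε := 1 / 2)
    (by norm_num)).comp_sub_right p.1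
  refine h.mono' (contDiff_gaborAtom_apply p).continuous.aestronglyMeasurable
    (Filter.Eventually.of_forall fun y => ?_)
  rw [norm_gaborAtom]
  apply le_of_eq
  ring_nf

theorem measurable_coeff {f : Conf ι → ℂ} (hf : Continuous f) : Measurable (coeff f) := by
  have : StronglyMeasurable fun q : Phase ι × Conf ι =>
      f q.2 * starRingEnd ℂ (gaborAtom q.1 q.2) :=
    ((hf.comp continuous_snd).mul
      (Complex.continuous_conj.comp continuous_gaborAtom)).stronglyMeasurable
  exact this.integral_prod_right'.measurable

/-- Writing `p.1 = y - (y - p.1)` distributes the exponent between the decay of `f` at `y` and the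
Gaussian window around `p.1`. -/
theorem norm_coeff_le_fst {θ C : ℝ} (hθ : Admissible θ) (hC : 0 < C) :
    ∃ ε > 0, ∃ K ≥ 0, ∀ (f : Conf ι → ℂ) (M : ℝ), NormLE θ C M f → ∀ p : Phase ι,
      ‖coeff f p‖ ≤ K * M * Real.exp (-ε * ‖p.1‖ ^ (1 / θ)) := by
  have hθ0 := hθ.pos
  set s := 1 / θ with hs
  have hs0 : 0 ≤ s := hθ.inv_nonneg
  have hs2 : s ≤ 2 := hθ.inv_le_two
  set a := θ * (1 / (2 * C * (Fintype.card ι + 1))) ^ s with ha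
  have ha0 : 0 < a := by positivity
  set η := min (a / 4) (1 / 16) with hη
  have hη0 : 0 < η := by positivity
  have h6 : η ≤ a / 4 := min_le_left _ _
  have h7 : η ≤ 1 / 16 := min_le_right _ _
  set I := ∫ y : Conf ι, Real.exp (-(1 / 4) * ‖y‖ ^ 2) with hI
  have hI0 : 0 ≤ I := integral_nonneg fun y => by positivity
  refine ⟨η, hη0, 2 * Real.exp 1 * I, by positivity, fun f M hf p => ?_⟩
  have hM := hf.nonneg
  have hint : Integrable fun y : Conf ι => Real.exp (-(1 / 4) * ‖y - p.1‖ ^ 2) :=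
    (integrable_exp_neg_mul_norm_sq (E := Conf ι) volume (ε := 1 / 4)
      (by norm_num)).comp_sub_right p.1
  have hI' : ∫ y : Conf ι, Real.exp (-(1 / 4) * ‖y - p.1‖ ^ 2) = I :=
    integral_sub_right_eq_self (fun y : Conf ι => Real.exp (-(1 / 4) * ‖y‖ ^ 2)) p.1
  calc ‖coeff f p‖ ≤ ∫ y, 2 * M * Real.exp 1 * Real.exp (-η * ‖p.1‖ ^ s) *
        Real.exp (-(1 / 4) * ‖y - p.1‖ ^ 2) := by
        refine norm_integral_le_of_norm_le (hint.const_mul _)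
          (Filter.Eventually.of_forall fun y => ?_)
        rw [norm_mul, RCLike.norm_conj, norm_gaborAtom]
        have h1 := hf.norm_apply_le hθ hC y
        rw [← hs, ← ha] at h1
        have hexp : Real.exp (-a * ‖y‖ ^ s) * Real.exp (-(‖y - p.1‖ ^ 2 / 2)) ≤
            Real.exp 1 * Real.exp (-η * ‖p.1‖ ^ s) * Real.exp (-(1 / 4) * ‖y - p.1‖ ^ 2) := by
          rw [← Real.exp_add, ← Real.exp_add, ← Real.exp_add, Real.exp_le_exp]
          have h2 : ‖p.1‖ ^ s ≤ 4 * (‖y‖ ^ s + ‖y - p.1‖ ^ s) := by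
            refine le_trans ?_ (add_rpow_le_four_mul (norm_nonneg _) (norm_nonneg _) hs0 hs2)
            gcongr
            calc ‖p.1‖ = ‖y - (y - p.1)‖ := by simp
              _ ≤ _ := norm_sub_le _ _
          have h3 := rpow_le_one_add_sq (norm_nonneg (y - p.1)) hs0 hs2
          have h8 : 0 ≤ ‖y‖ ^ s := by positivity
          have h9 := mul_le_mul_of_nonneg_left h2 hη0.le
          have h10 := mul_le_mul_of_nonneg_left h3 hη0.le
          have h11 : η * ‖y‖ ^ s ≤ a / 4 * ‖y‖ ^ s := by gcongr
          have h12 : η * (1 + ‖y - p.1‖ ^ 2) ≤ 1 / 16 * (1 + ‖y - p.1‖ ^ 2) := by gcongr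
          linarith
        calc ‖f y‖ * Real.exp (-(‖y - p.1‖ ^ 2 / 2))
            ≤ 2 * M * Real.exp (-a * ‖y‖ ^ s) * Real.exp (-(‖y - p.1‖ ^ 2 / 2)) := by gcongr
          _ = 2 * M * (Real.exp (-a * ‖y‖ ^ s) * Real.exp (-(‖y - p.1‖ ^ 2 / 2))) := by ring
          _ ≤ _ := mul_le_mul_of_nonneg_left hexp (by positivity)
          _ = _ := by ring
    _ = _ := by rw [integral_const_mul, hI']; ring

theorem norm_iteratedFDeriv_window_le {θ : ℝ} (hθ : Admissible θ) : ∃ C > 0, ∀ (x y : Conf ι)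
    (n : ℕ), ‖iteratedFDeriv ℝ n (gaborAtom ((x, 0) : Phase ι)) y‖ ≤
      2 * Real.exp 1 * C ^ n * (n.factorial : ℝ) ^ θ * Real.exp (-(1 / 4) * ‖y - x‖ ^ 2) := by
  obtain ⟨C, hC, h⟩ := add_sqrt_pow_le hθ (ε := 1 / 4) (by norm_num)
  refine ⟨C, hC, fun x y n => ?_⟩
  have h1 := norm_iteratedFDeriv_gaborAtom_le ((x, 0) : Phase ι) y n
  simp only [norm_zero, add_zero] at h1
  have h2 := h ‖y - x‖ (norm_nonneg _) n
  have h3 := rpow_le_one_add_sq (norm_nonneg (y - x)) hθ.inv_nonneg hθ.inv_le_two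
  rw [norm_gaborAtom] at h1
  calc _ ≤ _ := h1
    _ ≤ Real.exp (-(‖y - x‖ ^ 2 / 2)) *
        (2 * C ^ n * (n.factorial : ℝ) ^ θ * Real.exp (1 / 4 * ‖y - x‖ ^ (1 / θ))) := by gcongr
    _ = 2 * C ^ n * (n.factorial : ℝ) ^ θ *
        (Real.exp (1 / 4 * ‖y - x‖ ^ (1 / θ)) * Real.exp (-(‖y - x‖ ^ 2 / 2))) := by ring
    _ ≤ 2 * C ^ n * (n.factorial : ℝ) ^ θ *
        (Real.exp 1 * Real.exp (-(1 / 4) * ‖y - x‖ ^ 2)) := by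
        gcongr _ * ?_
        rw [← Real.exp_add, ← Real.exp_add, Real.exp_le_exp]
        linarith
    _ = _ := by ring

theorem norm_iteratedFDeriv_mul_window_le {θ C : ℝ} (hθ : Admissible θ) (hC : 0 < C) :
    ∃ D ≥ 1, ∀ (f : Conf ι → ℂ) (M : ℝ), ContDiff ℝ ∞ f → NormLE θ C M f →
      ∀ (x y : Conf ι) (n : ℕ),
      ‖iteratedFDeriv ℝ n (fun y => f y * gaborAtom ((x, 0) : Phase ι) y) y‖ ≤
        2 * Real.exp 1 * M * D ^ n * (n.factorial : ℝ) ^ θ * Real.exp (-(1 / 4) * ‖y - x‖ ^ 2) := by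
  obtain ⟨C₁, hC₁, h₁⟩ := norm_iteratedFDeriv_window_le (ι := ι) hθ
  have hθ0 := hθ.pos
  -- The binomial theorem adds the scales of `f` and of the window; the summand `1` ensures `D ≥ 1`,
  -- so that lower powers of `D` can later be replaced by `D ^ n`.
  refine ⟨Fintype.card ι * C + C₁ + 1, le_add_of_nonneg_left (by positivity),
    fun f M sf hf x y n => ?_⟩
  have hM := hf.nonneg
  refine (norm_iteratedFDeriv_mul_le sf (contDiff_gaborAtom_apply _) y
    (by exact_mod_cast le_top)).trans ?_
  set E := Real.exp (-(1 / 4) * ‖y - x‖ ^ 2)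
  set A := (Fintype.card ι : ℝ) * C with hA
  have hA0 : 0 ≤ A := by positivity
  have hterm : ∀ i ∈ Finset.range (n + 1), (n.choose i : ℝ) * ‖iteratedFDeriv ℝ i f y‖ *
      ‖iteratedFDeriv ℝ (n - i) (gaborAtom ((x, 0) : Phase ι)) y‖ ≤
      2 * Real.exp 1 * M * (n.factorial : ℝ) ^ θ * E * (A ^ i * C₁ ^ (n - i) * n.choose i) := by
    intro i hi
    have hin : i ≤ n := Nat.lt_succ_iff.1 (Finset.mem_range.1 hi)
    have hfac : (i.factorial : ℝ) ^ θ * ((n - i).factorial : ℝ) ^ θ ≤ (n.factorial : ℝ) ^ θ := by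
      rw [← Real.mul_rpow (by positivity) (by positivity)]
      refine Real.rpow_le_rpow (by positivity) ?_ hθ0.le
      exact_mod_cast Nat.le_of_dvd (Nat.factorial_pos _)
        (Nat.factorial_mul_factorial_dvd_factorial hin)
    calc _ ≤ (n.choose i : ℝ) * (M * A ^ i * (i.factorial : ℝ) ^ θ) *
          (2 * Real.exp 1 * C₁ ^ (n - i) * ((n - i).factorial : ℝ) ^ θ * E) := by
          gcongr
          · exact hf.norm_iteratedFDeriv_le hθ0 hC i y
          · exact h₁ x y (n - i)
      _ = 2 * Real.exp 1 * M * E * (A ^ i * C₁ ^ (n - i) * n.choose i) *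
          ((i.factorial : ℝ) ^ θ * ((n - i).factorial : ℝ) ^ θ) := by ring
      _ ≤ 2 * Real.exp 1 * M * E * (A ^ i * C₁ ^ (n - i) * n.choose i) *
          (n.factorial : ℝ) ^ θ := by gcongr
      _ = _ := by ring
  refine (Finset.sum_le_sum hterm).trans ?_
  rw [← Finset.mul_sum, ← add_pow]
  calc _ ≤ 2 * Real.exp 1 * M * (n.factorial : ℝ) ^ θ * E * (A + C₁ + 1) ^ n := by
        have hle : A + C₁ ≤ A + C₁ + 1 := by linarith
        gcongr _ * ?_ ^ n
    _ = _ := by ring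

theorem integrable_norm_iteratedFDeriv_mul_window {θ C M : ℝ} (hθ : Admissible θ) (hC : 0 < C)
    {f : Conf ι → ℂ} (sf : ContDiff ℝ ∞ f) (hf : NormLE θ C M f) (x : Conf ι) (n : ℕ) :
    Integrable fun y =>
      ‖iteratedFDeriv ℝ n (fun y => f y * gaborAtom ((x, 0) : Phase ι) y) y‖ := by
  obtain ⟨D, hD, h⟩ := norm_iteratedFDeriv_mul_window_le (ι := ι) hθ hC
  have hint : Integrable fun y : Conf ι => Real.exp (-(1 / 4) * ‖y - x‖ ^ 2) :=
    (integrable_exp_neg_mul_norm_sq (E := Conf ι) volume (ε := 1 / 4)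
      (by norm_num)).comp_sub_right x
  refine (hint.const_mul (2 * Real.exp 1 * M * D ^ n * (n.factorial : ℝ) ^ θ)).mono' ?_
    (Filter.Eventually.of_forall fun y => ?_)
  · have : ContDiff ℝ ∞ (fun y => f y * gaborAtom ((x, 0) : Phase ι) y) :=
      sf.mul (contDiff_gaborAtom_apply _)
    exact (this.continuous_iteratedFDeriv
      (by exact_mod_cast le_top)).norm.aestronglyMeasurable
  · rw [norm_norm]
    exact h f M sf hf x y n

open scoped FourierTransform in
theorem coeff_eq_fourier (f : Conf ι → ℂ) (p : Phase ι) :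
    coeff f p = 𝓕 (fun y => f y * gaborAtom ((p.1, 0) : Phase ι) y)
      ((-(1 / (2 * Real.pi))) • p.2) := by
  rw [Real.fourier_eq', coeff]
  congr 1
  funext y
  rw [conj_gaborAtom_eq_mul, inner_smul_right, smul_eq_mul, real_inner_comm p.2 y]
  have : (-2 * Real.pi * (-(1 / (2 * Real.pi)) * inner ℝ p.2 y) : ℝ) = inner ℝ p.2 y := by
    field_simp
  rw [this]
  ring_nf

open scoped FourierTransform in
-- In `p.2` the coefficient is a Fourier transform of `f` times a window, whose derivatives have
-- `L¹` norms of size `D ^ n (n!) ^ θ` uniformly in `p.1`; `le_exp_of_forall_pow_mul_le` converts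
-- this into exponential decay.
theorem norm_coeff_le_snd {θ C : ℝ} (hθ : Admissible θ) (hC : 0 < C) :
    ∃ ε > 0, ∃ K ≥ 0, ∀ (f : Conf ι → ℂ) (M : ℝ), ContDiff ℝ ∞ f → NormLE θ C M f →
      ∀ p : Phase ι, ‖coeff f p‖ ≤ K * M * Real.exp (-ε * ‖p.2‖ ^ (1 / θ)) := by
  obtain ⟨D, hD, h⟩ := norm_iteratedFDeriv_mul_window_le (ι := ι) hθ hC
  have hθ0 := hθ.pos
  have hD0 : 0 < D := by linarith
  set I := ∫ y : Conf ι, Real.exp (-(1 / 4) * ‖y‖ ^ 2) with hI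
  have hI0 : 0 ≤ I := integral_nonneg fun y => by positivity
  have hpi := Real.pi_pos
  refine ⟨θ * (1 / (2 * Real.pi * (2 * (4 * D)))) ^ (1 / θ), by positivity,
    2 * (2 * Real.exp 1 * I), by positivity, fun f M sf hf p => ?_⟩
  have hM := hf.nonneg
  set F : Conf ι → ℂ := fun y => f y * gaborAtom ((p.1, 0) : Phase ι) y with hF
  have sF : ContDiff ℝ ∞ F := sf.mul (contDiff_gaborAtom_apply _)
  have hint : Integrable fun y : Conf ι => Real.exp (-(1 / 4) * ‖y - p.1‖ ^ 2) :=
    (integrable_exp_neg_mul_norm_sq (E := Conf ι) volume (ε := 1 / 4)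
      (by norm_num)).comp_sub_right p.1
  have hI' : ∫ y : Conf ι, Real.exp (-(1 / 4) * ‖y - p.1‖ ^ 2) = I :=
    integral_sub_right_eq_self (fun y : Conf ι => Real.exp (-(1 / 4) * ‖y‖ ^ 2)) p.1
  have hFi : ∀ q : ℕ, ∫ y, ‖iteratedFDeriv ℝ q F y‖ ≤
      2 * Real.exp 1 * I * M * D ^ q * (q.factorial : ℝ) ^ θ := by
    intro q
    calc ∫ y, ‖iteratedFDeriv ℝ q F y‖ ≤ ∫ y, 2 * Real.exp 1 * M * D ^ q * (q.factorial : ℝ) ^ θ *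
          Real.exp (-(1 / 4) * ‖y - p.1‖ ^ 2) :=
          integral_mono (integrable_norm_iteratedFDeriv_mul_window hθ hC sf hf p.1 q)
            (hint.const_mul _) fun y => h f M sf hf p.1 y q
      _ = _ := by rw [integral_const_mul, hI']; ring
  set w := (-(1 / (2 * Real.pi))) • p.2 with hw
  have key : ∀ n : ℕ, ‖w‖ ^ n * ‖𝓕 F w‖ ≤
      (2 * Real.exp 1 * I * M) * (4 * D) ^ n * (n.factorial : ℝ) ^ θ := by
    intro n
    have h1 := Real.pow_mul_norm_iteratedFDeriv_fourier_le (K := 0) (N := ⊤) (f := F) sF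
      (fun k q hk _ => by
        have hk0 : k = 0 := by simpa using hk
        subst hk0
        simpa using integrable_norm_iteratedFDeriv_mul_window hθ hC sf hf p.1 q)
      (k := 0) (n := n) le_rfl le_top w
    simp only [norm_iteratedFDeriv_zero, pow_zero, Nat.cast_zero, mul_zero, zero_add, one_mul,
      Finset.range_one, Finset.sum_product, Finset.sum_singleton] at h1
    refine h1.trans ?_
    have h2 : ∑ q ∈ Finset.range (n + 1), ∫ y, ‖iteratedFDeriv ℝ q F y‖ ≤
        (2 : ℝ) ^ n * (2 * Real.exp 1 * I * M * D ^ n * (n.factorial : ℝ) ^ θ) := by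
      calc _ ≤ ∑ q ∈ Finset.range (n + 1),
            2 * Real.exp 1 * I * M * D ^ n * (n.factorial : ℝ) ^ θ := by
            refine Finset.sum_le_sum fun q hq => (hFi q).trans ?_
            have hqn : q ≤ n := Nat.lt_succ_iff.1 (Finset.mem_range.1 hq)
            have hfac : (q.factorial : ℝ) ≤ n.factorial := by
              exact_mod_cast Nat.factorial_le hqn
            gcongr
        _ = ((n : ℝ) + 1) * (2 * Real.exp 1 * I * M * D ^ n * (n.factorial : ℝ) ^ θ) := by
            rw [Finset.sum_const, Finset.card_range, nsmul_eq_mul]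
            push_cast
            ring
        _ ≤ _ := by
            gcongr
            exact_mod_cast Nat.lt_two_pow_self
    -- One `2 ^ n` comes from the Fourier estimate, the other from the `n + 1` orders of
    -- derivatives; together they turn `D` into `4 * D`.
    calc _ ≤ (2 : ℝ) ^ n * ((2 : ℝ) ^ n *
          (2 * Real.exp 1 * I * M * D ^ n * (n.factorial : ℝ) ^ θ)) := by gcongr
      _ = _ := by
          rw [mul_pow, show (4 : ℝ) = 2 * 2 by norm_num, mul_pow]
          ring
  have fin := le_exp_of_forall_pow_mul_le hθ0 hθ.2.le (by positivity) (norm_nonneg w)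
    (norm_nonneg (𝓕 F w)) key
  rw [coeff_eq_fourier]
  refine fin.trans (le_of_eq ?_)
  have hwn : ‖w‖ / (2 * (4 * D)) = 1 / (2 * Real.pi * (2 * (4 * D))) * ‖p.2‖ := by
    rw [hw, norm_smul, norm_neg, Real.norm_of_nonneg (by positivity)]
    field_simp
  rw [hwn, Real.mul_rpow (by positivity) (norm_nonneg _)]
  ring_nf

/-- The norm of phase space is the maximum of the component norms, so the larger component supplies
the decay. -/
theorem norm_coeff_le {θ C : ℝ} (hθ : Admissible θ) (hC : 0 < C) :
    ∃ ε > 0, ∃ K ≥ 0, ∀ (f : Conf ι → ℂ) (M : ℝ), ContDiff ℝ ∞ f → NormLE θ C M f →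
      ∀ p : Phase ι, ‖coeff f p‖ ≤ K * M * Real.exp (-ε * ‖p‖ ^ (1 / θ)) := by
  obtain ⟨a, ha, K, hK, h⟩ := norm_coeff_le_fst (ι := ι) hθ hC
  obtain ⟨b, hb, L, hL, h'⟩ := norm_coeff_le_snd (ι := ι) hθ hC
  refine ⟨min a b, by positivity, max K L, by positivity, fun f M sf hf p => ?_⟩
  have hM := hf.nonneg
  rcases le_total ‖p.1‖ ‖p.2‖ with hp | hp
  · rw [Prod.norm_def, max_eq_right hp]
    refine (h' f M sf hf p).trans ?_
    gcongr
    · exact le_max_right _ _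
    · exact min_le_right _ _
  · rw [Prod.norm_def, max_eq_left hp]
    refine (h f M hf p).trans ?_
    gcongr
    · exact le_max_left _ _
    · exact min_le_left _ _

theorem exists_norm_coeff_le {θ : ℝ} (hθ : Admissible θ) {f : Conf ι → ℂ} (hf : f ∈ GS θ ι) :
    ∃ ε > 0, ∃ K ≥ 0, ∀ p : Phase ι, ‖coeff f p‖ ≤ K * Real.exp (-ε * ‖p‖ ^ (1 / θ)) := by
  obtain ⟨sf, C, hC, M, hM⟩ := hf
  obtain ⟨ε, hε, K, hK, h⟩ := norm_coeff_le (ι := ι) hθ hC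
  exact ⟨ε, hε, K * M, mul_nonneg hK hM.nonneg, h f M sf hM⟩

/-! ### Gaussian integrals -/

theorem integral_gaussian {b : ℝ} (hb : 0 < b) (m η : Conf ι) :
    ∫ y : Conf ι, Complex.exp (-((b * ‖y - m‖ ^ 2 : ℝ) : ℂ) +
      Complex.I * ((inner ℝ η y : ℝ) : ℂ)) =
      (((Real.pi / b) ^ ((Fintype.card ι : ℝ) / 2) : ℝ) : ℂ) *
        Complex.exp (((-(‖η‖ ^ 2 / (4 * b)) : ℝ) : ℂ) + Complex.I * ((inner ℝ η m : ℝ) : ℂ)) := by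
  rw [← integral_add_right_eq_self _ m]
  have h : ∀ y : Conf ι, Complex.exp (-((b * ‖y + m - m‖ ^ 2 : ℝ) : ℂ) +
      Complex.I * ((inner ℝ η (y + m) : ℝ) : ℂ)) =
      Complex.exp (Complex.I * ((inner ℝ η m : ℝ) : ℂ)) *
        Complex.exp (-(b : ℂ) * (‖y‖ : ℂ) ^ 2 + Complex.I * ((inner ℝ η y : ℝ) : ℂ)) := by
    intro y
    rw [← Complex.exp_add, add_sub_cancel_right, inner_add_right]
    push_cast
    ring_nf
  simp only [h]
  rw [integral_const_mul,
    GaussianFourier.integral_cexp_neg_mul_sq_norm_add_of_euclideanSpace (by simpa using hb)]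
  have e2 : Complex.I ^ 2 * (‖η‖ : ℂ) ^ 2 / (4 * (b : ℂ)) = ((-(‖η‖ ^ 2 / (4 * b)) : ℝ) : ℂ) := by
    push_cast
    rw [Complex.I_sq]
    ring
  have e3 : ((Real.pi : ℂ) / (b : ℂ)) ^ ((Fintype.card ι : ℂ) / 2) =
      (((Real.pi / b) ^ ((Fintype.card ι : ℝ) / 2) : ℝ) : ℂ) := by
    rw [Complex.ofReal_cpow (by positivity)]
    push_cast
    rfl
  rw [e2, e3, mul_left_comm, Complex.exp_add, mul_comm (Complex.exp (Complex.I * _))]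

theorem norm_integral_gaussian {b : ℝ} (hb : 0 < b) (m η : Conf ι) :
    ‖∫ y : Conf ι, Complex.exp (-((b * ‖y - m‖ ^ 2 : ℝ) : ℂ) +
      Complex.I * ((inner ℝ η y : ℝ) : ℂ))‖ =
      (Real.pi / b) ^ ((Fintype.card ι : ℝ) / 2) * Real.exp (-(‖η‖ ^ 2 / (4 * b))) := by
  have e1 : ‖Complex.exp (Complex.I * ((inner ℝ η m : ℝ) : ℂ))‖ = 1 := by
    rw [mul_comm]
    exact Complex.norm_exp_ofReal_mul_I _
  rw [integral_gaussian hb, norm_mul, Complex.exp_add, norm_mul, e1, Complex.norm_exp_ofReal,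
    Complex.norm_real, Real.norm_of_nonneg (by positivity), mul_one]

theorem two_point_identity (y a b : Conf ι) :
    ‖y - a‖ ^ 2 / 2 + ‖y - b‖ ^ 2 / 2 =
      1 * ‖y - (1 / 2 : ℝ) • (a + b)‖ ^ 2 + ‖a - b‖ ^ 2 / 4 := by
  simp only [EuclideanSpace.real_norm_sq_eq, Finset.sum_div, Finset.mul_sum,
    ← Finset.sum_add_distrib]
  refine Finset.sum_congr rfl fun i _ => ?_
  simp
  ring

/-- The product of the two windows is a Gaussian around the midpoint, and its Fourier transform
produces the decay in the difference of the frequencies. -/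
theorem norm_coeff_gaborAtom (q p : Phase ι) :
    ‖coeff (gaborAtom q) p‖ = Real.pi ^ ((Fintype.card ι : ℝ) / 2) *
      Real.exp (-(‖q.1 - p.1‖ ^ 2 / 4 + ‖p.2 - q.2‖ ^ 2 / 4)) := by
  have h : coeff (gaborAtom q) p = ((Real.exp (-(‖q.1 - p.1‖ ^ 2 / 4)) : ℝ) : ℂ) *
      ∫ y : Conf ι, Complex.exp (-((1 * ‖y - (1 / 2 : ℝ) • (q.1 + p.1)‖ ^ 2 : ℝ) : ℂ) +
        Complex.I * ((inner ℝ (p.2 - q.2) y : ℝ) : ℂ)) := by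
    rw [← integral_const_mul, coeff]
    congr 1
    funext y
    rw [conj_gaborAtom, gaborAtom, gaborAtom, ← Complex.exp_add, Complex.ofReal_exp,
      ← Complex.exp_add]
    congr 1
    have h1 := two_point_identity y q.1 p.1
    have h2 : (1 * ‖y - (1 / 2 : ℝ) • (q.1 + p.1)‖ ^ 2 : ℝ) =
      ‖y - q.1‖ ^ 2 / 2 + ‖y - p.1‖ ^ 2 / 2 - ‖q.1 - p.1‖ ^ 2 / 4 := by linarith
    rw [h2, inner_neg_left, inner_sub_left]
    push_cast
    ring
  rw [h, norm_mul, norm_integral_gaussian one_pos, Complex.norm_real,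
    Real.norm_of_nonneg (by positivity), div_one, mul_one, neg_add, Real.exp_add]
  ring

theorem norm_coeff_gaborAtom_le (q p : Phase ι) :
    ‖coeff (gaborAtom q) p‖ ≤ Real.pi ^ ((Fintype.card ι : ℝ) / 2) *
      Real.exp (-(1 / 4) * ‖p - q‖ ^ 2) := by
  rw [norm_coeff_gaborAtom]
  have hpi := Real.pi_pos
  gcongr
  have h1 := sq_nonneg ‖q.1 - p.1‖
  have h2 := sq_nonneg ‖p.2 - q.2‖
  have h3 : ‖p - q‖ ^ 2 ≤ ‖q.1 - p.1‖ ^ 2 + ‖p.2 - q.2‖ ^ 2 := by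
    rw [Prod.norm_def, Prod.fst_sub, Prod.snd_sub, norm_sub_rev p.1]
    rcases max_choice ‖q.1 - p.1‖ ‖p.2 - q.2‖ with h | h <;> rw [h] <;> linarith
  linarith

/-! ### The inversion formula -/

/-- The normalisation `(2π)^{-d} π^{-d/2}` of the inversion formula. -/
def synthConst (ι : Type) [Fintype ι] : ℝ :=
  ((2 * Real.pi) ^ Fintype.card ι * Real.pi ^ ((Fintype.card ι : ℝ) / 2))⁻¹

theorem synthConst_pos : 0 < synthConst ι := by
  unfold synthConst
  have := Real.pi_pos
  positivity

theorem integrable_of_norm_le_exp {E : Type*} [NormedAddCommGroup E] [NormedSpace ℝ E]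
    [FiniteDimensional ℝ E] [MeasurableSpace E] [BorelSpace E] {μ : Measure E}
    [μ.IsAddHaarMeasure] {F : Type*} [NormedAddCommGroup F] {θ ε K : ℝ}
    (hθ : Admissible θ) (hε : 0 < ε) {g : E → F} (hm : AEStronglyMeasurable g μ)
    (h : ∀ p, ‖g p‖ ≤ K * Real.exp (-ε * ‖p‖ ^ (1 / θ))) : Integrable g μ :=
  ((integrable_exp_neg_mul_norm_rpow μ hθ hε).const_mul K).mono' hm
    (Filter.Eventually.of_forall h)

theorem integrable_mul_exp_of_norm_le_exp {E : Type*} [NormedAddCommGroup E] [NormedSpace ℝ E]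
    [FiniteDimensional ℝ E] [MeasurableSpace E] [BorelSpace E] {μ : Measure E}
    [μ.IsAddHaarMeasure] {θ ε ε' K : ℝ}
    (hθ : Admissible θ) (hε : ε' < ε) {G : E → ℂ} (hm : AEStronglyMeasurable G μ)
    (h : ∀ p, ‖G p‖ ≤ K * Real.exp (-ε * ‖p‖ ^ (1 / θ))) :
    Integrable (fun p => ‖G p‖ * Real.exp (ε' * ‖p‖ ^ (1 / θ))) μ := by
  refine integrable_of_norm_le_exp (K := K) (ε := ε - ε') hθ (by linarith)
    (hm.norm.mul (continuous_exp_mul_norm_rpow hθ _).aestronglyMeasurable) fun p => ?_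
  rw [norm_mul, norm_norm, Real.norm_of_nonneg (Real.exp_pos _).le]
  calc _ ≤ K * Real.exp (-ε * ‖p‖ ^ (1 / θ)) * Real.exp (ε' * ‖p‖ ^ (1 / θ)) := by
        gcongr
        exact h p
    _ = _ := by rw [mul_assoc, ← Real.exp_add]; ring_nf

open scoped FourierTransform in
-- Fourier inversion for `f` times the window at `x`. The synthesis atom carries a second window,
-- and the two multiply to `exp (-‖y - x‖ ^ 2)`.
theorem integral_coeff_mul_snd {θ : ℝ} (hθ : Admissible θ) {f : Conf ι → ℂ} (hf : f ∈ GS θ ι)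
    (x y : Conf ι) :
    ∫ ξ, coeff f (x, ξ) * gaborAtom ((x, ξ) : Phase ι) y =
      (((2 * Real.pi) ^ Fintype.card ι * Real.exp (-1 * ‖y - x‖ ^ 2) : ℝ) : ℂ) * f y := by
  obtain ⟨ε, hε, K, hK, hdec⟩ := exists_norm_coeff_le hθ hf
  obtain ⟨sf, C, hC, M, hM⟩ := hf
  set F : Conf ι → ℂ := fun y => f y * gaborAtom ((x, 0) : Phase ι) y with hF
  have sF : ContDiff ℝ ∞ F := sf.mul (contDiff_gaborAtom_apply _)
  have hpi := Real.pi_pos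
  have hFi : Integrable F := by
    have h0 := integrable_norm_iteratedFDeriv_mul_window hθ hC sf hM x 0
    simp only [norm_iteratedFDeriv_zero] at h0
    exact (integrable_norm_iff sF.continuous.aestronglyMeasurable).1 h0
  set R : ℝ := -(1 / (2 * Real.pi)) with hR
  have hR0 : R ≠ 0 := by rw [hR]; exact neg_ne_zero.2 (by positivity)
  have hFF : Integrable (𝓕 F) := by
    rw [← integrable_comp_smul_iff volume _ hR0]
    have e : (fun ξ => 𝓕 F (R • ξ)) = fun ξ => coeff f (x, ξ) :=
      funext fun ξ => (coeff_eq_fourier f (x, ξ)).symm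
    rw [e]
    refine integrable_of_norm_le_exp (K := K) hθ hε
      ((measurable_coeff sf.continuous).comp measurable_prodMk_left).aestronglyMeasurable
      fun ξ => (hdec _).trans ?_
    gcongr ?_ * Real.exp ?_
    have := norm_snd_rpow_le hθ ((x, ξ) : Phase ι)
    nlinarith
  have hinv := congrFun (sF.continuous.fourierInv_fourier_eq hFi hFF) y
  rw [Real.fourierInv_eq'] at hinv
  have hcv := Measure.integral_comp_smul volume
    (fun w : Conf ι => Complex.exp (((2 * Real.pi * inner ℝ w y : ℝ) : ℂ) * Complex.I) • 𝓕 F w) R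
  rw [hinv, finrank_euclideanSpace] at hcv
  have habs : |(R ^ Fintype.card ι)⁻¹| = (2 * Real.pi) ^ Fintype.card ι := by
    rw [abs_inv, abs_pow, hR, abs_neg, abs_of_pos (by positivity), one_div, inv_pow, inv_inv]
  rw [habs] at hcv
  have e : ∀ ξ, coeff f (x, ξ) * gaborAtom ((x, ξ) : Phase ι) y = gaborAtom ((x, 0) : Phase ι) y *
      (Complex.exp (((2 * Real.pi * inner ℝ (R • ξ) y : ℝ) : ℂ) * Complex.I) •
        𝓕 F (R • ξ)) := by
    intro ξ
    rw [coeff_eq_fourier, gaborAtom_eq_mul, inner_smul_left, smul_eq_mul]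
    have : (2 * Real.pi * (starRingEnd ℝ R * inner ℝ ξ y) : ℝ) = -inner ℝ ξ y := by
      simp [hR]
      field_simp
    rw [this, hF]
    push_cast
    rw [show -((inner ℝ ξ y : ℝ) : ℂ) * Complex.I = -Complex.I * ((inner ℝ ξ y : ℝ) : ℂ) by ring]
    ring
  simp only [e]
  rw [integral_const_mul, hcv]
  have e2 : gaborAtom ((x, 0) : Phase ι) y * gaborAtom ((x, 0) : Phase ι) y =
      ((Real.exp (-1 * ‖y - x‖ ^ 2) : ℝ) : ℂ) := by
    rw [gaborAtom, ← Complex.exp_add, Complex.ofReal_exp]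
    simp
    ring_nf
  rw [Complex.ofReal_mul, ← e2, hF]
  simp
  ring

theorem integrable_coeff_mul_gaborAtom {θ : ℝ} (hθ : Admissible θ) {f : Conf ι → ℂ}
    (hf : f ∈ GS θ ι) (y : Conf ι) : Integrable fun p => coeff f p * gaborAtom p y := by
  obtain ⟨ε, hε, K, hK, hdec⟩ := exists_norm_coeff_le hθ hf
  refine integrable_of_norm_le_exp (K := K) hθ hε ?_ fun p => ?_
  · exact (measurable_coeff hf.1.continuous).aestronglyMeasurable.mul
      (Continuous.comp (g := fun q : Phase ι × Conf ι => gaborAtom q.1 q.2) (f := fun p => (p, y))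
        continuous_gaborAtom (Continuous.prodMk continuous_id continuous_const)).aestronglyMeasurable
  · rw [norm_mul]
    exact (mul_le_of_le_one_right (norm_nonneg _) (norm_gaborAtom_le_one p y)).trans (hdec p)

/-- After the frequency integral only a Gaussian in `x` is left; its integral `π ^ (d / 2)`
completes the normalisation. -/
theorem eq_synth_coeff {θ : ℝ} (hθ : Admissible θ) {f : Conf ι → ℂ} (hf : f ∈ GS θ ι)
    (y : Conf ι) : f y = (synthConst ι : ℂ) * synth (coeff f) y := by
  have hpi := Real.pi_pos
  have h := integral_prod _ (integrable_coeff_mul_gaborAtom hθ hf y)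
  have e : synth (coeff f) y =
      (((2 * Real.pi) ^ Fintype.card ι * Real.pi ^ ((Fintype.card ι : ℝ) / 2) : ℝ) : ℂ) * f y := by
    refine h.trans ?_
    simp only [integral_coeff_mul_snd hθ hf, Complex.ofReal_mul]
    rw [integral_mul_const, integral_const_mul, integral_complex_ofReal]
    have : ∫ x : Conf ι, Real.exp (-1 * ‖y - x‖ ^ 2) = Real.pi ^ ((Fintype.card ι : ℝ) / 2) := by
      rw [integral_sub_left_eq_self (fun x : Conf ι => Real.exp (-1 * ‖x‖ ^ 2)),
        GaussianFourier.integral_rexp_neg_mul_sq_norm one_pos, finrank_euclideanSpace, div_one]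
    rw [this]
  rw [e, ← mul_assoc, ← Complex.ofReal_mul, synthConst, inv_mul_cancel₀ (by positivity),
    Complex.ofReal_one, one_mul]

/-! ### Ultradistributions as superpositions of Gabor atoms -/

/-- The short-time Fourier transform `⟨u, g_p⟩` of an ultradistribution. -/
def stft {θ : ℝ} (u : GSDual θ ι) (p : Phase ι) : ℂ := pairing u (gaborAtom p)

theorem pairing_of_mem {θ : ℝ} (u : GSDual θ ι) {g : Conf ι → ℂ} (h : g ∈ GS θ ι) :
    pairing u g = u.1 ⟨g, h⟩ := dif_pos h

theorem stft_eq {θ : ℝ} (hθ : Admissible θ) (u : GSDual θ ι) (p : Phase ι) :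
    stft u p = u.1 ⟨gaborAtom p, gaborAtom_mem hθ p⟩ := pairing_of_mem u _

/-- Growth slower than every `exp (ε |p|^{1/θ})`. -/
def Moderate {E : Type*} [NormedAddCommGroup E] (θ : ℝ) (N : E → ℝ) : Prop :=
  ∀ ε > 0, ∃ K ≥ 0, ∀ p, N p ≤ K * Real.exp (ε * ‖p‖ ^ (1 / θ))

theorem moderate_stft {θ : ℝ} (hθ : Admissible θ) (u : GSDual θ ι) :
    Moderate θ fun p => ‖stft u p‖ := by
  intro ε hε
  obtain ⟨C, hC, h⟩ := normLE_gaborAtom (ι := ι) hθ hε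
  obtain ⟨K, hK⟩ := u.2 C hC
  refine ⟨|K| * (2 * Real.exp 1), by positivity, fun p => ?_⟩
  simp only
  rw [stft_eq hθ]
  refine (hK ⟨gaborAtom p, gaborAtom_mem hθ p⟩ _ (h p)).trans ?_
  calc _ ≤ |K| * (2 * Real.exp 1 * Real.exp (ε * ‖p‖ ^ (1 / θ))) := by
        gcongr
        exact le_abs_self K
    _ = _ := by ring

theorem integrable_mul_conj_gaborAtom {f : Conf ι → ℂ} (hf : Continuous f) {B : ℝ}
    (hB : ∀ y, ‖f y‖ ≤ B) (p : Phase ι) :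
    Integrable fun y => f y * starRingEnd ℂ (gaborAtom p y) := by
  have h := ((integrable_norm_gaborAtom p).norm.const_mul B)
  refine h.mono' (hf.mul (Complex.continuous_conj.comp
    (contDiff_gaborAtom_apply p).continuous)).aestronglyMeasurable
    (Filter.Eventually.of_forall fun y => ?_)
  rw [norm_mul, RCLike.norm_conj]
  gcongr
  exact hB y

theorem exists_norm_le_of_mem {θ : ℝ} (hθ : Admissible θ) {f : Conf ι → ℂ} (hf : f ∈ GS θ ι) :
    ∃ ε > 0, ∃ K ≥ 0, ∀ y, ‖f y‖ ≤ K * Real.exp (-ε * ‖y‖ ^ (1 / θ)) := by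
  obtain ⟨-, C, hC, M, hM⟩ := hf
  have := hM.nonneg
  have hθ0 := hθ.pos
  exact ⟨_, by positivity, 2 * M, by positivity, hM.norm_apply_le hθ hC⟩

theorem exists_bound_of_mem {θ : ℝ} (hθ : Admissible θ) {f : Conf ι → ℂ} (hf : f ∈ GS θ ι) :
    ∃ B, ∀ y, ‖f y‖ ≤ B := by
  obtain ⟨ε, hε, K, hK, h⟩ := exists_norm_le_of_mem hθ hf
  refine ⟨K, fun y => (h y).trans (mul_le_of_le_one_right hK (Real.exp_le_one_iff.2 ?_))⟩
  have : 0 ≤ ‖y‖ ^ (1 / θ) := by positivity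
  nlinarith

theorem integrable_of_mem {θ : ℝ} (hθ : Admissible θ) {f : Conf ι → ℂ} (hf : f ∈ GS θ ι) :
    Integrable f := by
  obtain ⟨ε, hε, K, hK, h⟩ := exists_norm_le_of_mem hθ hf
  exact integrable_of_norm_le_exp hθ hε hf.1.continuous.aestronglyMeasurable h

theorem coeff_add {θ : ℝ} (hθ : Admissible θ) {f g : Conf ι → ℂ} (hf : f ∈ GS θ ι)
    (hg : g ∈ GS θ ι) : coeff (f + g) = coeff f + coeff g := by
  obtain ⟨B, hB⟩ := exists_bound_of_mem hθ hf
  obtain ⟨B', hB'⟩ := exists_bound_of_mem hθ hg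
  funext p
  simp only [coeff, Pi.add_apply, add_mul]
  exact integral_add (integrable_mul_conj_gaborAtom hf.1.continuous hB p)
    (integrable_mul_conj_gaborAtom hg.1.continuous hB' p)

theorem coeff_smul (c : ℂ) (f : Conf ι → ℂ) : coeff (c • f) = c • coeff f := by
  funext p
  simp only [coeff, Pi.smul_apply, smul_eq_mul, mul_assoc]
  exact integral_const_mul _ _

/-- A weight at `q` moves to `p` at the cost of a factor `4` in the exponent; the Gaussian pays for
the distance. -/
theorem exp_mul_gaussian_le {E : Type*} [NormedAddCommGroup E] {θ ε c : ℝ} (hθ : Admissible θ)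
    (hε : 0 ≤ ε) (hεc : 4 * ε ≤ c) (hc : c ≤ 1) (p q : E) :
    Real.exp (ε * ‖q‖ ^ (1 / θ)) * Real.exp (-c * ‖p - q‖ ^ 2) ≤
      Real.exp 1 * Real.exp (4 * ε * ‖p‖ ^ (1 / θ)) := by
  rw [← Real.exp_add, ← Real.exp_add, Real.exp_le_exp]
  set s := 1 / θ
  have h1 : ‖q‖ ^ s ≤ 4 * (‖p‖ ^ s + ‖p - q‖ ^ s) := by
    refine le_trans ?_ (add_rpow_le_four_mul (norm_nonneg _) (norm_nonneg _) hθ.inv_nonneg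
      hθ.inv_le_two)
    have := hθ.inv_nonneg
    gcongr
    calc ‖q‖ = ‖p - (p - q)‖ := by simp
      _ ≤ _ := norm_sub_le _ _
  have h2 := rpow_le_one_add_sq (norm_nonneg (p - q)) hθ.inv_nonneg hθ.inv_le_two
  have h3 := mul_le_mul_of_nonneg_left h1 hε
  have h4 := mul_le_mul_of_nonneg_left h2 hε
  have h5 : 4 * ε * ‖p - q‖ ^ 2 ≤ c * ‖p - q‖ ^ 2 := by gcongr
  nlinarith

/-- The constant in the bound for `coeff (gaborAtom q)`. -/
def atomConst (ι : Type) [Fintype ι] : ℝ :=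
  Real.pi ^ ((Fintype.card ι : ℝ) / 2) * Real.exp 1

theorem atomConst_pos : 0 < atomConst ι := by
  unfold atomConst
  have := Real.pi_pos
  positivity

theorem norm_coeff_gaborAtom_le_exp {θ ε : ℝ} (hθ : Admissible θ) (hε : 0 ≤ ε) (hε' : ε ≤ 1 / 16)
    (q p : Phase ι) : ‖coeff (gaborAtom q) p‖ ≤ atomConst ι *
      (Real.exp (4 * ε * ‖q‖ ^ (1 / θ)) * Real.exp (-ε * ‖p‖ ^ (1 / θ))) := by
  have hpi := Real.pi_pos
  have h := exp_mul_gaussian_le hθ hε (c := 1 / 4) (by linarith) (by norm_num) q p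
  have h1 := norm_coeff_gaborAtom_le q p
  rw [norm_sub_rev] at h1
  have hx := Real.exp_pos (ε * ‖p‖ ^ (1 / θ))
  rw [neg_mul ε, Real.exp_neg, ← div_eq_mul_inv, mul_div_assoc', le_div_iff₀ hx]
  calc _ ≤ Real.pi ^ ((Fintype.card ι : ℝ) / 2) * Real.exp (-(1 / 4) * ‖q - p‖ ^ 2) *
        Real.exp (ε * ‖p‖ ^ (1 / θ)) := by gcongr
    _ = Real.pi ^ ((Fintype.card ι : ℝ) / 2) *
        (Real.exp (ε * ‖p‖ ^ (1 / θ)) * Real.exp (-(1 / 4) * ‖q - p‖ ^ 2)) := by ring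
    _ ≤ Real.pi ^ ((Fintype.card ι : ℝ) / 2) *
        (Real.exp 1 * Real.exp (4 * ε * ‖q‖ ^ (1 / θ))) := by gcongr
    _ = _ := by rw [atomConst]; ring

theorem stronglyMeasurable_coeff_gaborAtom :
    StronglyMeasurable fun r : Phase ι × Phase ι => coeff (gaborAtom r.1) r.2 := by
  have : StronglyMeasurable fun t : (Phase ι × Phase ι) × Conf ι =>
      gaborAtom t.1.1 t.2 * starRingEnd ℂ (gaborAtom t.1.2 t.2) := by
    refine Continuous.stronglyMeasurable (Continuous.mul ?_ (Complex.continuous_conj.comp ?_))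
    · exact Continuous.comp (g := fun q : Phase ι × Conf ι => gaborAtom q.1 q.2)
        (f := fun t : (Phase ι × Phase ι) × Conf ι => (t.1.1, t.2)) continuous_gaborAtom
        (by fun_prop)
    · exact Continuous.comp (g := fun q : Phase ι × Conf ι => gaborAtom q.1 q.2)
        (f := fun t : (Phase ι × Phase ι) × Conf ι => (t.1.2, t.2)) continuous_gaborAtom
        (by fun_prop)
  exact this.integral_prod_right'

/-! ### Representation of linear forms by square integrable functions -/

/-- A linear form that is bounded by `‖j v‖` for a linear map `j` into a Hilbert space is
represented by a vector of that space. -/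
theorem exists_inner_eq_of_norm_le {V H : Type*} [AddCommGroup V] [Module ℂ V]
    [NormedAddCommGroup H] [InnerProductSpace ℂ H] [CompleteSpace H] (j : V →ₗ[ℂ] H)
    (u : V →ₗ[ℂ] ℂ) {K : ℝ} (h : ∀ v, ‖u v‖ ≤ K * ‖j v‖) :
    ∃ a : H, ∀ v, u v = inner ℂ a (j v) := by
  -- The bound forces `u` to vanish on the kernel of `j`, so `u` descends to a continuous form on
  -- the range of `j`; Hahn–Banach and Riesz finish.
  have hker : ∀ v w, j v = j w → u v = u w := by
    intro v w hvw
    have := h (v - w)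
    rw [map_sub, map_sub, hvw, sub_self, norm_zero, mul_zero] at this
    exact sub_eq_zero.1 (norm_le_zero_iff.1 this)
  choose pre hpre using fun y : LinearMap.range j => LinearMap.mem_range.1 y.2
  let g : LinearMap.range j →ₗ[ℂ] ℂ :=
    { toFun := fun y => u (pre y)
      map_add' := fun y z => by
        rw [← map_add]
        refine hker _ _ ?_
        rw [map_add, hpre, hpre, hpre]
        rfl
      map_smul' := fun c y => by
        rw [RingHom.id_apply, ← map_smul]
        refine hker _ _ ?_
        rw [map_smul, hpre, hpre]
        rfl }
  let g' : StrongDual ℂ (LinearMap.range j) := g.mkContinuous K fun y => by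
    have := h (pre y)
    rw [hpre] at this
    exact this
  obtain ⟨G, hG, -⟩ := exists_extension_norm_eq (LinearMap.range j) g'
  refine ⟨(InnerProductSpace.toDual ℂ H).symm G, fun v => ?_⟩
  rw [InnerProductSpace.toDual_symm_apply]
  have := hG ⟨j v, LinearMap.mem_range_self j v⟩
  rw [this]
  exact hker _ _ (hpre ⟨j v, LinearMap.mem_range_self j v⟩).symm

theorem memLp_two_of_norm_le_exp {E : Type*} [NormedAddCommGroup E] [NormedSpace ℝ E]
    [FiniteDimensional ℝ E] [MeasurableSpace E] [BorelSpace E] {μ : Measure E}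
    [μ.IsAddHaarMeasure] {F : Type*} [NormedAddCommGroup F] {θ ε K : ℝ}
    (hθ : Admissible θ) (hε : 0 < ε) {g : E → F} (hm : AEStronglyMeasurable g μ)
    (h : ∀ p, ‖g p‖ ≤ K * Real.exp (-ε * ‖p‖ ^ (1 / θ))) : MemLp g 2 μ := by
  rw [memLp_two_iff_integrable_sq_norm hm]
  refine integrable_of_norm_le_exp (K := K ^ 2) (ε := 2 * ε) hθ (by linarith) (hm.norm.pow 2)
    fun p => ?_
  rw [norm_pow, norm_norm]
  calc ‖g p‖ ^ 2 ≤ (K * Real.exp (-ε * ‖p‖ ^ (1 / θ))) ^ 2 := by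
        gcongr
        exact h p
    _ = _ := by rw [mul_pow, ← Real.exp_nat_mul]; push_cast; ring_nf

theorem integral_norm_mul_le_of_memLp_two {α : Type*} [MeasurableSpace α] {μ : Measure α}
    {f : α → ℂ} {g : α → ℝ} (hf : MemLp f 2 μ) (hg : MemLp g 2 μ) :
    ∫ p, ‖f p‖ * ‖g p‖ ∂μ ≤ ‖hf.toLp f‖ * ‖hg.toLp g‖ := by
  have h := integral_mul_norm_le_Lp_mul_Lq (μ := μ) (f := fun p => ‖f p‖) (g := g) (p := 2) (q := 2)
    Real.HolderConjugate.two_two (by simpa using hf.norm) (by simpa using hg)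
  simp only [norm_norm] at h
  refine h.trans (le_of_eq ?_)
  rw [Lp.norm_toLp, Lp.norm_toLp, hf.eLpNorm_eq_integral_rpow_norm (by norm_num) (by norm_num),
    hg.eLpNorm_eq_integral_rpow_norm (by norm_num) (by norm_num), ENNReal.toReal_ofReal,
    ENNReal.toReal_ofReal]
  · norm_num
  · exact Real.rpow_nonneg (integral_nonneg fun _ => by positivity) _
  · exact Real.rpow_nonneg (integral_nonneg fun _ => by positivity) _

/-- A linear form that is bounded by the `L²` norm of a linear map into functions is represented by
integration against a square integrable function. -/
theorem exists_integral_eq_of_norm_le {V α : Type*} [AddCommGroup V] [Module ℂ V]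
    [MeasurableSpace α] {μ : Measure α} (J : V →ₗ[ℂ] (α → ℂ)) (u : V →ₗ[ℂ] ℂ) {K : ℝ}
    (h : ∀ v (hv : MemLp (J v) 2 μ), ‖u v‖ ≤ K * ‖hv.toLp (J v)‖) :
    ∃ H : α → ℂ, StronglyMeasurable H ∧ MemLp H 2 μ ∧
      ∀ v, MemLp (J v) 2 μ → u v = ∫ p, H p * J v p ∂μ := by
  let S : Submodule ℂ V :=
    { carrier := {v | MemLp (J v) 2 μ}
      zero_mem' := by
        change MemLp (J 0) 2 μ
        rw [map_zero]
        exact MemLp.zero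
      add_mem' := fun {v w} hv hw => by
        change MemLp (J (v + w)) 2 μ
        rw [map_add]
        exact MemLp.add hv hw
      smul_mem' := fun c v hv => by
        change MemLp (J (c • v)) 2 μ
        rw [map_smul]
        exact MemLp.const_smul hv c }
  have hS : ∀ v : S, MemLp (J v) 2 μ := fun v => v.2
  let j : S →ₗ[ℂ] Lp ℂ 2 μ :=
    { toFun := fun v => (hS v).toLp (J v)
      map_add' := fun v w => by
        rw [← MemLp.toLp_add]
        exact MemLp.toLp_congr _ _ (Filter.EventuallyEq.of_eq (map_add J _ _))
      map_smul' := fun c v => by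
        rw [RingHom.id_apply, ← MemLp.toLp_const_smul]
        exact MemLp.toLp_congr _ _ (Filter.EventuallyEq.of_eq (map_smul J _ _)) }
  obtain ⟨a, ha⟩ := exists_inner_eq_of_norm_le j (u ∘ₗ S.subtype) (fun v => h v (hS v))
  refine ⟨fun p => starRingEnd ℂ (a p), ?_, ?_, fun v hv => ?_⟩
  · exact Complex.continuous_conj.comp_stronglyMeasurable (Lp.stronglyMeasurable a)
  · exact (Lp.memLp a).star
  · have h1 := ha ⟨v, hv⟩
    change u v = inner ℂ a (hv.toLp _) at h1
    rw [h1, L2.inner_def]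
    refine integral_congr_ae ?_
    filter_upwards [hv.coeFn_toLp] with p hp
    rw [hp, RCLike.inner_apply, mul_comm]

/-- The weighted Gabor coefficients of a function. -/
def wcoeff (θ ε : ℝ) (f : Conf ι → ℂ) (p : Phase ι) : ℂ :=
  ((Real.exp (ε * ‖p‖ ^ (1 / θ)) : ℝ) : ℂ) * coeff f p

theorem wcoeff_add {θ ε : ℝ} (hθ : Admissible θ) {f g : Conf ι → ℂ} (hf : f ∈ GS θ ι)
    (hg : g ∈ GS θ ι) : wcoeff θ ε (f + g) = wcoeff θ ε f + wcoeff θ ε g := by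
  funext p
  simp only [wcoeff, coeff_add hθ hf hg, Pi.add_apply, mul_add]

theorem wcoeff_smul {θ ε : ℝ} (c : ℂ) (f : Conf ι → ℂ) :
    wcoeff θ ε (c • f) = c • wcoeff θ ε f := by
  funext p
  simp only [wcoeff, coeff_smul, Pi.smul_apply, smul_eq_mul]
  ring

theorem norm_wcoeff {θ ε : ℝ} (f : Conf ι → ℂ) (p : Phase ι) :
    ‖wcoeff θ ε f p‖ = Real.exp (ε * ‖p‖ ^ (1 / θ)) * ‖coeff f p‖ := by
  rw [wcoeff, norm_mul, Complex.norm_real, Real.norm_of_nonneg (Real.exp_pos _).le]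

theorem measurable_wcoeff {θ ε : ℝ} (hθ : Admissible θ) {f : Conf ι → ℂ} (hf : Continuous f) :
    Measurable (wcoeff θ ε f) :=
  (Complex.measurable_ofReal.comp (continuous_exp_mul_norm_rpow hθ ε).measurable).mul
    (measurable_coeff hf)

/-- The weighted coefficients as a linear map. -/
def wcoeffMap {θ : ℝ} (hθ : Admissible θ) (ε : ℝ) : GS θ ι →ₗ[ℂ] (Phase ι → ℂ) where
  toFun f := wcoeff θ ε (f : Conf ι → ℂ)
  map_add' f g := wcoeff_add hθ f.2 g.2
  map_smul' c f := wcoeff_smul c (f : Conf ι → ℂ)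

/-- A form given by an integral commutes with other integrals by Fubini, which is what `apply_synth`
and `measurable_stft` need. It exists because `f` is the superposition of its coefficients:
`normLE_synth` bounds `u` by a weighted `L¹` norm of them, and Cauchy–Schwarz by a weighted `L²`
norm. -/
theorem exists_l2_representation {θ ε : ℝ} (hθ : Admissible θ) (hε : 0 < ε) (u : GSDual θ ι) :
    ∃ H : Phase ι → ℂ, StronglyMeasurable H ∧ MemLp H 2 volume ∧ ∀ f : GS θ ι,
      MemLp (wcoeff θ ε (f : Conf ι → ℂ)) 2 volume →
        u.1 f = ∫ p, H p * wcoeff θ ε (f : Conf ι → ℂ) p := by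
  -- Only half of the weight is used for the `L¹` norm; the remaining factor `exp (-(ε / 2) ‖p‖ ^ (1
  -- / θ))` is the square integrable partner in Cauchy–Schwarz.
  obtain ⟨C, hC, hs⟩ := normLE_synth (ι := ι) hθ (half_pos hε)
  obtain ⟨K, hK⟩ := u.2 C hC
  have hw : MemLp (fun p : Phase ι => Real.exp (-(ε / 2) * ‖p‖ ^ (1 / θ))) 2 volume :=
    memLp_two_of_norm_le_exp (K := 1) hθ (half_pos hε)
      (continuous_exp_mul_norm_rpow hθ _).aestronglyMeasurable fun p => by
        rw [Real.norm_of_nonneg (Real.exp_pos _).le, one_mul]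
  have hc := (synthConst_pos (ι := ι))
  set c : ℂ := (synthConst ι : ℂ) with hcdef
  have bound : ∀ (f : GS θ ι) (hfm : MemLp (wcoeff θ ε (f : Conf ι → ℂ)) 2 volume), ‖u.1 f‖ ≤
      |K| * (2 * Real.exp 1 * synthConst ι * ‖hw.toLp _‖) * ‖hfm.toLp _‖ := by
    intro f hfm
    set G : Phase ι → ℂ := fun p => c * coeff (f : Conf ι → ℂ) p with hG
    have hGm : AEStronglyMeasurable G volume :=
      ((measurable_coeff f.2.1.continuous).const_mul c).aestronglyMeasurable
    have e : ∀ p, ‖G p‖ * Real.exp (ε / 2 * ‖p‖ ^ (1 / θ)) = synthConst ι *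
        (‖wcoeff θ ε (f : Conf ι → ℂ) p‖ * ‖Real.exp (-(ε / 2) * ‖p‖ ^ (1 / θ))‖) := by
      intro p
      rw [norm_wcoeff, hG, norm_mul, hcdef, Complex.norm_real, Real.norm_of_nonneg hc.le,
        Real.norm_of_nonneg (Real.exp_pos _).le]
      have : Real.exp (ε / 2 * ‖p‖ ^ (1 / θ)) = Real.exp (ε * ‖p‖ ^ (1 / θ)) *
          Real.exp (-(ε / 2) * ‖p‖ ^ (1 / θ)) := by
        rw [← Real.exp_add]
        ring_nf
      rw [this]
      ring
    have hGi : Integrable fun p => ‖G p‖ * Real.exp (ε / 2 * ‖p‖ ^ (1 / θ)) := by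
      simp only [e]
      exact (hfm.norm.integrable_mul hw.norm).const_mul _
    have hfs : (f : Conf ι → ℂ) = synth G := by
      funext y
      rw [eq_synth_coeff hθ f.2 y, synth, synth, ← integral_const_mul]
      congr 1
      funext p
      rw [hG]
      ring
    have h1 := hs G hGm hGi
    rw [← hfs] at h1
    have h2 := hK f _ h1
    have h3 := integral_norm_mul_le_of_memLp_two hfm hw
    refine h2.trans ?_
    simp only [e]
    rw [integral_const_mul]
    have h4 : 0 ≤ ∫ p, ‖wcoeff θ ε (f : Conf ι → ℂ) p‖ *
      ‖Real.exp (-(ε / 2) * ‖p‖ ^ (1 / θ))‖ := integral_nonneg fun p => by positivity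
    calc _ ≤ |K| * (2 * Real.exp 1 * (synthConst ι *
          (‖MemLp.toLp _ hfm‖ * ‖hw.toLp _‖))) := by
          gcongr
          exact le_abs_self K
      _ = _ := by ring
  exact exists_integral_eq_of_norm_le (wcoeffMap hθ ε) u.1 bound

/-! ### Interchange of an ultradistribution with a superposition of atoms -/

section Exchange

variable {θ ε : ℝ} {G : Phase ι → ℂ}

theorem integrable_of_integrable_mul_exp (hε : 0 ≤ ε)
    (hm : AEStronglyMeasurable G volume)
    (hG : Integrable fun p => ‖G p‖ * Real.exp (ε * ‖p‖ ^ (1 / θ))) : Integrable G := by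
  refine hG.mono' hm (Filter.Eventually.of_forall fun p => ?_)
  exact le_mul_of_one_le_right (norm_nonneg _) (Real.one_le_exp (by positivity))

theorem coeff_synth (hG : Integrable G) (q : Phase ι) :
    coeff (synth G) q = ∫ p, G p * coeff (gaborAtom p) q := by
  have hint : Integrable (Function.uncurry fun (y : Conf ι) (p : Phase ι) =>
      G p * gaborAtom p y * starRingEnd ℂ (gaborAtom q y)) (volume.prod volume) := by
    have h := (integrable_norm_gaborAtom q).norm.mul_prod hG.norm
    refine h.mono' ?_ (Filter.Eventually.of_forall fun r => ?_)
    · refine (hG.1.comp_snd.mul ?_).mul ?_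
      · exact (Continuous.comp (g := fun q : Phase ι × Conf ι => gaborAtom q.1 q.2)
          (f := fun t : Conf ι × Phase ι => (t.2, t.1)) continuous_gaborAtom
          (by fun_prop)).aestronglyMeasurable
      · exact ((Complex.continuous_conj.comp
          (contDiff_gaborAtom_apply q).continuous).comp continuous_fst).aestronglyMeasurable
    · simp only [Function.uncurry]
      rw [norm_mul, norm_mul, RCLike.norm_conj, mul_comm]
      gcongr
      exact mul_le_of_le_one_right (norm_nonneg _) (norm_gaborAtom_le_one _ _)
  calc coeff (synth G) q = ∫ y, ∫ p, G p * gaborAtom p y * starRingEnd ℂ (gaborAtom q y) := by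
        unfold coeff synth
        congr 1
        funext y
        rw [integral_mul_const]
    _ = ∫ p, ∫ y, G p * gaborAtom p y * starRingEnd ℂ (gaborAtom q y) :=
        integral_integral_swap hint
    _ = _ := by
        congr 1
        funext p
        rw [coeff, ← integral_const_mul]
        simp only [mul_assoc]

/-- With the `L²` representative `H` of `u`, both sides are iterated integrals of the same function;
the bound `hker` makes the double integral absolutely convergent. -/
theorem apply_synth (hθ : Admissible θ) (hε : 0 < ε) (u : GSDual θ ι)
    (hm : AEStronglyMeasurable G volume)
    (hG : Integrable fun p => ‖G p‖ * Real.exp (ε * ‖p‖ ^ (1 / θ))) :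
    u.1 ⟨synth G, synth_mem hθ hε hm hG⟩ = ∫ p, G p * stft u p := by
  have hGi := integrable_of_integrable_mul_exp hε.le hm hG
  -- Moving the weight `2 η` from `q` to `p` costs `4 * (2 η) ≤ ε`, and `2 η ≤ 1 / 16` is the range
  -- of `norm_coeff_gaborAtom_le_exp`. A decay of rate `η` in `q` survives the weight of `wcoeff`.
  set η := min (ε / 8) (1 / 32) with hη
  have hη0 : 0 < η := by positivity
  have h6 : η ≤ ε / 8 := min_le_left _ _
  have h7 : η ≤ 1 / 32 := min_le_right _ _
  have hat := atomConst_pos (ι := ι)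
  have hker : ∀ p q : Phase ι, ‖wcoeff θ η (gaborAtom p) q‖ ≤ atomConst ι *
      (Real.exp (ε * ‖p‖ ^ (1 / θ)) * Real.exp (-η * ‖q‖ ^ (1 / θ))) := by
    intro p q
    rw [norm_wcoeff]
    have h1 := norm_coeff_gaborAtom_le_exp (ε := 2 * η) hθ (by linarith) (by linarith) p q
    have h8 : 0 ≤ ‖p‖ ^ (1 / θ) := by positivity
    calc _ ≤ Real.exp (η * ‖q‖ ^ (1 / θ)) * (atomConst ι *
          (Real.exp (4 * (2 * η) * ‖p‖ ^ (1 / θ)) *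
            Real.exp (-(2 * η) * ‖q‖ ^ (1 / θ)))) := by gcongr
      _ ≤ Real.exp (η * ‖q‖ ^ (1 / θ)) * (atomConst ι *
          (Real.exp (ε * ‖p‖ ^ (1 / θ)) * Real.exp (-(2 * η) * ‖q‖ ^ (1 / θ)))) := by
          gcongr
          linarith
      _ = atomConst ι * (Real.exp (ε * ‖p‖ ^ (1 / θ)) * (Real.exp (η * ‖q‖ ^ (1 / θ)) *
          Real.exp (-(2 * η) * ‖q‖ ^ (1 / θ)))) := by ring
      _ = _ := by
          rw [← Real.exp_add (η * _)]
          ring_nf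
  obtain ⟨H, hHm, hH, hrep⟩ := exists_l2_representation hθ hη0 u
  have hatom : ∀ p : Phase ι, MemLp (wcoeff θ η (gaborAtom p)) 2 volume := fun p =>
    memLp_two_of_norm_le_exp (K := atomConst ι * Real.exp (ε * ‖p‖ ^ (1 / θ))) hθ hη0
      (measurable_wcoeff hθ (contDiff_gaborAtom_apply p).continuous).aestronglyMeasurable
      fun q => (hker p q).trans (le_of_eq (by ring))
  have hws : ∀ q, wcoeff θ η (synth G) q = ∫ p, G p * wcoeff θ η (gaborAtom p) q := by
    intro q
    rw [wcoeff, coeff_synth hGi, ← integral_const_mul]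
    congr 1
    funext p
    rw [wcoeff]
    ring
  have hsm : MemLp (wcoeff θ η (synth G)) 2 volume := by
    refine memLp_two_of_norm_le_exp
      (K := ∫ p, atomConst ι * (‖G p‖ * Real.exp (ε * ‖p‖ ^ (1 / θ)))) hθ hη0
      (measurable_wcoeff hθ (contDiff_synth hθ hε hm hG).continuous).aestronglyMeasurable
      fun q => ?_
    rw [hws, ← integral_mul_const]
    refine norm_integral_le_of_norm_le ((hG.const_mul _).mul_const _)
      (Filter.Eventually.of_forall fun p => ?_)
    rw [norm_mul]
    calc _ ≤ ‖G p‖ * _ := mul_le_mul_of_nonneg_left (hker p q) (norm_nonneg _)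
      _ = _ := by ring
  have hwm : MemLp (fun p : Phase ι => Real.exp (-η * ‖p‖ ^ (1 / θ))) 2 volume :=
    memLp_two_of_norm_le_exp (K := 1) hθ hη0
      (continuous_exp_mul_norm_rpow hθ _).aestronglyMeasurable fun p => by
        rw [Real.norm_of_nonneg (Real.exp_pos _).le, one_mul]
  have hint : Integrable (Function.uncurry fun (q p : Phase ι) =>
      H q * (G p * wcoeff θ η (gaborAtom p) q)) (volume.prod volume) := by
    have h := ((hH.norm.integrable_mul hwm).const_mul (atomConst ι)).mul_prod hG
    refine h.mono' ?_ (Filter.Eventually.of_forall fun r => ?_)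
    · refine hH.1.comp_fst.mul (hm.comp_snd.mul (AEStronglyMeasurable.mul ?_ ?_))
      · exact (Complex.continuous_ofReal.comp ((continuous_exp_mul_norm_rpow hθ η).comp
          continuous_fst)).aestronglyMeasurable
      · exact (stronglyMeasurable_coeff_gaborAtom.comp_measurable
          measurable_swap).aestronglyMeasurable
    · simp only [Function.uncurry, Pi.mul_apply]
      rw [norm_mul, norm_mul]
      have h1 := hker r.2 r.1
      calc _ ≤ ‖H r.1‖ * (‖G r.2‖ * (atomConst ι *
            (Real.exp (ε * ‖r.2‖ ^ (1 / θ)) * Real.exp (-η * ‖r.1‖ ^ (1 / θ))))) := by gcongr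
        _ = _ := by ring
  refine (hrep ⟨synth G, synth_mem hθ hε hm hG⟩ hsm).trans ?_
  calc ∫ q, H q * wcoeff θ η (synth G) q
      = ∫ q, ∫ p, H q * (G p * wcoeff θ η (gaborAtom p) q) := by
        congr 1
        funext q
        rw [hws, integral_const_mul]
    _ = ∫ p, ∫ q, H q * (G p * wcoeff θ η (gaborAtom p) q) := integral_integral_swap hint
    _ = _ := by
        congr 1
        funext p
        rw [(stft_eq hθ u p).trans (hrep ⟨gaborAtom p, gaborAtom_mem hθ p⟩ (hatom p)),
          ← integral_const_mul]
        congr 1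
        funext q
        ring

end Exchange

/-- The representative `H` writes the transform as a parameter integral of a jointly measurable
function. -/
theorem measurable_stft {θ : ℝ} (hθ : Admissible θ) (u : GSDual θ ι) : Measurable (stft u) := by
  obtain ⟨H, hHm, hH, hrep⟩ := exists_l2_representation hθ (ε := 1 / 32) (by norm_num) u
  have hatom : ∀ p : Phase ι, MemLp (wcoeff θ (1 / 32) (gaborAtom p)) 2 volume := fun p => by
    refine memLp_two_of_norm_le_exp
      (K := atomConst ι * Real.exp (4 * (1 / 16) * ‖p‖ ^ (1 / θ))) (ε := 1 / 32) hθ (by norm_num)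
      (measurable_wcoeff hθ (contDiff_gaborAtom_apply p).continuous).aestronglyMeasurable
      fun q => ?_
    rw [norm_wcoeff]
    have h1 := norm_coeff_gaborAtom_le_exp (ε := 1 / 16) hθ (by norm_num) le_rfl p q
    calc _ ≤ Real.exp (1 / 32 * ‖q‖ ^ (1 / θ)) * _ :=
          mul_le_mul_of_nonneg_left h1 (Real.exp_pos _).le
      _ = atomConst ι * Real.exp (4 * (1 / 16) * ‖p‖ ^ (1 / θ)) *
          (Real.exp (1 / 32 * ‖q‖ ^ (1 / θ)) * Real.exp (-(1 / 16) * ‖q‖ ^ (1 / θ))) := by ring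
      _ = _ := by
          rw [← Real.exp_add]
          ring_nf
  have e : stft u = fun p => ∫ q, H q * wcoeff θ (1 / 32) (gaborAtom p) q :=
    funext fun p => by rw [stft_eq hθ, hrep ⟨gaborAtom p, gaborAtom_mem hθ p⟩ (hatom p)]
  rw [e]
  have hs : StronglyMeasurable fun r : Phase ι × Phase ι =>
      H r.2 * wcoeff θ (1 / 32) (gaborAtom r.1) r.2 := by
    refine (hHm.comp_measurable measurable_snd).mul (StronglyMeasurable.mul ?_
      stronglyMeasurable_coeff_gaborAtom)
    exact (Complex.continuous_ofReal.comp ((continuous_exp_mul_norm_rpow hθ _).comp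
      continuous_snd)).stronglyMeasurable
  exact hs.integral_prod_right'.measurable

theorem apply_eq_integral {θ : ℝ} (hθ : Admissible θ) (u : GSDual θ ι) (f : GS θ ι) :
    u.1 f = (synthConst ι : ℂ) * ∫ p, coeff (f : Conf ι → ℂ) p * stft u p := by
  obtain ⟨ε, hε, K, hK, hdec⟩ := exists_norm_coeff_le hθ f.2
  have hm : AEStronglyMeasurable (coeff (f : Conf ι → ℂ)) volume :=
    (measurable_coeff f.2.1.continuous).aestronglyMeasurable
  have hG := integrable_mul_exp_of_norm_le_exp hθ (half_lt_self hε) hm hdec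
  rw [← apply_synth hθ (half_pos hε) u hm hG, ← smul_eq_mul, ← map_smul]
  congr 1
  ext y
  exact eq_synth_coeff hθ f.2 y

/-! ### Decay in cones and Gaussian kernels -/

section Decay

variable {E : Type*} [NormedAddCommGroup E] [NormedSpace ℝ E]
  {E' : Type*} [NormedAddCommGroup E'] [NormedSpace ℝ E']
  {H : Type*} [NormedAddCommGroup H] [NormedSpace ℝ H]

/-- An open set that is invariant under multiplication by positive numbers. -/
def IsOpenCone (L : Set E) : Prop := IsOpen L ∧ ∀ z ∈ L, ∀ t : ℝ, 0 < t → t • z ∈ L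

/-- `N` decays like `exp (-ε |z|^{1/θ})` in an open cone containing `S`. -/
def DecayOn (θ : ℝ) (N : E → ℝ) (S : Set E) : Prop :=
  ∃ L, IsOpenCone L ∧ S ⊆ L ∧ ∃ ε > 0, ∃ C ≥ 0, ∀ z ∈ L, N z ≤ C * Real.exp (-ε * ‖z‖ ^ (1 / θ))

/-- `N` decays like `exp (-ε |z|^{1/θ})` in an open cone containing the point `x`. -/
def DecayAt (θ : ℝ) (N : E → ℝ) (x : E) : Prop := DecayOn θ N {x}

theorem DecayAt.mono {θ : ℝ} {N N' : E → ℝ} {x : E} (h : DecayAt θ N x) (hN : ∀ z, N' z ≤ N z) :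
    DecayAt θ N' x := by
  obtain ⟨L, hL, hx, ε, hε, C, hC, hb⟩ := h
  exact ⟨L, hL, hx, ε, hε, C, hC, fun z hz => (hN z).trans (hb z hz)⟩

theorem DecayAt.smul {θ : ℝ} {N : E → ℝ} {x : E} (h : DecayAt θ N x) {t : ℝ} (ht : 0 < t) :
    DecayAt θ N (t • x) := by
  obtain ⟨L, hL, hx, h⟩ := h
  exact ⟨L, hL, Set.singleton_subset_iff.2 (hL.2 x (Set.singleton_subset_iff.1 hx) t ht), h⟩

theorem DecayAt.const_mul {θ : ℝ} {N : E → ℝ} {x : E} (h : DecayAt θ N x) {c : ℝ} (hc : 0 ≤ c) :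
    DecayAt θ (fun z => c * N z) x := by
  obtain ⟨L, hL, hx, ε, hε, C, hC, hb⟩ := h
  exact ⟨L, hL, hx, ε, hε, c * C, by positivity, fun z hz =>
    (mul_le_mul_of_nonneg_left (hb z hz) hc).trans (le_of_eq (by ring))⟩

theorem DecayOn.union {θ : ℝ} {N : E → ℝ} {S T : Set E} (hS : DecayOn θ N S)
    (hT : DecayOn θ N T) : DecayOn θ N (S ∪ T) := by
  obtain ⟨L, hL, hSL, ε, hε, C, hC, hb⟩ := hS
  obtain ⟨L', hL', hTL, ε', hε', C', hC', hb'⟩ := hT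
  refine ⟨L ∪ L', ⟨hL.1.union hL'.1, ?_⟩, Set.union_subset_union hSL hTL, min ε ε', by positivity,
    max C C', by positivity, ?_⟩
  · rintro z (hz | hz) t ht
    · exact Or.inl (hL.2 z hz t ht)
    · exact Or.inr (hL'.2 z hz t ht)
  · rintro z (hz | hz)
    · refine (hb z hz).trans ?_
      gcongr
      · exact le_max_left _ _
      · exact min_le_left _ _
    · refine (hb' z hz).trans ?_
      gcongr
      · exact le_max_right _ _
      · exact min_le_right _ _

theorem DecayAt.add {θ : ℝ} {N N' : E → ℝ} {x : E} (h : DecayAt θ N x) (h' : DecayAt θ N' x) :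
    DecayAt θ (fun z => N z + N' z) x := by
  obtain ⟨L, hL, hx, ε, hε, C, hC, hb⟩ := h
  obtain ⟨L', hL', hx', ε', hε', C', hC', hb'⟩ := h'
  refine ⟨L ∩ L', ⟨hL.1.inter hL'.1, fun z hz t ht => ⟨hL.2 z hz.1 t ht, hL'.2 z hz.2 t ht⟩⟩,
    Set.subset_inter hx hx', min ε ε', by positivity, C + C', by positivity, fun z hz => ?_⟩
  rw [add_mul]
  refine add_le_add ((hb z hz.1).trans ?_) ((hb' z hz.2).trans ?_)
  · gcongr
    exact min_le_left _ _
  · gcongr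
    exact min_le_right _ _

/-- Finitely many of the open cones cover `S`, and on their union the smallest of the rates serves.
-/
theorem decayOn_of_isCompact {θ : ℝ} {N : E → ℝ} {S : Set E} (hS : IsCompact S)
    (h : ∀ x ∈ S, DecayAt θ N x) : DecayOn θ N S := by
  refine hS.induction_on (p := DecayOn θ N) ?_ ?_ (fun s t hs ht => hs.union ht) fun x hx => ?_
  · exact ⟨∅, ⟨isOpen_empty, fun z hz => hz.elim⟩, subset_rfl, 1, one_pos, 0, le_rfl,
      fun z hz => hz.elim⟩
  · rintro s t hst ⟨L, hL, htL, hb⟩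
    exact ⟨L, hL, hst.trans htL, hb⟩
  · obtain ⟨L, hL, hxL, hb⟩ := h x hx
    exact ⟨L, mem_nhdsWithin_of_mem_nhds (hL.1.mem_nhds (Set.singleton_subset_iff.1 hxL)),
      L, hL, subset_rfl, hb⟩

theorem rpow_norm_le_mul {θ R a b : ℝ} (hθ : Admissible θ) (hR : 0 < R) (ha : 0 ≤ a) (hb : 0 ≤ b)
    (h : a ≤ R * b) : (R ^ (1 / θ))⁻¹ * a ^ (1 / θ) ≤ b ^ (1 / θ) := by
  have h1 := Real.rpow_le_rpow ha h hθ.inv_nonneg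
  rw [Real.mul_rpow hR.le hb] at h1
  rwa [inv_mul_le_iff₀ (by positivity)]

variable {θ : ℝ} {N : E → ℝ} (A : E →L[ℝ] H) (B : E' →L[ℝ] H) {c : ℝ}

/-- In a cone around `(p₀, q₀)` the difference `A p - B q` is at least a multiple of `‖(p, q)‖`, so
the Gaussian is quadratic in the full norm and beats the moderate factor because `1 / θ ≤ 2`. -/
theorem decayAt_kernel_of_ne (hθ : Admissible θ) (hN : Moderate θ N) (hc : 0 < c) {p₀ : E} {q₀ : E'}
    (h : A p₀ ≠ B q₀) :
    DecayAt θ (fun r : E × E' => N r.1 * Real.exp (-c * ‖A r.1 - B r.2‖ ^ 2)) (p₀, q₀) := by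
  set r₀ : E × E' := (p₀, q₀)
  have hd : 0 < ‖A p₀ - B q₀‖ := norm_pos_iff.2 (sub_ne_zero.2 h)
  -- The `+ 1` makes the inequality defining the open cone strict at `r₀`.
  set δ := ‖A p₀ - B q₀‖ / (‖r₀‖ + 1) with hδ
  have hδ0 : 0 < δ := by positivity
  obtain ⟨K, hK, hNK⟩ := hN (c * δ ^ 2 / 2) (by positivity)
  refine ⟨{r | δ * ‖r‖ < ‖A r.1 - B r.2‖}, ⟨?_, ?_⟩, ?_, c * δ ^ 2 / 2, by positivity,
    K * Real.exp (c * δ ^ 2), by positivity, ?_⟩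
  · exact isOpen_lt (by fun_prop) (by fun_prop)
  · intro r hr t ht
    simp only [Set.mem_ofPred_eq, Prod.smul_fst, Prod.smul_snd, map_smul, ← smul_sub, norm_smul,
      Real.norm_of_nonneg ht.le] at hr ⊢
    calc δ * (t * ‖r‖) = t * (δ * ‖r‖) := by ring
      _ < _ := by gcongr
  · rw [Set.singleton_subset_iff]
    change δ * ‖r₀‖ < ‖A p₀ - B q₀‖
    rw [hδ, div_mul_eq_mul_div, div_lt_iff₀ (by positivity)]
    nlinarith
  · intro r hr
    have hr' : δ * ‖r‖ < ‖A r.1 - B r.2‖ := hr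
    have h1 := hNK r.1
    have h2 : (δ * ‖r‖) ^ 2 ≤ ‖A r.1 - B r.2‖ ^ 2 := by gcongr
    have h3 := rpow_le_one_add_sq (norm_nonneg r) hθ.inv_nonneg hθ.inv_le_two
    have h4 : ‖r.1‖ ^ (1 / θ) ≤ ‖r‖ ^ (1 / θ) :=
      Real.rpow_le_rpow (norm_nonneg _) (norm_fst_le r) hθ.inv_nonneg
    have h5 := mul_le_mul_of_nonneg_left h2 hc.le
    have h6 := mul_le_mul_of_nonneg_left h3 (by positivity : 0 ≤ c * δ ^ 2)
    have h7 := mul_le_mul_of_nonneg_left h4 (by positivity : 0 ≤ c * δ ^ 2 / 2)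
    calc _ ≤ K * Real.exp (c * δ ^ 2 / 2 * ‖r.1‖ ^ (1 / θ)) *
          Real.exp (-c * ‖A r.1 - B r.2‖ ^ 2) :=
          mul_le_mul_of_nonneg_right h1 (Real.exp_pos _).le
      _ ≤ _ := by
          rw [mul_assoc, mul_assoc, ← Real.exp_add, ← Real.exp_add]
          rw [mul_pow] at h5
          exact mul_le_mul_of_nonneg_left (Real.exp_le_exp.2 (by linarith)) hK

/-- As `p₀ ≠ 0`, `‖(p, q)‖` is at most a multiple of `‖p‖` in a cone around the point, so decay of
`N` in `p` is decay in both variables. -/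
theorem decayAt_kernel_of_decayAt (hθ : Admissible θ) (hN0 : ∀ p, 0 ≤ N p) (hc : 0 < c) {p₀ : E}
    (q₀ : E') (hp : p₀ ≠ 0) (h : DecayAt θ N p₀) :
    DecayAt θ (fun r : E × E' => N r.1 * Real.exp (-c * ‖A r.1 - B r.2‖ ^ 2)) (p₀, q₀) := by
  set r₀ : E × E' := (p₀, q₀)
  have hp0 : 0 < ‖p₀‖ := norm_pos_iff.2 hp
  set R := ‖r₀‖ / ‖p₀‖ + 1 with hR
  have hR0 : 0 < R := by positivity
  obtain ⟨L, hL, hpL, ε, hε, C, hC, hb⟩ := h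
  refine ⟨{r | r.1 ∈ L ∧ ‖r‖ < R * ‖r.1‖}, ⟨?_, ?_⟩, ?_, ε * (R ^ (1 / θ))⁻¹, by positivity,
    C, hC, ?_⟩
  · exact (hL.1.preimage continuous_fst).inter 
      (isOpen_lt (f := fun r : E × E' => ‖r‖) (g := fun r => R * ‖r.1‖) (by fun_prop) (by fun_prop))
  · intro r hr t ht
    refine ⟨hL.2 r.1 hr.1 t ht, ?_⟩
    have := hr.2
    simp only [Prod.smul_fst, norm_smul, Real.norm_of_nonneg ht.le]
    calc t * ‖r‖ < t * (R * ‖r.1‖) := by gcongr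
      _ = _ := by ring
  · rw [Set.singleton_subset_iff]
    refine ⟨Set.singleton_subset_iff.1 hpL, ?_⟩
    change ‖r₀‖ < R * ‖p₀‖
    rw [hR, add_mul, div_mul_cancel₀ _ hp0.ne']
    linarith
  · intro r hr
    have h1 := rpow_norm_le_mul hθ hR0 (norm_nonneg r) (norm_nonneg r.1) hr.2.le
    have h2 : Real.exp (-c * ‖A r.1 - B r.2‖ ^ 2) ≤ 1 := by
      rw [Real.exp_le_one_iff]
      have := sq_nonneg ‖A r.1 - B r.2‖
      nlinarith
    calc _ ≤ N r.1 := mul_le_of_le_one_right (hN0 _) h2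
      _ ≤ _ := hb r.1 hr.1
      _ ≤ _ := by
          have := mul_le_mul_of_nonneg_left h1 hε.le
          exact mul_le_mul_of_nonneg_left (Real.exp_le_exp.2 (by linarith)) hC

/-- As `q₀ ≠ 0`, the last factor decays in both variables near the point, and half of its rate
absorbs the growth of `N`. -/
theorem decayAt_kernel_mul_exp (hθ : Admissible θ) (hN0 : ∀ p, 0 ≤ N p) (hN : Moderate θ N)
    (hc : 0 < c) (p₀ : E) {q₀ : E'} (hq : q₀ ≠ 0) {ε : ℝ} (hε : 0 < ε) :
    DecayAt θ (fun r : E × E' => N r.1 * Real.exp (-c * ‖A r.1 - B r.2‖ ^ 2) *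
      Real.exp (-ε * ‖r.2‖ ^ (1 / θ))) (p₀, q₀) := by
  set r₀ : E × E' := (p₀, q₀)
  have hq0 : 0 < ‖q₀‖ := norm_pos_iff.2 hq
  set R := ‖r₀‖ / ‖q₀‖ + 1 with hR
  have hR0 : 0 < R := by positivity
  set η := ε * (R ^ (1 / θ))⁻¹ / 2 with hη
  have hη0 : 0 < η := by positivity
  obtain ⟨K, hK, hNK⟩ := hN η hη0
  refine ⟨{r | ‖r‖ < R * ‖r.2‖}, ⟨?_, ?_⟩, ?_, η, hη0, K, hK, ?_⟩
  · exact isOpen_lt (by fun_prop) (by fun_prop)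
  · intro r hr t ht
    simp only [Set.mem_ofPred_eq, Prod.smul_snd, norm_smul, Real.norm_of_nonneg ht.le] at hr ⊢
    calc t * ‖r‖ < t * (R * ‖r.2‖) := by gcongr
      _ = _ := by ring
  · rw [Set.singleton_subset_iff]
    change ‖r₀‖ < R * ‖q₀‖
    rw [hR, add_mul, div_mul_cancel₀ _ hq0.ne']
    linarith
  · intro r hr
    have h1 := rpow_norm_le_mul hθ hR0 (norm_nonneg r) (norm_nonneg r.2) (le_of_lt hr)
    have h2 : Real.exp (-c * ‖A r.1 - B r.2‖ ^ 2) ≤ 1 := by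
      rw [Real.exp_le_one_iff]
      have := sq_nonneg ‖A r.1 - B r.2‖
      nlinarith
    have h4 : ‖r.1‖ ^ (1 / θ) ≤ ‖r‖ ^ (1 / θ) :=
      Real.rpow_le_rpow (norm_nonneg _) (norm_fst_le r) hθ.inv_nonneg
    calc _ ≤ N r.1 * Real.exp (-ε * ‖r.2‖ ^ (1 / θ)) :=
          mul_le_mul_of_nonneg_right (mul_le_of_le_one_right (hN0 _) h2) (Real.exp_pos _).le
      _ ≤ K * Real.exp (η * ‖r.1‖ ^ (1 / θ)) * Real.exp (-ε * ‖r.2‖ ^ (1 / θ)) :=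
          mul_le_mul_of_nonneg_right (hNK r.1) (Real.exp_pos _).le
      _ ≤ _ := by
          rw [mul_assoc, ← Real.exp_add]
          refine mul_le_mul_of_nonneg_left (Real.exp_le_exp.2 ?_) hK
          have h5 := mul_le_mul_of_nonneg_left h1 hε.le
          have h6 := mul_le_mul_of_nonneg_left h4 hη0.le
          have h7 : ε * ((R ^ (1 / θ))⁻¹ * ‖r‖ ^ (1 / θ)) = 2 * η * ‖r‖ ^ (1 / θ) := by
            rw [hη]
            ring
          linarith

theorem decayAt_mul_exp_of_decayAt {f : E × E' → ℝ} (hf : ∀ r, 0 ≤ f r) {ε : ℝ} (hε : 0 ≤ ε)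
    {r₀ : E × E'} (h : DecayAt θ f r₀) :
    DecayAt θ (fun r => f r * Real.exp (-ε * ‖r.2‖ ^ (1 / θ))) r₀ := by
  refine h.mono fun r => mul_le_of_le_one_right (hf r) ?_
  rw [Real.exp_le_one_iff]
  have : 0 ≤ ‖r.2‖ ^ (1 / θ) := by positivity
  nlinarith

variable [FiniteDimensional ℝ E] [FiniteDimensional ℝ E']

/-- A bound for a Gaussian kernel applied to a moderate function that decays along `ker A`. -/
theorem kernel_le_exp (hθ : Admissible θ) (hN0 : ∀ p, 0 ≤ N p) (hN : Moderate θ N) (hc : 0 < c)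
    (hker : ∀ p, p ≠ 0 → A p = 0 → DecayAt θ N p) {ε : ℝ} (hε : 0 < ε) :
    ∃ ε' > 0, ∃ K ≥ 0, ∀ p q, N p * Real.exp (-c * ‖A p - B q‖ ^ 2) ≤
      K * Real.exp (-ε' * ‖p‖ ^ (1 / θ)) * Real.exp (ε * ‖q‖ ^ (1 / θ)) := by
  set f : E × E' → ℝ := fun r => N r.1 * Real.exp (-c * ‖A r.1 - B r.2‖ ^ 2) with hf
  have hf0 : ∀ r, 0 ≤ f r := fun r => mul_nonneg (hN0 _) (Real.exp_pos _).le
  set g : E × E' → ℝ := fun r => f r * Real.exp (-ε * ‖r.2‖ ^ (1 / θ)) with hg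
  -- Three kinds of directions: for `q ≠ 0` the extra factor decays; for `q = 0`, `A p ≠ 0` the
  -- Gaussian does; for `q = 0`, `A p = 0` the hypothesis on `ker A` enters.
  have hD : DecayOn θ g (Metric.sphere 0 1) := by
    refine decayOn_of_isCompact (isCompact_sphere _ _) fun r hr => ?_
    obtain ⟨p, q⟩ := r
    by_cases hq : q = 0
    · subst hq
      by_cases hp : A p = 0
      · have hp0 : p ≠ 0 := by
          rintro rfl
          simp at hr
        exact decayAt_mul_exp_of_decayAt hf0 hε.le
          (decayAt_kernel_of_decayAt A B hθ hN0 hc 0 hp0 (hker p hp0 hp))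
      · exact decayAt_mul_exp_of_decayAt hf0 hε.le
          (decayAt_kernel_of_ne A B hθ hN hc (by simpa using hp))
    · exact decayAt_kernel_mul_exp A B hθ hN0 hN hc p hq hε
  obtain ⟨L, hL, hSL, ε', hε', C, hC, hb⟩ := hD
  -- The origin is not a multiple of a unit vector, so its value is built into the constant.
  refine ⟨ε', hε', max C (g 0), by positivity, fun p q => ?_⟩
  have key : g (p, q) ≤ max C (g 0) * Real.exp (-ε' * ‖(p, q)‖ ^ (1 / θ)) := by
    by_cases h0 : (p, q) = 0
    · rw [h0, norm_zero, Real.zero_rpow (one_div_ne_zero hθ.pos.ne'), mul_zero, Real.exp_zero,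
        mul_one]
      exact le_max_right _ _
    · have hn : 0 < ‖(p, q)‖ := norm_pos_iff.2 h0
      have hm : (‖(p, q)‖⁻¹ • (p, q)) ∈ L := hSL (by
        rw [mem_sphere_zero_iff_norm, norm_smul, norm_inv, norm_norm, inv_mul_cancel₀ hn.ne'])
      have hm' := hL.2 _ hm ‖(p, q)‖ hn
      rw [smul_smul, mul_inv_cancel₀ hn.ne', one_smul] at hm'
      refine (hb _ hm').trans ?_
      gcongr
      exact le_max_left _ _
  have h4 : ‖p‖ ^ (1 / θ) ≤ ‖(p, q)‖ ^ (1 / θ) :=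
    Real.rpow_le_rpow (norm_nonneg _) (norm_fst_le (p, q)) hθ.inv_nonneg
  have hx := Real.exp_pos (ε * ‖q‖ ^ (1 / θ))
  have hgq : g (p, q) = f (p, q) / Real.exp (ε * ‖q‖ ^ (1 / θ)) := by
    change f (p, q) * Real.exp (-ε * ‖q‖ ^ (1 / θ)) = _
    rw [neg_mul, Real.exp_neg]
    rfl
  rw [hgq, div_le_iff₀ hx] at key
  refine key.trans ?_
  have hm0 : 0 ≤ max C (g 0) := le_max_of_le_left hC
  gcongr ?_ * _
  gcongr _ * ?_
  exact Real.exp_le_exp.2 (by nlinarith)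

/-- The set of second components whose whole fibre lies in an open cone. -/
theorem exists_openCone_fibre {U : Set (E × E')} (hU : IsOpenCone U) {q₀ : E'}
    (h : ∀ (p : E) (t : ℝ), 0 ≤ t → (p, t • q₀) ≠ 0 → (p, t • q₀) ∈ U) (hq₀ : q₀ ≠ 0) :
    ∃ L : Set E', IsOpenCone L ∧ q₀ ∈ L ∧ ∀ q ∈ L, ∀ p, (p, q) ∈ U := by
  -- The directions `(p, 0)` are the points at infinity of the fibre: the case `t = 0` of the
  -- hypothesis controls large `p`, uniformly by the tube lemma.
  have hT : ∃ δ > 0, ∀ p ∈ Metric.sphere (0 : E) 1, ∀ q : E', ‖q‖ < δ → (p, q) ∈ U := by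
    have h1 : Metric.sphere (0 : E) 1 ×ˢ ({0} : Set E') ⊆ U := by
      rintro ⟨p, q⟩ ⟨hp, hq⟩
      obtain rfl : q = 0 := hq
      have := h p 0 le_rfl
      rw [zero_smul] at this
      refine this fun h0 => ?_
      rw [Prod.mk_eq_zero] at h0
      rw [h0.1] at hp
      simp at hp
    obtain ⟨u, v, -, hv, hu', hv', huv⟩ := generalized_tube_lemma (isCompact_sphere (0 : E) 1)
      isCompact_singleton hU.1 h1
    obtain ⟨δ, hδ, hb⟩ := Metric.isOpen_iff.1 hv 0 (hv' rfl)
    exact ⟨δ, hδ, fun p hp q hq => huv ⟨hu' hp, hb (by simpa using hq)⟩⟩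
  obtain ⟨δ, hδ, hT⟩ := hT
  -- For `‖p‖ > R` division by `‖p‖` brings `q` below `δ`; for `‖p‖ ≤ R` a second tube lemma
  -- applies.
  set R := (‖q₀‖ + 1) / δ with hR
  have hR0 : 0 < R := by positivity
  have hnear : ∃ ρ > 0, ∀ p ∈ Metric.closedBall (0 : E) R, ∀ q ∈ Metric.ball q₀ ρ, (p, q) ∈ U := by
    have h1 : Metric.closedBall (0 : E) R ×ˢ ({q₀} : Set E') ⊆ U := by
      rintro ⟨p, q⟩ ⟨-, hq⟩
      obtain rfl : q = q₀ := hq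
      have := h p 1 zero_le_one
      rw [one_smul] at this
      exact this fun h0 => hq₀ (Prod.mk_eq_zero.1 h0).2
    obtain ⟨u, v, -, hv, hu', hv', huv⟩ := generalized_tube_lemma (isCompact_closedBall (0 : E) R)
      isCompact_singleton hU.1 h1
    obtain ⟨ρ, hρ, hb⟩ := Metric.isOpen_iff.1 hv q₀ (hv' rfl)
    exact ⟨ρ, hρ, fun p hp q hq => huv ⟨hu' hp, hb hq⟩⟩
  obtain ⟨ρ, hρ, hnear⟩ := hnear
  have hfib : ∀ q ∈ Metric.ball q₀ (min ρ 1), ∀ p, (p, q) ∈ U := by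
    intro q hq p
    rw [Metric.mem_ball, lt_min_iff] at hq
    by_cases hp : ‖p‖ ≤ R
    · exact hnear p (by simpa using hp) q hq.1
    · push Not at hp
      have hp0 : 0 < ‖p‖ := hR0.trans hp
      have h1 : (‖p‖⁻¹ • p, ‖p‖⁻¹ • q) ∈ U := by
        refine hT _ (by rw [mem_sphere_zero_iff_norm, norm_smul, norm_inv, norm_norm,
          inv_mul_cancel₀ hp0.ne']) _ ?_
        rw [norm_smul, norm_inv, norm_norm, inv_mul_lt_iff₀ hp0]
        have h2 : ‖q‖ ≤ ‖q₀‖ + dist q q₀ := by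
          rw [dist_eq_norm]
          calc ‖q‖ = ‖q₀ + (q - q₀)‖ := by simp
            _ ≤ _ := norm_add_le _ _
        calc ‖q‖ < ‖q₀‖ + 1 := by linarith [hq.2]
          _ = R * δ := by rw [hR]; field_simp
          _ ≤ ‖p‖ * δ := by gcongr
      have h3 := hU.2 _ h1 ‖p‖ hp0
      simpa [smul_smul, mul_inv_cancel₀ hp0.ne'] using h3
  refine ⟨{q | ∃ t : ℝ, 0 < t ∧ t • q ∈ Metric.ball q₀ (min ρ 1)}, ⟨?_, ?_⟩, ?_, ?_⟩
  · have : {q | ∃ t : ℝ, 0 < t ∧ t • q ∈ Metric.ball q₀ (min ρ 1)} =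
        ⋃ t ∈ Set.Ioi (0 : ℝ), (fun q => t • q) ⁻¹' Metric.ball q₀ (min ρ 1) := by
      ext q
      simp only [Set.mem_iUnion₂, Set.mem_Ioi, exists_prop]
      rfl
    rw [this]
    exact isOpen_biUnion fun t _ => Metric.isOpen_ball.preimage (continuous_const_smul t)
  · rintro q ⟨t, ht, hq⟩ a ha
    refine ⟨t / a, by positivity, ?_⟩
    rwa [smul_smul, div_mul_cancel₀ _ ha.ne']
  · exact ⟨1, one_pos, by rw [one_smul]; exact Metric.mem_ball_self (by positivity)⟩
  · rintro q ⟨t, ht, hq⟩ p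
    have h1 := hU.2 _ (hfib _ hq (t • p)) t⁻¹ (by positivity)
    simpa [smul_smul, inv_mul_cancel₀ ht.ne'] using h1

/-- A bound for a Gaussian kernel in a cone. -/
theorem kernel_le_exp_cone (hθ : Admissible θ) (hN0 : ∀ p, 0 ≤ N p) (hN : Moderate θ N)
    (hc : 0 < c) (hker : ∀ p, p ≠ 0 → A p = 0 → DecayAt θ N p) {q₀ : E'} (hq₀ : B q₀ ≠ 0)
    (hfib : ∀ p, A p = B q₀ → DecayAt θ N p) :
    ∃ L : Set E', IsOpenCone L ∧ q₀ ∈ L ∧ ∃ ε > 0, ∃ K ≥ 0, ∀ q ∈ L, ∀ p,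
      N p * Real.exp (-c * ‖A p - B q‖ ^ 2) ≤
        K * Real.exp (-ε * ‖p‖ ^ (1 / θ)) * Real.exp (-ε * ‖q‖ ^ (1 / θ)) := by
  have hq0 : q₀ ≠ 0 := by
    rintro rfl
    simp at hq₀
  -- Unit directions over the closed ray through `q₀`. The value `t = 0` is included because the
  -- fibre over `q₀` approaches the directions `(p, 0)`.
  set S : Set (E × E') := Metric.sphere 0 1 ∩ {r | ∃ t : ℝ, 0 ≤ t ∧ r.2 = t • q₀} with hS
  have hcl : IsClosed {r : E × E' | ∃ t : ℝ, 0 ≤ t ∧ r.2 = t • q₀} := by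
    have h1 : IsClosed ((fun t : ℝ => t • q₀) '' Set.Ici 0) := by
      have he : Topology.IsClosedEmbedding fun t : ℝ => t • q₀ :=
        isClosedEmbedding_smul_left hq0
      exact he.isClosedMap _ isClosed_Ici
    have h2 : {r : E × E' | ∃ t : ℝ, 0 ≤ t ∧ r.2 = t • q₀} =
        Prod.snd ⁻¹' ((fun t : ℝ => t • q₀) '' Set.Ici 0) := by
      ext r
      simp [eq_comm]
    rw [h2]
    exact h1.preimage continuous_snd
  have hcpt : IsCompact S := (isCompact_sphere _ _).inter_right hcl
  obtain ⟨U, hU, hSU, ε, hε, C, hC, hb⟩ := decayOn_of_isCompact (θ := θ)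
    (N := fun r : E × E' => N r.1 * Real.exp (-c * ‖A r.1 - B r.2‖ ^ 2)) hcpt (by
      rintro ⟨p, q⟩ ⟨hr, t, ht, hq⟩
      simp only at hq
      subst hq
      -- On this set, `t > 0` reduces to the fibre over `q₀` by rescaling and `t = 0` is the kernel
      -- case; off it the Gaussian decays.
      by_cases hAB : A p = B (t • q₀)
      · have hp0 : p ≠ 0 := by
          rintro rfl
          rw [map_zero, map_smul, eq_comm, smul_eq_zero] at hAB
          rcases hAB with h | h
          · rw [h] at hr
            simp at hr
          · exact hq₀ h
        refine decayAt_kernel_of_decayAt A B hθ hN0 hc _ hp0 ?_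
        rcases ht.eq_or_lt with h0 | hpos
        · rw [← h0, zero_smul, map_zero] at hAB
          exact hker p hp0 hAB
        · have h1 : A (t⁻¹ • p) = B q₀ := by
            rw [map_smul, hAB, map_smul, smul_smul, inv_mul_cancel₀ hpos.ne', one_smul]
          have h2 := (hfib _ h1).smul hpos
          rwa [smul_smul, mul_inv_cancel₀ hpos.ne', one_smul] at h2
      · exact decayAt_kernel_of_ne A B hθ hN hc hAB)
  obtain ⟨L, hL, hqL, hLU⟩ := exists_openCone_fibre hU (q₀ := q₀) (fun p t ht h0 => by
    have hn : 0 < ‖(p, t • q₀)‖ := norm_pos_iff.2 h0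
    have hm : (‖(p, t • q₀)‖⁻¹ • (p, t • q₀)) ∈ U := by
      refine hSU ⟨?_, ‖(p, t • q₀)‖⁻¹ * t, by positivity, ?_⟩
      · rw [mem_sphere_zero_iff_norm, norm_smul, norm_inv, norm_norm, inv_mul_cancel₀ hn.ne']
      · simp [smul_smul]
    have hm' := hU.2 _ hm ‖(p, t • q₀)‖ hn
    rwa [smul_smul, mul_inv_cancel₀ hn.ne', one_smul] at hm') hq0
  -- Half of the decay in `‖(p, q)‖` goes to each variable.
  refine ⟨L, hL, hqL, ε / 2, by positivity, C, hC, fun q hq p => ?_⟩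
  refine (hb _ (hLU q hq p)).trans ?_
  rw [mul_assoc, ← Real.exp_add]
  have h1 : ‖p‖ ^ (1 / θ) ≤ ‖(p, q)‖ ^ (1 / θ) :=
    Real.rpow_le_rpow (norm_nonneg _) (norm_fst_le (p, q)) hθ.inv_nonneg
  have h2 : ‖q‖ ^ (1 / θ) ≤ ‖(p, q)‖ ^ (1 / θ) :=
    Real.rpow_le_rpow (norm_nonneg _) (norm_snd_le (p, q)) hθ.inv_nonneg
  gcongr
  nlinarith

/-! ### Gaussian integral operators -/

variable [MeasurableSpace E] [BorelSpace E] (μ : Measure E) [μ.IsAddHaarMeasure]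

theorem integrable_kernel (hθ : Admissible θ) (hN0 : ∀ p, 0 ≤ N p) (hN : Moderate θ N)
    (hm : Measurable N) (hc : 0 < c) (hker : ∀ p, p ≠ 0 → A p = 0 → DecayAt θ N p) (q : E') :
    Integrable (fun p => N p * Real.exp (-c * ‖A p - B q‖ ^ 2)) μ := by
  obtain ⟨ε, hε, K, hK, h⟩ := kernel_le_exp A B hθ hN0 hN hc hker one_pos
  refine integrable_of_norm_le_exp (K := K * Real.exp (1 * ‖q‖ ^ (1 / θ))) hθ hε ?_ fun p => ?_
  · refine (hm.mul ?_).aestronglyMeasurable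
    exact (by fun_prop : Continuous fun p => Real.exp (-c * ‖A p - B q‖ ^ 2)).measurable
  · rw [Real.norm_of_nonneg (mul_nonneg (hN0 _) (Real.exp_pos _).le)]
    exact (h p q).trans (le_of_eq (by ring))

theorem moderate_integral_kernel (hθ : Admissible θ) (hN0 : ∀ p, 0 ≤ N p) (hN : Moderate θ N)
    (hm : Measurable N) (hc : 0 < c) (hker : ∀ p, p ≠ 0 → A p = 0 → DecayAt θ N p) :
    Moderate θ fun q => ∫ p, N p * Real.exp (-c * ‖A p - B q‖ ^ 2) ∂μ := by
  intro ε hε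
  obtain ⟨ε', hε', K, hK, h⟩ := kernel_le_exp A B hθ hN0 hN hc hker hε
  have hi := integrable_exp_neg_mul_norm_rpow μ hθ hε'
  refine ⟨K * ∫ p, Real.exp (-ε' * ‖p‖ ^ (1 / θ)) ∂μ,
    mul_nonneg hK (integral_nonneg fun p => by positivity), fun q => ?_⟩
  calc _ ≤ ∫ p, K * Real.exp (-ε' * ‖p‖ ^ (1 / θ)) * Real.exp (ε * ‖q‖ ^ (1 / θ)) ∂μ :=
        integral_mono (integrable_kernel A B μ hθ hN0 hN hm hc hker q)
          ((hi.const_mul _).mul_const _) fun p => h p q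
    _ = _ := by rw [integral_mul_const, integral_const_mul]

/-- In `kernel_le_exp_cone` the factor in `p` is integrable and the factor in `q` is the decay
claimed. -/
theorem decayAt_integral_kernel (hθ : Admissible θ) (hN0 : ∀ p, 0 ≤ N p) (hN : Moderate θ N)
    (hm : Measurable N) (hc : 0 < c) (hker : ∀ p, p ≠ 0 → A p = 0 → DecayAt θ N p) {q₀ : E'}
    (hq₀ : B q₀ ≠ 0) (hfib : ∀ p, A p = B q₀ → DecayAt θ N p) :
    DecayAt θ (fun q => ∫ p, N p * Real.exp (-c * ‖A p - B q‖ ^ 2) ∂μ) q₀ := by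
  obtain ⟨L, hL, hqL, ε', hε', K, hK, h⟩ :=
    kernel_le_exp_cone A B hθ hN0 hN hc hker hq₀ hfib
  have hi := integrable_exp_neg_mul_norm_rpow μ hθ hε'
  refine ⟨L, hL, Set.singleton_subset_iff.2 hqL, ε', hε', K * ∫ p, Real.exp (-ε' * ‖p‖ ^ (1 / θ)) ∂μ,
    mul_nonneg hK (integral_nonneg fun p => by positivity), fun q hq => ?_⟩
  calc _ ≤ ∫ p, K * Real.exp (-ε' * ‖p‖ ^ (1 / θ)) * Real.exp (-ε' * ‖q‖ ^ (1 / θ)) ∂μ :=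
        integral_mono (integrable_kernel A B μ hθ hN0 hN hm hc hker q)
          ((hi.const_mul _).mul_const _) fun p => h q hq p
    _ = _ := by rw [integral_mul_const, integral_const_mul]

end Decay

/-! ### Ultradistributions with given Gabor coefficients -/

/-- Measurable functions on phase space of subexponential growth. -/
structure IsModel (θ : ℝ) (W : Phase ι → ℂ) : Prop where
  measurable : Measurable W
  moderate : Moderate θ fun p => ‖W p‖

theorem isModel_stft {θ : ℝ} (hθ : Admissible θ) (u : GSDual θ ι) : IsModel θ (stft u) :=
  ⟨measurable_stft hθ u, moderate_stft hθ u⟩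

theorem exp_mul_exp_half (ε r : ℝ) :
    Real.exp (-ε * r) * Real.exp (ε / 2 * r) = Real.exp (-(ε / 2) * r) := by
  rw [← Real.exp_add]
  ring_nf

theorem IsModel.norm_mul_le {θ : ℝ} {W : Phase ι → ℂ} (hW : IsModel θ W) {ε : ℝ} (hε : 0 < ε) :
    ∃ K ≥ 0, ∀ (a : ℝ) (c : ℂ) (p : Phase ι), ‖c‖ ≤ a * Real.exp (-ε * ‖p‖ ^ (1 / θ)) →
      ‖c * W p‖ ≤ a * K * Real.exp (-(ε / 2) * ‖p‖ ^ (1 / θ)) := by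
  obtain ⟨K, hK, h⟩ := hW.moderate (ε / 2) (by positivity)
  refine ⟨K, hK, fun a c p hc => ?_⟩
  rw [norm_mul, ← exp_mul_exp_half]
  refine (mul_le_mul hc (h p) (norm_nonneg _) ((norm_nonneg _).trans hc)).trans (le_of_eq ?_)
  ring

theorem IsModel.integrable_mul {θ : ℝ} (hθ : Admissible θ) {W : Phase ι → ℂ} (hW : IsModel θ W)
    {G : Phase ι → ℂ} (hG : Measurable G) {ε K : ℝ} (hε : 0 < ε)
    (h : ∀ p, ‖G p‖ ≤ K * Real.exp (-ε * ‖p‖ ^ (1 / θ))) :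
    Integrable fun p => G p * W p := by
  obtain ⟨K', -, hb⟩ := hW.norm_mul_le hε
  exact integrable_of_norm_le_exp hθ (by positivity : 0 < ε / 2)
    (hG.mul hW.measurable).aestronglyMeasurable fun p => hb _ _ p (h p)

theorem continuous_of_mem {θ : ℝ} {f : Conf ι → ℂ} (hf : f ∈ GS θ ι) : Continuous f :=
  hf.1.continuous

theorem IsModel.integrable_coeff_mul {θ : ℝ} (hθ : Admissible θ) {W : Phase ι → ℂ}
    (hW : IsModel θ W) {f : Conf ι → ℂ} (hf : f ∈ GS θ ι) :
    Integrable fun p => coeff f p * W p := by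
  obtain ⟨ε, hε, K, -, h⟩ := exists_norm_coeff_le hθ hf
  exact hW.integrable_mul hθ (measurable_coeff (continuous_of_mem hf)) hε h

/-- The ultradistribution `f ↦ c ∫ ⟨f, conj g_p⟩ W(p) dp`. -/
def ofModel {θ : ℝ} (hθ : Admissible θ) {W : Phase ι → ℂ} (hW : IsModel θ W) : GSDual θ ι :=
  ⟨{ toFun := fun f => (synthConst ι : ℂ) * ∫ p, coeff (f : Conf ι → ℂ) p * W p
     map_add' := fun f g => by
      rw [← mul_add, ← integral_add (hW.integrable_coeff_mul hθ f.2)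
        (hW.integrable_coeff_mul hθ g.2)]
      simp only [Submodule.coe_add, coeff_add hθ f.2 g.2, Pi.add_apply, add_mul]
     map_smul' := fun c f => by
      simp only [Submodule.coe_smul, coeff_smul, Pi.smul_apply, smul_eq_mul, RingHom.id_apply,
        mul_assoc, integral_const_mul]
      ring }, by
    intro C hC
    obtain ⟨ε, hε, K, hK, h⟩ := norm_coeff_le (ι := ι) hθ hC
    obtain ⟨K', hK', hb⟩ := hW.norm_mul_le hε
    have hi := integrable_exp_neg_mul_norm_rpow (volume : Measure (Phase ι)) hθ
      (by positivity : 0 < ε / 2)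
    refine ⟨synthConst ι * (K * K' * ∫ p : Phase ι, Real.exp (-(ε / 2) * ‖p‖ ^ (1 / θ))),
      fun f M hf => ?_⟩
    change ‖(synthConst ι : ℂ) * ∫ p, coeff (f : Conf ι → ℂ) p * W p‖ ≤ _
    rw [norm_mul, Complex.norm_real, Real.norm_of_nonneg synthConst_pos.le, mul_assoc]
    refine mul_le_mul_of_nonneg_left ?_ synthConst_pos.le
    calc _ ≤ ∫ p : Phase ι, K * M * K' * Real.exp (-(ε / 2) * ‖p‖ ^ (1 / θ)) :=
          norm_integral_le_of_norm_le (hi.const_mul _)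
            (Filter.Eventually.of_forall fun p => hb _ _ p (h f M f.2.1 hf p))
      _ = _ := by
          rw [integral_const_mul]
          ring⟩

theorem ofModel_apply {θ : ℝ} (hθ : Admissible θ) {W : Phase ι → ℂ} (hW : IsModel θ W)
    (f : GS θ ι) :
    (ofModel hθ hW).1 f = (synthConst ι : ℂ) * ∫ p, coeff (f : Conf ι → ℂ) p * W p := rfl

theorem ofModel_stft {θ : ℝ} (hθ : Admissible θ) (u : GSDual θ ι) :
    ofModel hθ (isModel_stft hθ u) = u :=
  Subtype.ext (LinearMap.ext fun f => (apply_eq_integral hθ u f).symm)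

theorem ext_of_stft {θ : ℝ} (hθ : Admissible θ) {u v : GSDual θ ι}
    (h : ∀ p, stft u p = stft v p) : u = v := by
  refine Subtype.ext (LinearMap.ext fun f => ?_)
  rw [apply_eq_integral hθ u f, apply_eq_integral hθ v f]
  simp only [h]

theorem stft_sub {θ : ℝ} (hθ : Admissible θ) (u v : GSDual θ ι) (p : Phase ι) :
    stft (u - v) p = stft u p - stft v p := by
  rw [stft_eq hθ, stft_eq hθ, stft_eq hθ]
  rfl

theorem stft_smul {θ : ℝ} (hθ : Admissible θ) (c : ℂ) (u : GSDual θ ι) (p : Phase ι) :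
    stft (c • u) p = c * stft u p := by
  rw [stft_eq hθ, stft_eq hθ]
  rfl

theorem IsModel.sub {θ : ℝ} {W V : Phase ι → ℂ} (hW : IsModel θ W)
    (hV : IsModel θ V) : IsModel θ fun p => W p - V p := by
  refine ⟨hW.measurable.sub hV.measurable, fun ε hε => ?_⟩
  obtain ⟨K, hK, h⟩ := hW.moderate ε hε
  obtain ⟨K', hK', h'⟩ := hV.moderate ε hε
  refine ⟨K + K', by positivity, fun p => ?_⟩
  rw [add_mul]
  exact (norm_sub_le _ _).trans (add_le_add (h p) (h' p))

theorem ofModel_sub {θ : ℝ} (hθ : Admissible θ) {W V : Phase ι → ℂ} (hW : IsModel θ W)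
    (hV : IsModel θ V) : ofModel hθ hW - ofModel hθ hV = ofModel hθ (hW.sub hV) := by
  refine Subtype.ext (LinearMap.ext fun f => ?_)
  change (ofModel hθ hW).1 f - (ofModel hθ hV).1 f = (ofModel hθ (hW.sub hV)).1 f
  rw [ofModel_apply, ofModel_apply, ofModel_apply, ← mul_sub,
    ← integral_sub (hW.integrable_coeff_mul hθ f.2) (hV.integrable_coeff_mul hθ f.2)]
  simp only [mul_sub]

theorem integrable_mul_gaussian {θ : ℝ} (hθ : Admissible θ) {R : Phase ι → ℝ}
    (hm : Measurable R) (hR0 : ∀ p, 0 ≤ R p) (hR : Moderate θ R) (q : Phase ι) :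
    Integrable fun p => R p * Real.exp (-(1 / 4) * ‖p - q‖ ^ 2) :=
  integrable_kernel (ContinuousLinearMap.id ℝ (Phase ι)) (ContinuousLinearMap.id ℝ (Phase ι))
    volume hθ hR0 hR hm (by norm_num) (fun p hp h => (hp h).elim) q

theorem decayAt_integral_mul_gaussian {θ : ℝ} (hθ : Admissible θ) {R : Phase ι → ℝ}
    (hm : Measurable R) (hR0 : ∀ p, 0 ≤ R p) (hR : Moderate θ R) {q₀ : Phase ι} (hq : q₀ ≠ 0)
    (h : DecayAt θ R q₀) :
    DecayAt θ (fun q => ∫ p, R p * Real.exp (-(1 / 4) * ‖p - q‖ ^ 2)) q₀ :=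
  decayAt_integral_kernel (ContinuousLinearMap.id ℝ (Phase ι))
    (ContinuousLinearMap.id ℝ (Phase ι)) volume hθ hR0 hR hm (by norm_num)
    (fun p hp h => (hp h).elim) hq fun p hp => by
      obtain rfl : p = q₀ := hp
      exact h

/-- The transform integrates `W` against the coefficients of an atom, which are bounded by a
Gaussian of `p - q`. A separate majorant `R` lets one bound serve a whole sequence. -/
theorem norm_stft_ofModel_le {θ : ℝ} (hθ : Admissible θ) {W : Phase ι → ℂ} (hW : IsModel θ W)
    {R : Phase ι → ℝ} (hm : Measurable R) (hR : Moderate θ R) (h : ∀ p, ‖W p‖ ≤ R p)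
    (q : Phase ι) :
    ‖stft (ofModel hθ hW) q‖ ≤ synthConst ι * Real.pi ^ ((Fintype.card ι : ℝ) / 2) *
      ∫ p, R p * Real.exp (-(1 / 4) * ‖p - q‖ ^ 2) := by
  have hR0 : ∀ p, 0 ≤ R p := fun p => (norm_nonneg _).trans (h p)
  rw [stft_eq hθ, ofModel_apply, norm_mul, Complex.norm_real,
    Real.norm_of_nonneg synthConst_pos.le, mul_assoc]
  refine mul_le_mul_of_nonneg_left ?_ synthConst_pos.le
  rw [← integral_const_mul]
  refine norm_integral_le_of_norm_le ((integrable_mul_gaussian hθ hm hR0 hR q).const_mul _)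
    (Filter.Eventually.of_forall fun p => ?_)
  rw [norm_mul]
  calc _ ≤ Real.pi ^ ((Fintype.card ι : ℝ) / 2) * Real.exp (-(1 / 4) * ‖p - q‖ ^ 2) * R p :=
        mul_le_mul (norm_coeff_gaborAtom_le q p) (h p) (norm_nonneg _) (by positivity)
    _ = _ := by ring

theorem decayAt_stft_ofModel {θ : ℝ} (hθ : Admissible θ) {W : Phase ι → ℂ} (hW : IsModel θ W)
    {q : Phase ι} (hq : q ≠ 0) (h : DecayAt θ (fun p => ‖W p‖) q) :
    DecayAt θ (fun p => ‖stft (ofModel hθ hW) p‖) q := by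
  refine ((decayAt_integral_mul_gaussian hθ hW.measurable.norm (fun p => norm_nonneg _)
    hW.moderate hq h).const_mul ?_).mono
      (norm_stft_ofModel_le hθ hW hW.measurable.norm hW.moderate fun p => le_rfl)
  have := synthConst_pos (ι := ι)
  positivity

/-! ### Uniform boundedness -/

/-- The functional `a ↦ ∫ a(p) b(p) dp` on `L¹`, for bounded measurable `b`. -/
theorem exists_clm_integral_mul {α : Type*} [MeasurableSpace α] {μ : Measure α} {b : α → ℂ}
    (hb : Measurable b) {K : ℝ} (hK : ∀ p, ‖b p‖ ≤ K) :
    ∃ T : Lp ℂ 1 μ →L[ℂ] ℂ, ∀ a : Lp ℂ 1 μ, T a = ∫ p, a p * b p ∂μ := by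
  have hi : ∀ a : Lp ℂ 1 μ, Integrable (fun p => a p * b p) μ := fun a =>
    (L1.integrable_coeFn a).mul_bdd (c := K) hb.aestronglyMeasurable
      (Filter.Eventually.of_forall hK)
  refine ⟨LinearMap.mkContinuous
    { toFun := fun a => ∫ p, a p * b p ∂μ
      map_add' := fun a a' => ?_
      map_smul' := fun c a => ?_ } K fun a => ?_, fun a => rfl⟩
  · rw [← integral_add (hi a) (hi a')]
    refine integral_congr_ae ?_
    filter_upwards [Lp.coeFn_add a a'] with p hp
    rw [hp, Pi.add_apply, add_mul]
  · rw [RingHom.id_apply, ← integral_smul]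
    refine integral_congr_ae ?_
    filter_upwards [Lp.coeFn_smul c a] with p hp
    rw [hp, Pi.smul_apply, smul_eq_mul, smul_eq_mul, mul_assoc]
  · change ‖∫ p, a p * b p ∂μ‖ ≤ K * ‖a‖
    rw [L1.norm_eq_integral_norm, ← integral_const_mul]
    refine norm_integral_le_of_norm_le ((L1.integrable_coeFn a).norm.const_mul K)
      (Filter.Eventually.of_forall fun p => ?_)
    rw [norm_mul, mul_comm]
    exact mul_le_mul_of_nonneg_right (hK p) (norm_nonneg _)

/-- Weighted synthesis `a ↦ synth (a w)` maps the Banach space `L¹` into `S_θ`. Composed with it,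
the functionals are continuous and pointwise bounded on `L¹`, so Banach–Steinhaus bounds their norms
uniformly. -/
theorem exists_moderate_bound {θ : ℝ} (hθ : Admissible θ) {J : Type*} (vn : J → GSDual θ ι)
    (h : ∀ f : GS θ ι, ∃ C, ∀ n, ‖(vn n).1 f‖ ≤ C) {ε : ℝ} (hε : 0 < ε) :
    ∃ K ≥ 0, ∀ n p, ‖stft (vn n) p‖ ≤ K * Real.exp (ε * ‖p‖ ^ (1 / θ)) := by
  set η := min (ε / 8) (1 / 32) with hη
  have hη0 : 0 < η := by positivity
  have hη1 : η ≤ ε / 8 := min_le_left _ _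
  have hη2 : η ≤ 1 / 32 := min_le_right _ _
  set w : Phase ι → ℂ := fun p => ((Real.exp (-η * ‖p‖ ^ (1 / θ)) : ℝ) : ℂ) with hw
  have hwm : Measurable w :=
    (Complex.continuous_ofReal.comp (continuous_exp_mul_norm_rpow hθ (-η))).measurable
  have hwn : ∀ p, ‖w p‖ = Real.exp (-η * ‖p‖ ^ (1 / θ)) := fun p => by
    rw [hw, Complex.norm_real, Real.norm_of_nonneg (Real.exp_pos _).le]
  have hT : ∀ n, ∃ T : Lp ℂ 1 (volume : Measure (Phase ι)) →L[ℂ] ℂ,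
      ∀ a, T a = ∫ p, a p * (w p * stft (vn n) p) := fun n => by
    obtain ⟨K, hK, hb⟩ := moderate_stft hθ (vn n) η hη0
    refine exists_clm_integral_mul (hwm.mul (measurable_stft hθ _)) (K := K) fun p => ?_
    rw [norm_mul, hwn]
    refine (mul_le_mul_of_nonneg_left (hb p) (Real.exp_pos _).le).trans (le_of_eq ?_)
    rw [mul_left_comm, ← Real.exp_add, neg_mul, neg_add_cancel, Real.exp_zero, mul_one]
  choose T hT using hT
  obtain ⟨C, hC⟩ := banach_steinhaus (g := T) fun a => by
    have ha := L1.integrable_coeFn a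
    have hm : AEStronglyMeasurable (fun p => a p * w p) volume :=
      ha.aestronglyMeasurable.mul hwm.aestronglyMeasurable
    have hG : Integrable fun p => ‖a p * w p‖ * Real.exp (η * ‖p‖ ^ (1 / θ)) := by
      refine ha.norm.congr (Filter.Eventually.of_forall fun p => ?_)
      simp only []
      rw [norm_mul, hwn, mul_assoc, ← Real.exp_add, neg_mul, neg_add_cancel, Real.exp_zero,
        mul_one]
    obtain ⟨C, hC⟩ := h ⟨synth _, synth_mem hθ hη0 hm hG⟩
    refine ⟨C, fun n => ?_⟩
    have h1 := hC n
    rw [apply_synth hθ hη0 (vn n) hm hG] at h1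
    rw [hT]
    simpa only [mul_assoc] using h1
  have hi := integrable_exp_neg_mul_norm_rpow (volume : Measure (Phase ι)) hθ hη0
  set I := ∫ p : Phase ι, Real.exp (-η * ‖p‖ ^ (1 / θ)) with hI
  have hI0 : 0 ≤ I := integral_nonneg fun p => (Real.exp_pos _).le
  refine ⟨synthConst ι * (max C 0 * (atomConst ι * I)), ?_, fun n q => ?_⟩
  · have := synthConst_pos (ι := ι)
    have := atomConst_pos (ι := ι)
    positivity
  -- The weight in `a` undoes `w`, so `T n` at `a` is `stft (vn n) q` up to the normalisation, and
  -- the `L¹` norm of `a` grows at most like `exp (ε ‖q‖ ^ (1 / θ))`.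
  set a : Phase ι → ℂ := fun p =>
    coeff (gaborAtom q) p * ((Real.exp (η * ‖p‖ ^ (1 / θ)) : ℝ) : ℂ) with ha
  have ham : Measurable a := (measurable_coeff (contDiff_gaborAtom_apply q).continuous).mul
    (Complex.continuous_ofReal.comp (continuous_exp_mul_norm_rpow hθ η)).measurable
  have hab : ∀ p, ‖a p‖ ≤ atomConst ι * Real.exp (ε * ‖q‖ ^ (1 / θ)) *
      Real.exp (-η * ‖p‖ ^ (1 / θ)) := fun p => by
    have h1 := norm_coeff_gaborAtom_le_exp hθ (by positivity : 0 ≤ 2 * η) (by linarith) q p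
    rw [ha, norm_mul, Complex.norm_real, Real.norm_of_nonneg (Real.exp_pos _).le]
    refine (mul_le_mul_of_nonneg_right h1 (Real.exp_pos _).le).trans ?_
    rw [mul_assoc (atomConst ι), mul_assoc (atomConst ι), ← Real.exp_add, ← Real.exp_add,
      ← Real.exp_add]
    refine mul_le_mul_of_nonneg_left (Real.exp_le_exp.2 ?_) atomConst_pos.le
    have : 0 ≤ ‖q‖ ^ (1 / θ) := by positivity
    nlinarith
  have hai : Integrable a := integrable_of_norm_le_exp hθ hη0 ham.aestronglyMeasurable hab
  have h1 : stft (vn n) q = synthConst ι * T n (hai.toL1 a) := by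
    rw [stft_eq hθ, apply_eq_integral hθ, hT]
    congr 1
    refine integral_congr_ae ?_
    filter_upwards [hai.coeFn_toL1] with p hp
    rw [hp, ha, hw]
    simp only []
    rw [mul_assoc, ← mul_assoc (Complex.ofReal _), ← Complex.ofReal_mul, ← Real.exp_add, neg_mul,
      add_neg_cancel, Real.exp_zero, Complex.ofReal_one, one_mul]
  rw [h1, norm_mul, Complex.norm_real, Real.norm_of_nonneg synthConst_pos.le, mul_assoc]
  refine mul_le_mul_of_nonneg_left ?_ synthConst_pos.le
  have h2 : ‖hai.toL1 a‖ ≤ atomConst ι * Real.exp (ε * ‖q‖ ^ (1 / θ)) * I := by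
    rw [L1.norm_eq_integral_norm, hI, ← integral_const_mul]
    refine integral_mono_ae (L1.integrable_coeFn _).norm (hi.const_mul _) ?_
    filter_upwards [hai.coeFn_toL1] with p hp
    rw [hp]
    exact hab p
  calc ‖T n (hai.toL1 a)‖ ≤ ‖T n‖ * ‖hai.toL1 a‖ := (T n).le_opNorm _
    _ ≤ max C 0 * (atomConst ι * Real.exp (ε * ‖q‖ ^ (1 / θ)) * I) :=
        mul_le_mul ((hC n).trans (le_max_left _ _)) h2 (norm_nonneg _) (le_max_right _ _)
    _ = _ := by ring

/-! ### The wave front set in terms of Gabor coefficients -/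

/-- The inverse of `toComplex`. -/
def ofComplex (z : EuclideanSpace ℂ ι) : Phase ι :=
  (WithLp.toLp 2 fun j => -(z j).im, WithLp.toLp 2 fun j => -(z j).re)

theorem ofComplex_toComplex (p : Phase ι) : ofComplex (toComplex p) = p := by
  refine Prod.ext ?_ ?_ <;> ext j <;> simp [ofComplex, toComplex]

theorem toComplex_ofComplex (z : EuclideanSpace ℂ ι) : toComplex (ofComplex z) = z := by
  ext j
  apply Complex.ext <;> simp [ofComplex, toComplex]

theorem continuous_toComplex : Continuous (toComplex : Phase ι → EuclideanSpace ℂ ι) := by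
  unfold toComplex
  fun_prop

theorem continuous_ofComplex : Continuous (ofComplex : EuclideanSpace ℂ ι → Phase ι) := by
  unfold ofComplex
  fun_prop

theorem toComplex_smul (t : ℝ) (p : Phase ι) : toComplex (t • p) = (t : ℂ) • toComplex p := by
  ext j
  simp [toComplex]
  ring

theorem ofComplex_smul (t : ℝ) (z : EuclideanSpace ℂ ι) :
    ofComplex ((t : ℂ) • z) = t • ofComplex z := by
  refine Prod.ext ?_ ?_ <;> ext j <;> simp [ofComplex]

theorem norm_toComplex_sq (p : Phase ι) : ‖toComplex p‖ ^ 2 = ‖p.1‖ ^ 2 + ‖p.2‖ ^ 2 := by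
  rw [EuclideanSpace.norm_sq_eq, EuclideanSpace.norm_sq_eq, EuclideanSpace.norm_sq_eq,
    ← Finset.sum_add_distrib]
  refine Finset.sum_congr rfl fun j _ => ?_
  rw [Complex.sq_norm, Complex.normSq_apply]
  simp [toComplex]
  ring

theorem norm_le_norm_toComplex (p : Phase ι) : ‖p‖ ≤ ‖toComplex p‖ := by
  have h := norm_toComplex_sq p
  refine max_le ?_ ?_
  · refine le_of_sq_le_sq ?_ (norm_nonneg _)
    nlinarith [sq_nonneg ‖p.2‖]
  · refine le_of_sq_le_sq ?_ (norm_nonneg _)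
    nlinarith [sq_nonneg ‖p.1‖]

theorem norm_toComplex_le (p : Phase ι) : ‖toComplex p‖ ≤ 2 * ‖p‖ := by
  have h := norm_toComplex_sq p
  have h1 := norm_fst_le p
  have h2 := norm_snd_le p
  refine le_of_sq_le_sq ?_ (by positivity)
  nlinarith [norm_nonneg p.1, norm_nonneg p.2, norm_nonneg p]

theorem weight_toComplex (p : Phase ι) : weight (toComplex p) = ‖p.1‖ ^ 2 / 2 := by
  rw [EuclideanSpace.norm_sq_eq]
  simp [weight, toComplex]

/-- Completing the square in `-|y|²/2 + ⟨x, y⟩` yields the window at `x` and a factor equal to the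
exponential of the weight. -/
theorem exp_phase_toComplex (p : Phase ι) :
    (fun y => Complex.exp (Complex.I * phase (toComplex p) y)) =
      ((Real.exp (‖p.1‖ ^ 2 / 2) : ℝ) : ℂ) • gaborAtom p := by
  funext y
  rw [Pi.smul_apply, smul_eq_mul, gaborAtom, Complex.ofReal_exp, ← Complex.exp_add]
  congr 1
  have h1 : (∑ j, toComplex p j * (y j : ℂ)) =
      -((inner ℝ p.2 y : ℝ) : ℂ) - Complex.I * ((inner ℝ p.1 y : ℝ) : ℂ) := by
    rw [PiLp.inner_apply, PiLp.inner_apply]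
    push_cast
    rw [Finset.mul_sum, ← Finset.sum_neg_distrib, ← Finset.sum_sub_distrib]
    refine Finset.sum_congr rfl fun j _ => ?_
    simp [toComplex]
    ring
  have h2 : ‖y - p.1‖ ^ 2 = ‖y‖ ^ 2 - 2 * inner ℝ p.1 y + ‖p.1‖ ^ 2 := by
    rw [norm_sub_sq_real, real_inner_comm]
  rw [phase, h1, h2]
  push_cast
  linear_combination (-(((inner ℝ p.1 y : ℝ) : ℂ)) + ((‖y‖ : ℝ) : ℂ) ^ 2 / 2) * Complex.I_sq

/-- The normalizing constant of the FBI transform. -/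
def fbiConst (ι : Type) [Fintype ι] : ℝ :=
  (2 : ℝ) ^ (-(Fintype.card ι : ℝ) / 2) * Real.pi ^ (-(3 * (Fintype.card ι : ℝ)) / 4)

theorem fbiConst_pos : 0 < fbiConst ι := by
  unfold fbiConst
  positivity

theorem norm_fbi_toComplex {θ : ℝ} (hθ : Admissible θ) (u : GSDual θ ι) (p : Phase ι) :
    ‖fbi u (toComplex p)‖ = fbiConst ι * (Real.exp (‖p.1‖ ^ 2 / 2) * ‖stft u p‖) := by
  have h : pairing u (((Real.exp (‖p.1‖ ^ 2 / 2) : ℝ) : ℂ) • gaborAtom p) =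
      ((Real.exp (‖p.1‖ ^ 2 / 2) : ℝ) : ℂ) * stft u p := by
    rw [pairing_of_mem u ((GS θ ι).smul_mem _ (gaborAtom_mem hθ p)), stft_eq hθ, ← smul_eq_mul,
      ← map_smul]
    rfl
  rw [fbi, exp_phase_toComplex, h, norm_mul, norm_mul, Complex.norm_real, Complex.norm_real,
    Real.norm_of_nonneg (Real.exp_pos _).le]
  congr 1
  exact Real.norm_of_nonneg (fbiConst_pos (ι := ι)).le

/-- The weight cancels the factor from completing the square; the norms of `p` and `toComplex p`
differ by a factor of at most `2`, which changes only `ε`. The index set `J` covers both a single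
ultradistribution and a sequence with uniform constants. -/
theorem exists_fbi_bound_iff {θ : ℝ} (hθ : Admissible θ) {J : Type*} (v : J → GSDual θ ι)
    (p : Phase ι) :
    (∃ L, IsConicNhd L (toComplex p) ∧ ∃ ε > 0, ∃ C : ℝ, ∀ n, ∀ z ∈ L,
      ‖fbi (v n) z‖ ≤ C * Real.exp (-ε * ‖z‖ ^ (1 / θ) + weight z)) ↔
    ∃ L, IsOpenCone L ∧ p ∈ L ∧ ∃ ε > 0, ∃ C ≥ 0, ∀ n, ∀ q ∈ L,
      ‖stft (v n) q‖ ≤ C * Real.exp (-ε * ‖q‖ ^ (1 / θ)) := by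
  have hk := fbiConst_pos (ι := ι)
  constructor
  · rintro ⟨L, ⟨hLo, hpL, hLc⟩, ε, hε, C, h⟩
    refine ⟨toComplex ⁻¹' L, ⟨hLo.preimage continuous_toComplex, fun q hq t ht => ?_⟩, hpL, ε, hε,
      |C| / fbiConst ι, by positivity, fun n q hq => ?_⟩
    · rw [Set.mem_preimage, toComplex_smul]
      exact hLc _ hq t ht
    · have h1 := h n _ hq
      rw [norm_fbi_toComplex hθ, weight_toComplex, Real.exp_add] at h1
      have h2 : C * (Real.exp (-ε * ‖toComplex q‖ ^ (1 / θ)) * Real.exp (‖q.1‖ ^ 2 / 2)) ≤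
          Real.exp (‖q.1‖ ^ 2 / 2) * (|C| * Real.exp (-ε * ‖q‖ ^ (1 / θ))) := by
        rw [mul_comm (Real.exp (-ε * _)), mul_left_comm]
        refine mul_le_mul_of_nonneg_left (mul_le_mul (le_abs_self C) (Real.exp_le_exp.2 ?_)
          (Real.exp_pos _).le (abs_nonneg C)) (Real.exp_pos _).le
        have := Real.rpow_le_rpow (norm_nonneg q) (norm_le_norm_toComplex q) hθ.inv_nonneg
        nlinarith
      have h3 := h1.trans h2
      rw [mul_left_comm] at h3
      have h4 := le_of_mul_le_mul_left h3 (Real.exp_pos _)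
      rw [div_mul_eq_mul_div, le_div_iff₀ hk, mul_comm]
      exact h4
  · rintro ⟨L, hL, hpL, ε, hε, C, hC, h⟩
    refine ⟨ofComplex ⁻¹' L, ⟨hL.1.preimage continuous_ofComplex, ?_, fun z hz t ht => ?_⟩,
      ε * ((2 : ℝ) ^ (1 / θ))⁻¹, by positivity, fbiConst ι * C, fun n z hz => ?_⟩
    · rwa [Set.mem_preimage, ofComplex_toComplex]
    · rw [Set.mem_preimage, ofComplex_smul]
      exact hL.2 _ hz t ht
    · obtain ⟨q, rfl⟩ : ∃ q, z = toComplex q := ⟨_, (toComplex_ofComplex z).symm⟩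
      rw [Set.mem_preimage, ofComplex_toComplex] at hz
      have h1 := h n q hz
      rw [norm_fbi_toComplex hθ, weight_toComplex, Real.exp_add, mul_assoc]
      refine mul_le_mul_of_nonneg_left ?_ hk.le
      rw [mul_comm (Real.exp _), ← mul_assoc]
      refine mul_le_mul_of_nonneg_right (h1.trans ?_) (Real.exp_pos _).le
      refine mul_le_mul_of_nonneg_left (Real.exp_le_exp.2 ?_) hC
      have h2 := mul_le_mul_of_nonneg_left (rpow_norm_le_mul hθ two_pos (norm_nonneg _)
        (norm_nonneg q) (norm_toComplex_le q)) hε.le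
      linarith

theorem mem_WF_iff {θ : ℝ} (hθ : Admissible θ) (u : GSDual θ ι) (p : Phase ι) :
    p ∈ WF u ↔ p ≠ 0 ∧ ¬ DecayAt θ (fun q => ‖stft u q‖) p := by
  have h := exists_fbi_bound_iff hθ (fun _ : Unit => u) p
  simp only [forall_const] at h
  change p ≠ 0 ∧ ¬ _ ↔ _
  rw [h]
  simp only [DecayAt, DecayOn, Set.singleton_subset_iff]

theorem mem_DualWF_iff {θ : ℝ} (hθ : Admissible θ) (u : GSDual θ ι) (Γ : Set (Phase ι)) :
    u ∈ DualWF θ Γ ↔ ∀ p, p ≠ 0 → p ∉ Γ → DecayAt θ (fun q => ‖stft u q‖) p := by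
  change WF u ⊆ Γ ↔ _
  constructor
  · intro h p hp hpΓ
    by_contra hd
    exact hpΓ (h ((mem_WF_iff hθ u p).2 ⟨hp, hd⟩))
  · intro h p hp
    rw [mem_WF_iff hθ] at hp
    by_contra hd
    exact hp.2 (h p hp.1 hd)

theorem ofModel_mem_DualWF {θ : ℝ} (hθ : Admissible θ) {W : Phase ι → ℂ} (hW : IsModel θ W)
    {Γ : Set (Phase ι)} (h : ∀ p, p ≠ 0 → p ∉ Γ → DecayAt θ (fun q => ‖W q‖) p) :
    ofModel hθ hW ∈ DualWF θ Γ :=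
  (mem_DualWF_iff hθ _ _).2 fun p hp hpΓ => decayAt_stft_ofModel hθ hW hp (h p hp hpΓ)

/-- Pointwise convergence of functions on phase space, with a moderate bound for the differences
that decays off `Γ`. -/
structure ModelTendsto (θ : ℝ) (Γ : Set (Phase ι)) (Wn : ℕ → Phase ι → ℂ) (W : Phase ι → ℂ) :
    Prop where
  tendsto : ∀ p, Filter.Tendsto (fun n => Wn n p) Filter.atTop (𝓝 (W p))
  bound : ∃ R : Phase ι → ℝ, Measurable R ∧ (∀ p, 0 ≤ R p) ∧ Moderate θ R ∧
    (∀ n p, ‖Wn n p - W p‖ ≤ R p) ∧ ∀ p, p ≠ 0 → p ∉ Γ → DecayAt θ R p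

/-- The majorant is the supremum over `n` of `‖stft (un n - u) p‖`. It is moderate by
`exists_moderate_bound`, as weakly convergent sequences are pointwise bounded, and it decays off `Γ`
by the uniform FBI bounds. -/
theorem TendstoWF.modelTendsto {θ : ℝ} (hθ : Admissible θ) {Γ : Set (Phase ι)}
    {un : ℕ → GSDual θ ι} {u : GSDual θ ι} (h : TendstoWF Γ un u) :
    ModelTendsto θ Γ (fun n => stft (un n)) (stft u) := by
  obtain ⟨-, -, hw, hb⟩ := h
  refine ⟨fun p => ?_, ?_⟩
  · simp only [stft_eq hθ]
    exact hw _
  have hmod : ∀ ε > 0, ∃ K ≥ 0, ∀ n p, ‖stft (un n - u) p‖ ≤ K * Real.exp (ε * ‖p‖ ^ (1 / θ)) :=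
    fun ε hε => exists_moderate_bound hθ (fun n => un n - u) (fun f => by
      have h1 : Filter.Tendsto (fun n => (un n - u).1 f) Filter.atTop (𝓝 0) := by
        have := (hw f).sub_const (u.1 f)
        rw [sub_self] at this
        exact this
      obtain ⟨C, hC⟩ := h1.norm.bddAbove_range
      exact ⟨C, fun n => hC ⟨n, rfl⟩⟩) hε
  have hle : ∀ n p, ‖stft (un n - u) p‖ ≤ ⨆ n, ‖stft (un n - u) p‖ := fun n p => by
    obtain ⟨K, -, hK⟩ := hmod 1 one_pos
    exact le_ciSup (f := fun n => ‖stft (un n - u) p‖)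
      ⟨K * Real.exp (1 * ‖p‖ ^ (1 / θ)), by rintro _ ⟨n, rfl⟩; exact hK n p⟩ n
  refine ⟨fun p => ⨆ n, ‖stft (un n - u) p‖,
    Measurable.iSup fun n => (measurable_stft hθ _).norm, fun p => (norm_nonneg _).trans (hle 0 p),
    fun ε hε => ?_, fun n p => ?_, fun p hp hpΓ => ?_⟩
  · obtain ⟨K, hK, h1⟩ := hmod ε hε
    exact ⟨K, hK, fun p => ciSup_le fun n => h1 n p⟩
  · rw [← stft_sub hθ]
    exact hle n p
  · obtain ⟨L, hL, hpL, ε, hε, C, hC, h1⟩ :=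
      (exists_fbi_bound_iff hθ (fun n => un n - u) p).1 (hb p hp hpΓ)
    exact ⟨L, hL, Set.singleton_subset_iff.2 hpL, ε, hε, C, hC,
      fun q hq => ciSup_le fun n => h1 n q hq⟩

theorem tendsto_integral_coeff_mul {θ : ℝ} (hθ : Admissible θ) {Γ : Set (Phase ι)}
    {Wn : ℕ → Phase ι → ℂ} {W : Phase ι → ℂ} (hWn : ∀ n, IsModel θ (Wn n)) (hW : IsModel θ W)
    (h : ModelTendsto θ Γ Wn W) {G : Phase ι → ℂ} (hG : Measurable G) {ε K : ℝ} (hε : 0 < ε)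
    (hb : ∀ p, ‖G p‖ ≤ K * Real.exp (-ε * ‖p‖ ^ (1 / θ))) :
    Filter.Tendsto (fun n => ∫ p, G p * Wn n p) Filter.atTop (𝓝 (∫ p, G p * W p)) := by
  obtain ⟨R, hRm, hR0, hRmod, hR, -⟩ := h.bound
  have hRc : IsModel θ fun p => ((R p : ℝ) : ℂ) :=
    ⟨Complex.measurable_ofReal.comp hRm, by
      simpa only [Complex.norm_real, Real.norm_of_nonneg (hR0 _)] using hRmod⟩
  refine tendsto_integral_of_dominated_convergence
    (fun p => ‖G p * W p‖ + ‖G p * ((R p : ℝ) : ℂ)‖)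
    (fun n => (hG.mul (hWn n).measurable).aestronglyMeasurable)
    ((hW.integrable_mul hθ hG hε hb).norm.add (hRc.integrable_mul hθ hG hε hb).norm)
    (fun n => Filter.Eventually.of_forall fun p => ?_)
    (Filter.Eventually.of_forall fun p => (h.tendsto p).const_mul _)
  rw [norm_mul, norm_mul, norm_mul, ← mul_add, Complex.norm_real, Real.norm_of_nonneg (hR0 p)]
  refine mul_le_mul_of_nonneg_left ?_ (norm_nonneg _)
  calc ‖Wn n p‖ = ‖W p + (Wn n p - W p)‖ := by rw [add_sub_cancel]
    _ ≤ _ := (norm_add_le _ _).trans (add_le_add_right (hR n p) _)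

/-- Dominated convergence gives weak convergence; convolving the common majorant with a Gaussian
gives the uniform bounds off `Γ`. -/
theorem tendstoWF_ofModel {θ : ℝ} (hθ : Admissible θ) {Γ : Set (Phase ι)}
    {Wn : ℕ → Phase ι → ℂ} {W : Phase ι → ℂ} (hWn : ∀ n, IsModel θ (Wn n)) (hW : IsModel θ W)
    (hd : ∀ p, p ≠ 0 → p ∉ Γ → DecayAt θ (fun q => ‖W q‖) p) (h : ModelTendsto θ Γ Wn W) :
    TendstoWF Γ (fun n => ofModel hθ (hWn n)) (ofModel hθ hW) := by
  have hb := h.bound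
  obtain ⟨R, hRm, hR0, hRmod, hR, hRd⟩ := hb
  refine ⟨fun n => ofModel_mem_DualWF hθ (hWn n) fun p hp hpΓ => ?_,
    ofModel_mem_DualWF hθ hW hd, fun f => ?_, fun p hp hpΓ => ?_⟩
  · refine ((hd p hp hpΓ).add (hRd p hp hpΓ)).mono fun q => ?_
    calc ‖Wn n q‖ = ‖W q + (Wn n q - W q)‖ := by rw [add_sub_cancel]
      _ ≤ _ := (norm_add_le _ _).trans (add_le_add_right (hR n q) _)
  · obtain ⟨ε, hε, K, -, hK⟩ := exists_norm_coeff_le hθ f.2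
    exact (tendsto_integral_coeff_mul hθ hWn hW h (measurable_coeff (continuous_of_mem f.2))
      hε hK).const_mul _
  · refine (exists_fbi_bound_iff hθ (fun n => ofModel hθ (hWn n) - ofModel hθ hW) p).2 ?_
    have hk : 0 ≤ synthConst ι * Real.pi ^ ((Fintype.card ι : ℝ) / 2) :=
      mul_nonneg synthConst_pos.le (by positivity)
    obtain ⟨L, hL, hpL, ε, hε, C, hC, h1⟩ :=
      (decayAt_integral_mul_gaussian hθ hRm hR0 hRmod hp (hRd p hp hpΓ)).const_mul hk
    refine ⟨L, hL, Set.singleton_subset_iff.1 hpL, ε, hε, C, hC, fun n q hq => ?_⟩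
    rw [ofModel_sub]
    exact (norm_stft_ofModel_le hθ _ hRm hRmod (hR n) q).trans (h1 q hq)

/-! ### Products of decaying and moderate functions -/

section Decay

variable {E : Type*} [NormedAddCommGroup E] [NormedSpace ℝ E]
  {E₁ : Type*} [NormedAddCommGroup E₁] [NormedSpace ℝ E₁]
  {E₂ : Type*} [NormedAddCommGroup E₂] [NormedSpace ℝ E₂]

/-- Near `p` the norm `‖r‖` is at most a multiple of `‖A r‖`, so the first factor decays in `r`, and
half of its rate absorbs the moderate second factor. -/
theorem decayAt_comp_mul_comp {θ : ℝ} (hθ : Admissible θ) {N₁ : E₁ → ℝ} {N₂ : E₂ → ℝ}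
    (h₁ : ∀ x, 0 ≤ N₁ x) (h₂ : Moderate θ N₂) (A : E →L[ℝ] E₁) (B : E →L[ℝ] E₂)
    (hB : ∀ r, ‖B r‖ ≤ ‖r‖) {p : E} (hp : A p ≠ 0) (h : DecayAt θ N₁ (A p)) :
    DecayAt θ (fun r => N₁ (A r) * N₂ (B r)) p := by
  have hp0 : 0 < ‖A p‖ := norm_pos_iff.2 hp
  set R := ‖p‖ / ‖A p‖ + 1 with hR
  have hR0 : 0 < R := by positivity
  obtain ⟨L, hL, hpL, ε, hε, C, hC, hb⟩ := h
  set η := ε * (R ^ (1 / θ))⁻¹ / 2 with hη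
  have hη0 : 0 < η := by positivity
  obtain ⟨K, hK, hNK⟩ := h₂ η hη0
  refine ⟨{r | A r ∈ L ∧ ‖r‖ < R * ‖A r‖}, ⟨?_, ?_⟩, ?_, η, hη0, C * K, by positivity, ?_⟩
  · exact (hL.1.preimage A.continuous).inter
      (isOpen_lt (f := fun r : E => ‖r‖) (g := fun r => R * ‖A r‖) (by fun_prop) (by fun_prop))
  · intro r hr t ht
    refine ⟨by rw [map_smul]; exact hL.2 _ hr.1 t ht, ?_⟩
    have := hr.2
    simp only [map_smul, norm_smul, Real.norm_of_nonneg ht.le]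
    calc t * ‖r‖ < t * (R * ‖A r‖) := by gcongr
      _ = _ := by ring
  · rw [Set.singleton_subset_iff]
    refine ⟨Set.singleton_subset_iff.1 hpL, ?_⟩
    rw [hR, add_mul, div_mul_cancel₀ _ hp0.ne']
    linarith
  · intro r hr
    have h1 := mul_le_mul_of_nonneg_left
      (rpow_norm_le_mul hθ hR0 (norm_nonneg r) (norm_nonneg (A r)) hr.2.le) hε.le
    have h2 := mul_le_mul_of_nonneg_left
      (Real.rpow_le_rpow (norm_nonneg _) (hB r) hθ.inv_nonneg) hη0.le
    have h3 : ε * ((R ^ (1 / θ))⁻¹ * ‖r‖ ^ (1 / θ)) = 2 * η * ‖r‖ ^ (1 / θ) := by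
      rw [hη]
      ring
    calc N₁ (A r) * N₂ (B r) ≤ N₁ (A r) * (K * Real.exp (η * ‖B r‖ ^ (1 / θ))) :=
          mul_le_mul_of_nonneg_left (hNK _) (h₁ _)
      _ ≤ C * Real.exp (-ε * ‖A r‖ ^ (1 / θ)) * (K * Real.exp (η * ‖B r‖ ^ (1 / θ))) :=
          mul_le_mul_of_nonneg_right (hb _ hr.1) (by positivity)
      _ = C * K * Real.exp (-ε * ‖A r‖ ^ (1 / θ) + η * ‖B r‖ ^ (1 / θ)) := by
          rw [Real.exp_add]
          ring
      _ ≤ _ := mul_le_mul_of_nonneg_left (Real.exp_le_exp.2 (by linarith)) (by positivity)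

theorem Moderate.comp_mul_comp {θ : ℝ} (hθ : Admissible θ) {N₁ : E₁ → ℝ} {N₂ : E₂ → ℝ}
    (h₁ : Moderate θ N₁) (h₂ : Moderate θ N₂) (hN : ∀ x, 0 ≤ N₂ x) (A : E →L[ℝ] E₁)
    (B : E →L[ℝ] E₂) (hA : ∀ r, ‖A r‖ ≤ ‖r‖) (hB : ∀ r, ‖B r‖ ≤ ‖r‖) :
    Moderate θ fun r => N₁ (A r) * N₂ (B r) := by
  intro ε hε
  obtain ⟨K, hK, h⟩ := h₁ (ε / 2) (by positivity)
  obtain ⟨K', hK', h'⟩ := h₂ (ε / 2) (by positivity)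
  refine ⟨K * K', by positivity, fun r => ?_⟩
  have e1 := Real.rpow_le_rpow (norm_nonneg _) (hA r) hθ.inv_nonneg
  have e2 := Real.rpow_le_rpow (norm_nonneg _) (hB r) hθ.inv_nonneg
  calc _ ≤ K * Real.exp (ε / 2 * ‖A r‖ ^ (1 / θ)) * (K' * Real.exp (ε / 2 * ‖B r‖ ^ (1 / θ))) :=
        mul_le_mul (h _) (h' _) (hN _) (by positivity)
    _ = K * K' * Real.exp (ε / 2 * ‖A r‖ ^ (1 / θ) + ε / 2 * ‖B r‖ ^ (1 / θ)) := by
        rw [Real.exp_add]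
        ring
    _ ≤ _ := mul_le_mul_of_nonneg_left (Real.exp_le_exp.2 (by nlinarith)) (by positivity)

theorem Moderate.add {θ : ℝ} {N N' : E → ℝ} (h : Moderate θ N) (h' : Moderate θ N') :
    Moderate θ fun p => N p + N' p := by
  intro ε hε
  obtain ⟨K, hK, h⟩ := h ε hε
  obtain ⟨K', hK', h'⟩ := h' ε hε
  refine ⟨K + K', by positivity, fun p => ?_⟩
  rw [add_mul]
  exact add_le_add (h p) (h' p)

end Decay

/-! ### The decomposition of `T^*ℝ^{2d}` -/

/-- The first component of a point of `ℝ^d × ℝ^d`. -/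
def leftConf (ι : Type) [Fintype ι] : Conf (ι ⊕ ι) →L[ℝ] Conf ι :=
  LinearMap.toContinuousLinearMap
    { toFun := fun z => WithLp.toLp 2 fun i => z (Sum.inl i)
      map_add' := fun _ _ => rfl
      map_smul' := fun _ _ => rfl }

/-- The second component of a point of `ℝ^d × ℝ^d`. -/
def rightConf (ι : Type) [Fintype ι] : Conf (ι ⊕ ι) →L[ℝ] Conf ι :=
  LinearMap.toContinuousLinearMap
    { toFun := fun z => WithLp.toLp 2 fun i => z (Sum.inr i)
      map_add' := fun _ _ => rfl
      map_smul' := fun _ _ => rfl }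

theorem leftConf_pair (x y : Conf ι) : leftConf ι (pair x y) = x := rfl

theorem rightConf_pair (x y : Conf ι) : rightConf ι (pair x y) = y := rfl

theorem pair_left_right (z : Conf (ι ⊕ ι)) : pair (leftConf ι z) (rightConf ι z) = z := by
  ext (i | i) <;> rfl

theorem norm_sq_eq_left_right (z : Conf (ι ⊕ ι)) :
    ‖z‖ ^ 2 = ‖leftConf ι z‖ ^ 2 + ‖rightConf ι z‖ ^ 2 := by
  rw [EuclideanSpace.norm_sq_eq, EuclideanSpace.norm_sq_eq, EuclideanSpace.norm_sq_eq,
    Fintype.sum_sum_type]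
  rfl

theorem inner_eq_left_right (z w : Conf (ι ⊕ ι)) :
    inner ℝ z w = inner ℝ (leftConf ι z) (leftConf ι w) + inner ℝ (rightConf ι z) (rightConf ι w) := by
  rw [PiLp.inner_apply, PiLp.inner_apply, PiLp.inner_apply, Fintype.sum_sum_type]
  rfl

theorem norm_leftConf_le (z : Conf (ι ⊕ ι)) : ‖leftConf ι z‖ ≤ ‖z‖ :=
  le_of_sq_le_sq (by rw [norm_sq_eq_left_right z]; linarith [sq_nonneg ‖rightConf ι z‖])
    (norm_nonneg _)

theorem norm_rightConf_le (z : Conf (ι ⊕ ι)) : ‖rightConf ι z‖ ≤ ‖z‖ :=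
  le_of_sq_le_sq (by rw [norm_sq_eq_left_right z]; linarith [sq_nonneg ‖leftConf ι z‖])
    (norm_nonneg _)

/-- The projection of `T^*ℝ^{2d}` to the first factor `T^*ℝ^d`. -/
def leftPhase (ι : Type) [Fintype ι] : Phase (ι ⊕ ι) →L[ℝ] Phase ι :=
  (leftConf ι).prodMap (leftConf ι)

/-- The projection of `T^*ℝ^{2d}` to the second factor `T^*ℝ^d`. -/
def rightPhase (ι : Type) [Fintype ι] : Phase (ι ⊕ ι) →L[ℝ] Phase ι :=
  (rightConf ι).prodMap (rightConf ι)

theorem leftPhase_apply (p : Phase (ι ⊕ ι)) :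
    leftPhase ι p = (leftConf ι p.1, leftConf ι p.2) := rfl

theorem rightPhase_apply (p : Phase (ι ⊕ ι)) :
    rightPhase ι p = (rightConf ι p.1, rightConf ι p.2) := rfl

theorem norm_leftPhase_le (p : Phase (ι ⊕ ι)) : ‖leftPhase ι p‖ ≤ ‖p‖ :=
  max_le_max (norm_leftConf_le _) (norm_leftConf_le _)

theorem norm_rightPhase_le (p : Phase (ι ⊕ ι)) : ‖rightPhase ι p‖ ≤ ‖p‖ :=
  max_le_max (norm_rightConf_le _) (norm_rightConf_le _)

theorem eq_zero_of_left_right {p : Phase (ι ⊕ ι)} (h : leftPhase ι p = 0)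
    (h' : rightPhase ι p = 0) : p = 0 := by
  rw [leftPhase_apply, Prod.mk_eq_zero] at h
  rw [rightPhase_apply, Prod.mk_eq_zero] at h'
  refine Prod.ext ?_ ?_
  · rw [← pair_left_right p.1, h.1, h'.1]
    ext (i | i) <;> rfl
  · rw [← pair_left_right p.2, h.2, h'.2]
    ext (i | i) <;> rfl

theorem gaborAtom_left_right (p : Phase (ι ⊕ ι)) (z : Conf (ι ⊕ ι)) :
    gaborAtom p z = gaborAtom (leftPhase ι p) (leftConf ι z) *
      gaborAtom (rightPhase ι p) (rightConf ι z) := by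
  rw [gaborAtom, gaborAtom, gaborAtom, ← Complex.exp_add, norm_sq_eq_left_right,
    inner_eq_left_right, map_sub, map_sub]
  congr 1
  simp only [leftPhase_apply, rightPhase_apply]
  push_cast
  ring

theorem measurePreserving_conf :
    MeasurePreserving (fun z : Conf (ι ⊕ ι) => (leftConf ι z, rightConf ι z)) volume volume := by
  have h1 := PiLp.volume_preserving_ofLp (ι ⊕ ι)
  have h2 := volume_measurePreserving_sumPiEquivProdPi (fun _ : ι ⊕ ι => ℝ)
  have h3 := (PiLp.volume_preserving_toLp ι).prod (PiLp.volume_preserving_toLp ι)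
  exact h3.comp (h2.comp h1)

theorem measurePreserving_prodProdProdComm {α β γ δ : Type*} [MeasureSpace α] [MeasureSpace β]
    [MeasureSpace γ] [MeasureSpace δ] [SigmaFinite (volume : Measure α)]
    [SigmaFinite (volume : Measure β)] [SigmaFinite (volume : Measure γ)]
    [SigmaFinite (volume : Measure δ)] :
    MeasurePreserving (fun p : (α × β) × (γ × δ) => ((p.1.1, p.2.1), (p.1.2, p.2.2)))
      volume volume := by
  have h1 := volume_preserving_prodAssoc (α₁ := α) (β₁ := β) (γ₁ := γ × δ)
  have h2 := (MeasurePreserving.id (volume : Measure α)).prod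
    ((volume_preserving_prodAssoc (α₁ := β) (β₁ := γ) (γ₁ := δ)).symm)
  have h3 := (MeasurePreserving.id (volume : Measure α)).prod
    ((Measure.measurePreserving_swap (μ := (volume : Measure β)) (ν := (volume : Measure γ))).prod
      (MeasurePreserving.id (volume : Measure δ)))
  have h4 := (MeasurePreserving.id (volume : Measure α)).prod
    (volume_preserving_prodAssoc (α₁ := γ) (β₁ := β) (γ₁ := δ))
  have h5 := (volume_preserving_prodAssoc (α₁ := α) (β₁ := γ) (γ₁ := β × δ)).symm
  exact h5.comp (h4.comp (h3.comp (h2.comp h1)))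

theorem measurePreserving_phase :
    MeasurePreserving (fun p : Phase (ι ⊕ ι) => (leftPhase ι p, rightPhase ι p))
      volume volume :=
  measurePreserving_prodProdProdComm.comp
    ((measurePreserving_conf (ι := ι)).prod (measurePreserving_conf (ι := ι)))

theorem integral_left_mul_right_conf {F G : Conf ι → ℂ} (hF : Measurable F) (hG : Measurable G) :
    ∫ z : Conf (ι ⊕ ι), F (leftConf ι z) * G (rightConf ι z) = (∫ x, F x) * ∫ y, G y := by
  have h := measurePreserving_conf (ι := ι)
  rw [← integral_prod_mul, ← Measure.volume_eq_prod, ← h.map_eq,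
    integral_map h.measurable.aemeasurable]
  exact ((hF.comp measurable_fst).mul (hG.comp measurable_snd)).aestronglyMeasurable

theorem integral_left_mul_right_phase {F G : Phase ι → ℂ} (hF : Measurable F)
    (hG : Measurable G) :
    ∫ p : Phase (ι ⊕ ι), F (leftPhase ι p) * G (rightPhase ι p) = (∫ x, F x) * ∫ y, G y := by
  have h := measurePreserving_phase (ι := ι)
  rw [← integral_prod_mul, ← Measure.volume_eq_prod, ← h.map_eq,
    integral_map h.measurable.aemeasurable]
  exact ((hF.comp measurable_fst).mul (hG.comp measurable_snd)).aestronglyMeasurable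

theorem synthConst_sum : synthConst (ι ⊕ ι) = synthConst ι * synthConst ι := by
  unfold synthConst
  rw [Fintype.card_sum, pow_add, Nat.cast_add, add_div, Real.rpow_add Real.pi_pos, ← mul_inv]
  congr 1
  ring

/-! ### Tensor products -/

theorem isModel_tensor {θ : ℝ} (hθ : Admissible θ) (u v : GSDual θ ι) :
    IsModel θ fun p : Phase (ι ⊕ ι) => stft u (leftPhase ι p) * stft v (rightPhase ι p) := by
  refine ⟨((measurable_stft hθ u).comp (leftPhase ι).continuous.measurable).mul
    ((measurable_stft hθ v).comp (rightPhase ι).continuous.measurable), ?_⟩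
  simp only [norm_mul]
  exact (moderate_stft hθ u).comp_mul_comp hθ (moderate_stft hθ v) (fun p => norm_nonneg _) _ _
    norm_leftPhase_le norm_rightPhase_le

/-- The tensor product `u ⊗ v`. -/
def tensor {θ : ℝ} (hθ : Admissible θ) (u v : GSDual θ ι) : GSDual θ (ι ⊕ ι) :=
  ofModel hθ (isModel_tensor hθ u v)

theorem coeff_tensor {f g : Conf ι → ℂ} (hf : Continuous f) (hg : Continuous g)
    {h : Conf (ι ⊕ ι) → ℂ} (hfg : ∀ x y, h (pair x y) = f x * g y) (p : Phase (ι ⊕ ι)) :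
    coeff h p = coeff f (leftPhase ι p) * coeff g (rightPhase ι p) := by
  have hc : ∀ p : Phase ι, Continuous fun y => starRingEnd ℂ (gaborAtom p y) := fun p =>
    Complex.continuous_conj.comp (contDiff_gaborAtom_apply p).continuous
  refine Eq.trans ?_ (integral_left_mul_right_conf (hf.mul (hc _)).measurable
    (hg.mul (hc _)).measurable)
  refine integral_congr_ae (Filter.Eventually.of_forall fun z => ?_)
  have h1 := hfg (leftConf ι z) (rightConf ι z)
  rw [pair_left_right] at h1
  simp only []
  rw [gaborAtom_left_right, map_mul, h1]
  ring

theorem isTensor_tensor {θ : ℝ} (hθ : Admissible θ) (u v : GSDual θ ι) :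
    IsTensor u v (tensor hθ u v) := by
  intro f g h hfg
  have hf := continuous_of_mem f.2
  have hg := continuous_of_mem g.2
  rw [tensor, ofModel_apply, apply_eq_integral hθ u f, apply_eq_integral hθ v g, synthConst_sum]
  have e : ∫ p, coeff (h : Conf (ι ⊕ ι) → ℂ) p * (stft u (leftPhase ι p) * stft v (rightPhase ι p))
      = (∫ p, coeff (f : Conf ι → ℂ) p * stft u p) * ∫ p, coeff (g : Conf ι → ℂ) p * stft v p := by
    refine Eq.trans ?_ (integral_left_mul_right_phase
      ((measurable_coeff hf).mul (measurable_stft hθ u))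
      ((measurable_coeff hg).mul (measurable_stft hθ v)))
    refine integral_congr_ae (Filter.Eventually.of_forall fun p => ?_)
    simp only [coeff_tensor hf hg hfg]
    ring
  rw [e]
  push_cast
  ring

/-- Atoms on `ℝ^{2d}` are tensor products of atoms on `ℝ^d`, so the defining identity already
determines the transform, and with it `t`. -/
theorem IsTensor.stft_eq {θ : ℝ} (hθ : Admissible θ) {u v : GSDual θ ι} {t : GSDual θ (ι ⊕ ι)}
    (h : IsTensor u v t) (p : Phase (ι ⊕ ι)) :
    stft t p = stft u (leftPhase ι p) * stft v (rightPhase ι p) := by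
  rw [GelfandShilov.stft_eq hθ, GelfandShilov.stft_eq hθ, GelfandShilov.stft_eq hθ]
  exact h _ _ _ fun x y => gaborAtom_left_right p (pair x y)

theorem IsTensor.eq_tensor {θ : ℝ} (hθ : Admissible θ) {u v : GSDual θ ι}
    {t : GSDual θ (ι ⊕ ι)} (h : IsTensor u v t) : t = tensor hθ u v :=
  ext_of_stft hθ fun p => by rw [h.stft_eq hθ, (isTensor_tensor hθ u v).stft_eq hθ]

theorem mem_tensorCone_iff {Γ₁ Γ₂ : Set (Phase ι)} {p : Phase (ι ⊕ ι)} :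
    p ∈ tensorCone Γ₁ Γ₂ ↔ p ≠ 0 ∧ leftPhase ι p ∈ Γ₁ ∪ {0} ∧ rightPhase ι p ∈ Γ₂ ∪ {0} := by
  constructor
  · rintro ⟨⟨x, y, ξ, η, h1, h2, rfl⟩, h0⟩
    exact ⟨h0, h1, h2⟩
  · rintro ⟨h0, h1, h2⟩
    exact ⟨⟨_, _, _, _, h1, h2, Prod.ext (pair_left_right _).symm (pair_left_right _).symm⟩, h0⟩

theorem IsClosedCone.isClosed_union {Γ : Set (Phase ι)} (h : IsClosedCone Γ) :
    IsClosed (Γ ∪ {0}) := by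
  rw [← closure_subset_iff_isClosed, closure_union, closure_singleton]
  exact Set.union_subset h.2.2 Set.subset_union_right

theorem IsClosedCone.smul_mem_union {Γ : Set (Phase ι)} (h : IsClosedCone Γ) {p : Phase ι}
    (hp : p ∈ Γ ∪ {0}) {t : ℝ} (ht : 0 < t) : t • p ∈ Γ ∪ {0} := by
  rcases hp with hp | hp
  · exact Or.inl (h.2.1 p hp t ht)
  · obtain rfl : p = 0 := hp
    exact Or.inr (smul_zero t)

theorem isClosedCone_tensorCone {Γ₁ Γ₂ : Set (Phase ι)} (h₁ : IsClosedCone Γ₁)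
    (h₂ : IsClosedCone Γ₂) : IsClosedCone (tensorCone Γ₁ Γ₂) := by
  refine ⟨fun h => h.2 rfl, fun p hp t ht => ?_, ?_⟩
  · rw [mem_tensorCone_iff] at hp ⊢
    rw [map_smul, map_smul]
    exact ⟨smul_ne_zero ht.ne' hp.1, h₁.smul_mem_union hp.2.1 ht, h₂.smul_mem_union hp.2.2 ht⟩
  · have hc : IsClosed (leftPhase ι ⁻¹' (Γ₁ ∪ {0}) ∩ rightPhase ι ⁻¹' (Γ₂ ∪ {0})) :=
      (h₁.isClosed_union.preimage (leftPhase ι).continuous).inter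
        (h₂.isClosed_union.preimage (rightPhase ι).continuous)
    have hsub : tensorCone Γ₁ Γ₂ ⊆ leftPhase ι ⁻¹' (Γ₁ ∪ {0}) ∩ rightPhase ι ⁻¹' (Γ₂ ∪ {0}) :=
      fun p hp => (mem_tensorCone_iff.1 hp).2
    intro p hp
    have hp' := closure_minimal hsub hc hp
    by_cases h0 : p = 0
    · exact Or.inr h0
    · exact Or.inl (mem_tensorCone_iff.2 ⟨h0, hp'⟩)

/-- A nonzero conormal point `(0, (ξ, -ξ))` has both components nonzero, so adjoining the origin to
the cones creates no new conormal point. -/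
theorem notMem_tensorCone {Γ₁ Γ₂ : Set (Phase ι)}
    (h : ∀ ξ : Conf ι, (0, ξ) ∈ Γ₁ → (0, -ξ) ∉ Γ₂) (ξ η : Conf ι) (hξη : ξ + η = 0) :
    ((0, pair ξ η) : Phase (ι ⊕ ι)) ∉ tensorCone Γ₁ Γ₂ := by
  intro hm
  obtain ⟨h0, h1, h2⟩ := mem_tensorCone_iff.1 hm
  obtain rfl : η = -ξ := (neg_eq_of_add_eq_zero_right hξη).symm
  have e1 : leftPhase ι (0, pair ξ (-ξ)) = (0, ξ) :=
    Prod.ext (map_zero (leftConf ι)) rfl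
  have e2 : rightPhase ι (0, pair ξ (-ξ)) = (0, -ξ) :=
    Prod.ext (map_zero (rightConf ι)) rfl
  rw [e1] at h1
  rw [e2] at h2
  have hξ : ξ ≠ 0 := by
    rintro rfl
    refine h0 (eq_zero_of_left_right e1 ?_)
    rw [e2, neg_zero]
    rfl
  rcases h1 with h1 | h1
  · rcases h2 with h2 | h2
    · exact h ξ h1 h2
    · exact hξ (neg_eq_zero.1 (Prod.mk_eq_zero.1 h2).2)
  · exact hξ (Prod.mk_eq_zero.1 h1).2

/-- Off the tensor cone one component of `p` is nonzero and outside its cone; that factor decays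
while the other is moderate. -/
theorem decayAt_left_mul_right {θ : ℝ} (hθ : Admissible θ) {Γ₁ Γ₂ : Set (Phase ι)}
    {N₁ N₂ : Phase ι → ℝ} (h₁ : ∀ p, 0 ≤ N₁ p) (h₂ : ∀ p, 0 ≤ N₂ p) (m₁ : Moderate θ N₁)
    (m₂ : Moderate θ N₂) (d₁ : ∀ p, p ≠ 0 → p ∉ Γ₁ → DecayAt θ N₁ p)
    (d₂ : ∀ p, p ≠ 0 → p ∉ Γ₂ → DecayAt θ N₂ p) (p : Phase (ι ⊕ ι)) (hp : p ≠ 0)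
    (hpΓ : p ∉ tensorCone Γ₁ Γ₂) :
    DecayAt θ (fun r => N₁ (leftPhase ι r) * N₂ (rightPhase ι r)) p := by
  rw [mem_tensorCone_iff] at hpΓ
  by_cases h : leftPhase ι p ∈ Γ₁ ∪ {0}
  · have h' : rightPhase ι p ∉ Γ₂ ∪ {0} := fun h' => hpΓ ⟨hp, h, h'⟩
    rw [Set.mem_union, not_or] at h'
    refine (decayAt_comp_mul_comp hθ h₂ m₁ (rightPhase ι) (leftPhase ι) norm_leftPhase_le h'.2
      (d₂ _ h'.2 h'.1)).mono fun r => le_of_eq (mul_comm _ _)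
  · rw [Set.mem_union, not_or] at h
    exact decayAt_comp_mul_comp hθ h₁ m₂ (leftPhase ι) (rightPhase ι) norm_rightPhase_le h.2
      (d₁ _ h.2 h.1)

theorem tensor_mem_DualWF {θ : ℝ} (hθ : Admissible θ) {Γ₁ Γ₂ : Set (Phase ι)} {u v : GSDual θ ι}
    (hu : u ∈ DualWF θ Γ₁) (hv : v ∈ DualWF θ Γ₂) :
    tensor hθ u v ∈ DualWF θ (tensorCone Γ₁ Γ₂) := by
  refine ofModel_mem_DualWF hθ _ fun p hp hpΓ => ?_
  simp only [norm_mul]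
  exact decayAt_left_mul_right hθ (fun p => norm_nonneg _) (fun p => norm_nonneg _)
    (moderate_stft hθ u) (moderate_stft hθ v) ((mem_DualWF_iff hθ u Γ₁).1 hu)
    ((mem_DualWF_iff hθ v Γ₂).1 hv) p hp hpΓ

theorem tendstoWF_tensor {θ : ℝ} (hθ : Admissible θ) {Γ₁ Γ₂ : Set (Phase ι)}
    {un vn : ℕ → GSDual θ ι} {u v : GSDual θ ι} (hu : TendstoWF Γ₁ un u)
    (hv : TendstoWF Γ₂ vn v) :
    TendstoWF (tensorCone Γ₁ Γ₂) (fun n => tensor hθ (un n) (vn n)) (tensor hθ u v) := by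
  have du := (mem_DualWF_iff hθ u Γ₁).1 hu.2.1
  have dv := (mem_DualWF_iff hθ v Γ₂).1 hv.2.1
  obtain ⟨tu, R, hRm, hR0, hRmod, hR, hRd⟩ := hu.modelTendsto hθ
  obtain ⟨tv, S, hSm, hS0, hSmod, hS, hSd⟩ := hv.modelTendsto hθ
  refine tendstoWF_ofModel hθ _ _ (fun p hp hpΓ => ?_) ⟨fun p => (tu _).mul (tv _), ?_⟩
  · simp only [norm_mul]
    exact decayAt_left_mul_right hθ (fun p => norm_nonneg _) (fun p => norm_nonneg _)
      (moderate_stft hθ u) (moderate_stft hθ v) du dv p hp hpΓ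
  have hvS : ∀ p, 0 ≤ ‖stft v p‖ + S p := fun p => add_nonneg (norm_nonneg _) (hS0 p)
  have mvS := (moderate_stft hθ v).add hSmod
  -- The splitting `uₙ ⊗ vₙ - u ⊗ v = (uₙ - u) ⊗ vₙ + u ⊗ (vₙ - v)`, with `vₙ` bounded by `|v| + S`,
  -- dictates this majorant.
  refine ⟨fun p => R (leftPhase ι p) * (‖stft v (rightPhase ι p)‖ + S (rightPhase ι p)) +
    ‖stft u (leftPhase ι p)‖ * S (rightPhase ι p), ?_, fun p => ?_, ?_, fun n p => ?_,
    fun p hp hpΓ => ?_⟩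
  · have ml := (leftPhase ι).continuous.measurable
    have mr := (rightPhase ι).continuous.measurable
    exact ((hRm.comp ml).mul ((((measurable_stft hθ v).comp mr).norm).add (hSm.comp mr))).add
      (((measurable_stft hθ u).comp ml).norm.mul (hSm.comp mr))
  · exact add_nonneg (mul_nonneg (hR0 _) (hvS _)) (mul_nonneg (norm_nonneg _) (hS0 _))
  · exact (hRmod.comp_mul_comp hθ mvS hvS _ _ norm_leftPhase_le norm_rightPhase_le).add
      ((moderate_stft hθ u).comp_mul_comp hθ hSmod hS0 _ _ norm_leftPhase_le norm_rightPhase_le)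
  · set a := leftPhase ι p
    set b := rightPhase ι p
    have e : stft (un n) a * stft (vn n) b - stft u a * stft v b =
        (stft (un n) a - stft u a) * (stft v b + (stft (vn n) b - stft v b)) +
          stft u a * (stft (vn n) b - stft v b) := by ring
    rw [e]
    refine (norm_add_le _ _).trans (add_le_add ?_ ?_)
    · rw [norm_mul]
      exact mul_le_mul (hR n a) ((norm_add_le _ _).trans (add_le_add_right (hS n b) _))
        (norm_nonneg _) (hR0 a)
    · rw [norm_mul]
      exact mul_le_mul_of_nonneg_left (hS n b) (norm_nonneg _)
  · exact (decayAt_left_mul_right hθ hR0 hvS hRmod mvS hRd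
      (fun q hq hqΓ => (dv q hq hqΓ).add (hSd q hq hqΓ)) p hp hpΓ).add
      (decayAt_left_mul_right hθ (fun p => norm_nonneg _) hS0 (moderate_stft hθ u) hSmod du hSd
        p hp hpΓ)

/-! ### Functions as ultradistributions -/

theorem measurePreserving_flip :
    MeasurePreserving (fun p : Phase ι => ((p.1, -p.2) : Phase ι)) volume volume :=
  (MeasurePreserving.id (volume : Measure (Conf ι))).prod
    (Measure.measurePreserving_neg (volume : Measure (Conf ι)))

/-- Conjugating an atom reverses its frequency; this symmetry exchanges atoms and conjugate atoms in
the inversion formula. -/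
theorem integral_flip (f : Phase ι → ℂ) : ∫ p : Phase ι, f (p.1, -p.2) = ∫ p, f p := by
  have h : MeasurePreserving
      ((MeasurableEquiv.refl (Conf ι)).prodCongr (MeasurableEquiv.neg (Conf ι))) volume volume :=
    measurePreserving_flip
  exact h.integral_comp' f

theorem norm_flip (p : Phase ι) : ‖((p.1, -p.2) : Phase ι)‖ = ‖p‖ := by
  rw [Prod.norm_def, Prod.norm_def, norm_neg]

theorem integrable_mul_of_norm_le_one {α β : Type*} [MeasurableSpace α] [MeasurableSpace β]
    {μ : Measure α} {ν : Measure β} [SFinite μ] [SFinite ν] {G : α → ℂ} {H : β → ℂ}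
    {k : α × β → ℂ} (hG : Integrable G μ) (hH : Integrable H ν)
    (hk : AEStronglyMeasurable k (μ.prod ν)) (h : ∀ r, ‖k r‖ ≤ 1) :
    Integrable (fun r : α × β => G r.1 * H r.2 * k r) (μ.prod ν) :=
  (hG.mul_prod hH).mul_bdd (c := 1) hk (Filter.Eventually.of_forall h)

/-- The inversion formula in terms of the conjugate atoms. -/
theorem eq_integral_conj_gaborAtom {θ : ℝ} (hθ : Admissible θ) {f : Conf ι → ℂ} (hf : f ∈ GS θ ι)
    (y : Conf ι) : f y = (synthConst ι : ℂ) * ∫ p, (∫ z, f z * gaborAtom p z) *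
      starRingEnd ℂ (gaborAtom p y) := by
  rw [eq_synth_coeff hθ hf y, synth, ← integral_flip]
  congr 1
  refine integral_congr_ae (Filter.Eventually.of_forall fun p => ?_)
  simp only [coeff, conj_gaborAtom, neg_neg]

theorem IsFunction.stft_eq {θ : ℝ} (hθ : Admissible θ) {u : GSDual θ ι} {F : Conf ι → ℂ}
    (h : IsFunction u F) (p : Phase ι) : stft u p = ∫ y, F y * gaborAtom p y := by
  rw [GelfandShilov.stft_eq hθ]
  exact h _

theorem IsFunction.eq {θ : ℝ} {u v : GSDual θ ι} {F : Conf ι → ℂ} (hu : IsFunction u F)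
    (hv : IsFunction v F) : u = v :=
  Subtype.ext (LinearMap.ext fun f => (hu f).trans (hv f).symm)

/-- Inserting the integral for `W` and exchanging the order leaves the inversion formula for the
test function. -/
theorem isFunction_ofModel_of_eq {θ : ℝ} (hθ : Admissible θ) {W : Phase ι → ℂ} (hW : IsModel θ W)
    {H : Conf ι → ℂ} (hH : Integrable H) (h : ∀ q, W q = ∫ y, H y * gaborAtom q y) :
    IsFunction (ofModel hθ hW) H := by
  intro f
  obtain ⟨ε, hε, K, -, hK⟩ := exists_norm_coeff_le hθ f.2
  have hc : Integrable (coeff (f : Conf ι → ℂ)) := integrable_of_norm_le_exp hθ hε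
    (measurable_coeff (continuous_of_mem f.2)).aestronglyMeasurable hK
  have hi := integrable_mul_of_norm_le_one hc hH
    (k := fun r : Phase ι × Conf ι => gaborAtom r.1 r.2)
    continuous_gaborAtom.aestronglyMeasurable fun r => norm_gaborAtom_le_one _ _
  rw [ofModel_apply]
  calc (synthConst ι : ℂ) * ∫ p, coeff (f : Conf ι → ℂ) p * W p
      = (synthConst ι : ℂ) * ∫ p, ∫ y, coeff (f : Conf ι → ℂ) p * H y * gaborAtom p y := by
        simp only [h, mul_assoc, integral_const_mul]
    _ = (synthConst ι : ℂ) * ∫ y, ∫ p, coeff (f : Conf ι → ℂ) p * H y * gaborAtom p y := by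
        rw [integral_integral_swap hi]
    _ = ∫ y, H y * (f : Conf ι → ℂ) y := by
        rw [← integral_const_mul]
        refine integral_congr_ae (Filter.Eventually.of_forall fun y => ?_)
        simp only []
        rw [eq_synth_coeff hθ f.2 y, synth, mul_left_comm, ← integral_const_mul (H y)]
        congr 2
        funext p
        ring

/-- The function is the superposition of conjugate atoms with coefficients `W`, that is, `synth` of
the flipped model; the decay of `W` places it in `S_θ`. -/
theorem isFunction_ofModel_of_norm_le {θ : ℝ} (hθ : Admissible θ) {W : Phase ι → ℂ}
    (hW : IsModel θ W) {ε K : ℝ} (hε : 0 < ε)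
    (h : ∀ p, ‖W p‖ ≤ K * Real.exp (-ε * ‖p‖ ^ (1 / θ))) :
    ∃ F ∈ GS θ ι, IsFunction (ofModel hθ hW) F := by
  have hWi : Integrable W := integrable_of_norm_le_exp hθ hε hW.measurable.aestronglyMeasurable h
  have hm : Measurable fun p : Phase ι => W (p.1, -p.2) :=
    hW.measurable.comp measurePreserving_flip.measurable
  have hb := integrable_mul_exp_of_norm_le_exp (μ := (volume : Measure (Phase ι)))
    (G := fun p : Phase ι => W (p.1, -p.2)) (ε := ε) (ε' := ε / 2) hθ (by linarith)
    hm.aestronglyMeasurable fun p => by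
      have := h (p.1, -p.2)
      rwa [norm_flip] at this
  refine ⟨(synthConst ι : ℂ) • synth fun p : Phase ι => W (p.1, -p.2),
    (GS θ ι).smul_mem _ (synth_mem hθ (by positivity : 0 < ε / 2) hm.aestronglyMeasurable hb),
    fun f => ?_⟩
  have hi := integrable_mul_of_norm_le_one hWi (integrable_of_mem hθ f.2)
    (k := fun r : Phase ι × Conf ι => starRingEnd ℂ (gaborAtom r.1 r.2))
    (Complex.continuous_conj.comp continuous_gaborAtom).aestronglyMeasurable fun r => by
      rw [RCLike.norm_conj]
      exact norm_gaborAtom_le_one _ _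
  rw [ofModel_apply]
  calc (synthConst ι : ℂ) * ∫ p, coeff (f : Conf ι → ℂ) p * W p
      = (synthConst ι : ℂ) * ∫ p, ∫ y, W p * (f : Conf ι → ℂ) y *
          starRingEnd ℂ (gaborAtom p y) := by
        congr 1
        refine integral_congr_ae (Filter.Eventually.of_forall fun p => ?_)
        simp only [mul_assoc, integral_const_mul]
        rw [coeff, mul_comm]
    _ = (synthConst ι : ℂ) * ∫ y, ∫ p, W p * (f : Conf ι → ℂ) y *
          starRingEnd ℂ (gaborAtom p y) := by
        rw [integral_integral_swap hi]
    _ = _ := by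
        rw [← integral_const_mul]
        refine integral_congr_ae (Filter.Eventually.of_forall fun y => ?_)
        simp only [Pi.smul_apply, smul_eq_mul]
        rw [synth, mul_assoc, ← integral_mul_const]
        rw [← integral_flip]
        congr 2
        funext p
        rw [conj_gaborAtom, neg_neg]
        ring

/-! ### The kernel of the pull-back to the diagonal -/

/-- The Gabor matrix of the pull-back to the diagonal. -/
def diagKernel (p : Phase (ι ⊕ ι)) (q : Phase ι) : ℂ :=
  ∫ y : Conf ι, starRingEnd ℂ (gaborAtom p (pair y y)) * gaborAtom q y

/-- `((x₁, x₂), (ξ₁, ξ₂)) ↦ (x₁, x₂, ξ₁ + ξ₂)`. -/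
def diagSource (ι : Type) [Fintype ι] : Phase (ι ⊕ ι) →L[ℝ] Conf ι × Conf ι × Conf ι :=
  (leftConf ι ∘L ContinuousLinearMap.fst ℝ _ _).prod
    ((rightConf ι ∘L ContinuousLinearMap.fst ℝ _ _).prod
      ((leftConf ι + rightConf ι) ∘L ContinuousLinearMap.snd ℝ _ _))

/-- `(x, ξ) ↦ (x, x, ξ)`. -/
def diagTarget (ι : Type) [Fintype ι] : Phase ι →L[ℝ] Conf ι × Conf ι × Conf ι :=
  (ContinuousLinearMap.fst ℝ _ _).prod
    ((ContinuousLinearMap.fst ℝ _ _).prod (ContinuousLinearMap.snd ℝ _ _))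

theorem diagSource_apply (p : Phase (ι ⊕ ι)) : diagSource ι p =
    (leftConf ι p.1, rightConf ι p.1, leftConf ι p.2 + rightConf ι p.2) := rfl

theorem diagTarget_apply (q : Phase ι) : diagTarget ι q = (q.1, q.1, q.2) := rfl

theorem continuous_pair_self : Continuous fun y : Conf ι => pair y y := by
  refine (PiLp.continuous_toLp 2 _).comp (continuous_pi fun i => ?_)
  rcases i with i | i
  · exact (by fun_prop : Continuous fun y : Conf ι => y i)
  · exact (by fun_prop : Continuous fun y : Conf ι => y i)

theorem three_point_identity (y a b c : Conf ι) :
    ‖y - a‖ ^ 2 / 2 + ‖y - b‖ ^ 2 / 2 + ‖y - c‖ ^ 2 / 2 =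
      3 / 2 * ‖y - (1 / 3 : ℝ) • (a + b + c)‖ ^ 2 +
        (‖a - b‖ ^ 2 + ‖a - c‖ ^ 2 + ‖b - c‖ ^ 2) / 6 := by
  simp only [EuclideanSpace.norm_sq_eq, Finset.sum_div, Finset.mul_sum, ← Finset.sum_add_distrib]
  refine Finset.sum_congr rfl fun i _ => ?_
  simp only [PiLp.sub_apply, PiLp.smul_apply, PiLp.add_apply, smul_eq_mul, Real.norm_eq_abs,
    sq_abs]
  ring

theorem norm_sq_le_of_triple (a b c : Conf ι) :
    ‖(a, b, c)‖ ^ 2 ≤ ‖a‖ ^ 2 + ‖b‖ ^ 2 + ‖c‖ ^ 2 := by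
  rw [Prod.norm_def, Prod.norm_def]
  have ha := sq_nonneg ‖a‖
  have hb := sq_nonneg ‖b‖
  have hc := sq_nonneg ‖c‖
  rcases max_choice ‖a‖ (max ‖b‖ ‖c‖) with h | h
  · simp only [h]
    linarith
  · simp only [h]
    rcases max_choice ‖b‖ ‖c‖ with h' | h'
    · rw [h']
      linarith
    · rw [h']
      linarith

/-- The constant in the bound for `diagKernel`. -/
def diagConst (ι : Type) [Fintype ι] : ℝ := (Real.pi / (3 / 2)) ^ ((Fintype.card ι : ℝ) / 2)

theorem diagConst_pos : 0 < diagConst ι := by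
  unfold diagConst
  positivity

/-- Three windows at `x₁`, `x₂`, `x` multiply to one Gaussian in `y`, oscillating with frequency `ξ₁
+ ξ₂ - ξ`; its integral decays in this frequency and in the distances of the centres. -/
theorem norm_diagKernel_le (p : Phase (ι ⊕ ι)) (q : Phase ι) :
    ‖diagKernel p q‖ ≤ diagConst ι *
      Real.exp (-(1 / 6) * ‖diagSource ι p - diagTarget ι q‖ ^ 2) := by
  set a := leftConf ι p.1 with ha
  set b := rightConf ι p.1 with hb
  set η := leftConf ι p.2 + rightConf ι p.2 - q.2 with hη
  set S := (‖a - b‖ ^ 2 + ‖a - q.1‖ ^ 2 + ‖b - q.1‖ ^ 2) / 6 with hS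
  have e : ∀ y : Conf ι, starRingEnd ℂ (gaborAtom p (pair y y)) * gaborAtom q y =
      ((Real.exp (-S) : ℝ) : ℂ) * Complex.exp (-((3 / 2 * ‖y - (1 / 3 : ℝ) • (a + b + q.1)‖ ^ 2 : ℝ)
        : ℂ) + Complex.I * ((inner ℝ η y : ℝ) : ℂ)) := fun y => by
    rw [gaborAtom_left_right, map_mul, conj_gaborAtom, conj_gaborAtom, gaborAtom, gaborAtom,
      gaborAtom, ← Complex.exp_add, ← Complex.exp_add, Complex.ofReal_exp, ← Complex.exp_add]
    congr 1
    have h1 := three_point_identity y a b q.1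
    have h2 : (inner ℝ η y : ℝ) = inner ℝ (leftConf ι p.2) y + inner ℝ (rightConf ι p.2) y -
        inner ℝ q.2 y := by rw [hη, inner_sub_left, inner_add_left]
    have h3 : (3 / 2 * ‖y - (1 / 3 : ℝ) • (a + b + q.1)‖ ^ 2 : ℝ) =
      ‖y - a‖ ^ 2 / 2 + ‖y - b‖ ^ 2 / 2 + ‖y - q.1‖ ^ 2 / 2 - S := by
        rw [h1, hS]
        ring
    rw [h2, h3]
    simp only [leftPhase_apply, rightPhase_apply, leftConf_pair, rightConf_pair, inner_neg_left,
      ← ha, ← hb]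
    push_cast
    ring
  rw [diagKernel]
  simp only [e]
  rw [integral_const_mul, norm_mul, norm_integral_gaussian (by norm_num), Complex.norm_real,
    Real.norm_of_nonneg (Real.exp_pos _).le, mul_left_comm, ← Real.exp_add]
  refine mul_le_mul_of_nonneg_left (Real.exp_le_exp.2 ?_) diagConst_pos.le
  have h1 : diagSource ι p - diagTarget ι q = (a - q.1, b - q.1, η) := rfl
  have h2 := norm_sq_le_of_triple (a - q.1) (b - q.1) η
  rw [h1, hS]
  have h3 := sq_nonneg ‖a - b‖
  rw [show (4 * (3 / 2) : ℝ) = 6 by norm_num]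
  linarith

theorem continuous_diagIntegrand :
    Continuous fun r : (Phase (ι ⊕ ι) × Phase ι) × Conf ι =>
      starRingEnd ℂ (gaborAtom r.1.1 (pair r.2 r.2)) * gaborAtom r.1.2 r.2 := by
  refine (Complex.continuous_conj.comp ?_).mul ?_
  · exact Continuous.comp (g := fun q : Phase (ι ⊕ ι) × Conf (ι ⊕ ι) => gaborAtom q.1 q.2)
      (f := fun r : (Phase (ι ⊕ ι) × Phase ι) × Conf ι => (r.1.1, pair r.2 r.2))
      continuous_gaborAtom ((continuous_fst.comp continuous_fst).prodMk
        (continuous_pair_self.comp continuous_snd))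
  · exact Continuous.comp (g := fun q : Phase ι × Conf ι => gaborAtom q.1 q.2)
      (f := fun r : (Phase (ι ⊕ ι) × Phase ι) × Conf ι => (r.1.2, r.2))
      continuous_gaborAtom ((continuous_snd.comp continuous_fst).prodMk continuous_snd)

theorem measurable_diagKernel :
    Measurable fun r : Phase (ι ⊕ ι) × Phase ι => diagKernel r.1 r.2 :=
  (continuous_diagIntegrand.stronglyMeasurable.integral_prod_right
    (ν := (volume : Measure (Conf ι)))).measurable

/-- The Gabor coefficients of the pull-back to the diagonal. -/
def diagModel (W : Phase (ι ⊕ ι) → ℂ) (q : Phase ι) : ℂ :=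
  (synthConst (ι ⊕ ι) : ℂ) * ∫ p, W p * diagKernel p q

/-- Decay along the conormal bundle of the diagonal, i.e. at the points `(0, (ξ, -ξ))`. -/
def DiagRegular (θ : ℝ) (N : Phase (ι ⊕ ι) → ℝ) : Prop :=
  ∀ p, p ≠ 0 → diagSource ι p = 0 → DecayAt θ N p

/-! ### Majorants and decay for the pull-back to the diagonal -/

section Model

variable {θ : ℝ} {W : Phase (ι ⊕ ι) → ℂ} {R : Phase (ι ⊕ ι) → ℝ}

/-- The Gaussian majorant of the pull-back to the diagonal. -/
def diagBound (R : Phase (ι ⊕ ι) → ℝ) (q : Phase ι) : ℝ :=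
  synthConst (ι ⊕ ι) * diagConst ι *
    ∫ p, R p * Real.exp (-(1 / 6) * ‖diagSource ι p - diagTarget ι q‖ ^ 2)

theorem integrable_diagBound (hθ : Admissible θ) (hm : Measurable R) (hR0 : ∀ p, 0 ≤ R p)
    (hR : Moderate θ R) (hd : DiagRegular θ R) (q : Phase ι) :
    Integrable fun p => R p * Real.exp (-(1 / 6) * ‖diagSource ι p - diagTarget ι q‖ ^ 2) :=
  integrable_kernel (diagSource ι) (diagTarget ι) volume hθ hR0 hR hm (by norm_num) hd q

theorem norm_mul_diagKernel_le (h : ∀ p, ‖W p‖ ≤ R p) (p : Phase (ι ⊕ ι)) (q : Phase ι) :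
    ‖W p * diagKernel p q‖ ≤ diagConst ι *
      (R p * Real.exp (-(1 / 6) * ‖diagSource ι p - diagTarget ι q‖ ^ 2)) := by
  rw [norm_mul, mul_left_comm]
  exact mul_le_mul (h p) (norm_diagKernel_le p q) (norm_nonneg _) ((norm_nonneg _).trans (h p))

theorem measurable_mul_diagKernel (hW : Measurable W) (q : Phase ι) :
    Measurable fun p => W p * diagKernel p q :=
  hW.mul (Measurable.comp (g := fun r : Phase (ι ⊕ ι) × Phase ι => diagKernel r.1 r.2)
    (f := fun p => (p, q)) measurable_diagKernel (measurable_id.prodMk measurable_const))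

theorem integrable_mul_diagKernel (hθ : Admissible θ) (hW : IsModel θ W)
    (hd : DiagRegular θ fun p => ‖W p‖) (q : Phase ι) :
    Integrable fun p => W p * diagKernel p q :=
  ((integrable_diagBound hθ hW.measurable.norm (fun _ => norm_nonneg _) hW.moderate hd q).const_mul
    (diagConst ι)).mono' (measurable_mul_diagKernel hW.measurable q).aestronglyMeasurable
    (Filter.Eventually.of_forall fun p => norm_mul_diagKernel_le (fun _ => le_rfl) p q)

theorem norm_diagModel_le (hθ : Admissible θ) (hm : Measurable R)
    (hR : Moderate θ R) (hd : DiagRegular θ R) (h : ∀ p, ‖W p‖ ≤ R p) (q : Phase ι) :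
    ‖diagModel W q‖ ≤ diagBound R q := by
  have hR0 : ∀ p, 0 ≤ R p := fun p => (norm_nonneg _).trans (h p)
  rw [diagModel, diagBound, norm_mul, Complex.norm_real, Real.norm_of_nonneg synthConst_pos.le,
    mul_assoc, ← integral_const_mul]
  exact mul_le_mul_of_nonneg_left (norm_integral_le_of_norm_le
    ((integrable_diagBound hθ hm hR0 hR hd q).const_mul _)
    (Filter.Eventually.of_forall fun p => norm_mul_diagKernel_le h p q)) synthConst_pos.le

theorem diagBound_const_nonneg : 0 ≤ synthConst (ι ⊕ ι) * diagConst ι :=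
  mul_nonneg synthConst_pos.le diagConst_pos.le

theorem Moderate.const_mul {E : Type*} [NormedAddCommGroup E] {N : E → ℝ} (h : Moderate θ N)
    {c : ℝ} (hc : 0 ≤ c) : Moderate θ fun p => c * N p := by
  intro ε hε
  obtain ⟨K, hK, hb⟩ := h ε hε
  refine ⟨c * K, by positivity, fun p => ?_⟩
  rw [mul_assoc]
  exact mul_le_mul_of_nonneg_left (hb p) hc

theorem Moderate.mono {E : Type*} [NormedAddCommGroup E] {N N' : E → ℝ} (h : Moderate θ N)
    (hN : ∀ p, N' p ≤ N p) : Moderate θ N' := by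
  intro ε hε
  obtain ⟨K, hK, hb⟩ := h ε hε
  exact ⟨K, hK, fun p => (hN p).trans (hb p)⟩

theorem moderate_diagBound (hθ : Admissible θ) (hm : Measurable R) (hR0 : ∀ p, 0 ≤ R p)
    (hR : Moderate θ R) (hd : DiagRegular θ R) : Moderate θ (diagBound R) :=
  (moderate_integral_kernel (diagSource ι) (diagTarget ι) volume hθ hR0 hR hm (by norm_num)
    hd).const_mul diagBound_const_nonneg

theorem measurable_diagBound (hm : Measurable R) : Measurable (diagBound R) := by
  have h : Measurable fun r : Phase ι × Phase (ι ⊕ ι) =>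
      R r.2 * Real.exp (-(1 / 6) * ‖diagSource ι r.2 - diagTarget ι r.1‖ ^ 2) :=
    (hm.comp measurable_snd).mul (by fun_prop : Continuous fun r : Phase ι × Phase (ι ⊕ ι) =>
      Real.exp (-(1 / 6) * ‖diagSource ι r.2 - diagTarget ι r.1‖ ^ 2)).measurable
  exact (h.stronglyMeasurable.integral_prod_right
    (ν := (volume : Measure (Phase (ι ⊕ ι))))).measurable.const_mul _

theorem measurable_diagModel (hW : Measurable W) : Measurable (diagModel W) := by
  have h : Measurable fun r : Phase ι × Phase (ι ⊕ ι) => W r.2 * diagKernel r.2 r.1 :=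
    (hW.comp measurable_snd).mul (Measurable.comp
      (g := fun r : Phase (ι ⊕ ι) × Phase ι => diagKernel r.1 r.2)
      (f := fun r : Phase ι × Phase (ι ⊕ ι) => (r.2, r.1)) measurable_diagKernel measurable_swap)
  exact (h.stronglyMeasurable.integral_prod_right
    (ν := (volume : Measure (Phase (ι ⊕ ι))))).measurable.const_mul _

theorem isModel_diagModel (hθ : Admissible θ) (hW : IsModel θ W)
    (hd : DiagRegular θ fun p => ‖W p‖) : IsModel θ (diagModel W) :=
  ⟨measurable_diagModel hW.measurable,
    (moderate_diagBound hθ hW.measurable.norm (fun _ => norm_nonneg _) hW.moderate hd).mono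
      (norm_diagModel_le hθ hW.measurable.norm hW.moderate hd fun _ => le_rfl)⟩

/-- `Γ` contains no conormal point of the diagonal. -/
def DiagTransversal (Γ : Set (Phase (ι ⊕ ι))) : Prop :=
  ∀ ξ η : Conf ι, ξ + η = 0 → (0, pair ξ η) ∉ Γ

theorem DiagTransversal.diagRegular {Γ : Set (Phase (ι ⊕ ι))} (hΓ : DiagTransversal Γ)
    (h : ∀ p, p ≠ 0 → p ∉ Γ → DecayAt θ R p) : DiagRegular θ R := by
  intro p hp h0
  refine h p hp ?_
  rw [diagSource_apply, Prod.mk_eq_zero, Prod.mk_eq_zero] at h0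
  have e : p = (0, pair (leftConf ι p.2) (rightConf ι p.2)) := by
    refine Prod.ext ?_ (pair_left_right _).symm
    rw [← pair_left_right p.1, h0.1, h0.2.1]
    ext (i | i) <;> rfl
  rw [e]
  exact hΓ _ _ h0.2.2

/-- The fibre of `diagSource` over `diagTarget (x, ξ)` consists of the points `((x, x), (ξ₁, ξ₂))`
with `ξ₁ + ξ₂ = ξ`. One of them in `Γ` would put `(x, ξ)` into `diagCone Γ`, so `R` decays on the
whole fibre. -/
theorem decayAt_diagBound (hθ : Admissible θ) {Γ : Set (Phase (ι ⊕ ι))} (hΓ : DiagTransversal Γ)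
    (hm : Measurable R) (hR0 : ∀ p, 0 ≤ R p) (hR : Moderate θ R)
    (h : ∀ p, p ≠ 0 → p ∉ Γ → DecayAt θ R p) (q : Phase ι) (hq : q ≠ 0)
    (hqΓ : q ∉ diagCone Γ) : DecayAt θ (diagBound R) q := by
  have hq' : diagTarget ι q ≠ 0 := by
    rw [diagTarget_apply]
    intro h0
    rw [Prod.mk_eq_zero, Prod.mk_eq_zero] at h0
    exact hq (Prod.ext h0.1 h0.2.2)
  refine (decayAt_integral_kernel (diagSource ι) (diagTarget ι) volume hθ hR0 hR hm (by norm_num)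
    (hΓ.diagRegular h) hq' fun p hp => h p ?_ fun hpΓ => hqΓ ?_).const_mul diagBound_const_nonneg
  · rintro rfl
    rw [map_zero] at hp
    exact hq' hp.symm
  · rw [diagSource_apply, diagTarget_apply, Prod.mk.injEq, Prod.mk.injEq] at hp
    refine ⟨q.1, leftConf ι p.2, rightConf ι p.2, ?_, Prod.ext rfl hp.2.2.symm⟩
    have e : p = (pair q.1 q.1, pair (leftConf ι p.2) (rightConf ι p.2)) := by
      refine Prod.ext ?_ (pair_left_right _).symm
      conv_lhs => rw [← pair_left_right p.1, hp.1, hp.2.1]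
    rwa [e] at hpΓ

end Model

/-! ### The pull-back to the diagonal -/

open Classical in
/-- The pull-back to the diagonal. -/
def diagPullback {θ : ℝ} (hθ : Admissible θ) (t : GSDual θ (ι ⊕ ι)) : GSDual θ ι :=
  if h : DiagRegular θ fun p => ‖stft t p‖ then
    ofModel hθ (isModel_diagModel hθ (isModel_stft hθ t) h)
  -- This value is never met on `S'_{θ,Γ}` for transversal `Γ`; one total map makes the pull-back
  -- visibly independent of `Γ`.
  else 0

section Pullback

variable {θ : ℝ} {Γ : Set (Phase (ι ⊕ ι))}

theorem diagRegular_stft (hθ : Admissible θ) (hΓ : DiagTransversal Γ) {t : GSDual θ (ι ⊕ ι)}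
    (ht : t ∈ DualWF θ Γ) : DiagRegular θ fun p => ‖stft t p‖ :=
  hΓ.diagRegular ((mem_DualWF_iff hθ t Γ).1 ht)

theorem diagPullback_eq (hθ : Admissible θ) {t : GSDual θ (ι ⊕ ι)}
    (h : DiagRegular θ fun p => ‖stft t p‖) :
    diagPullback hθ t = ofModel hθ (isModel_diagModel hθ (isModel_stft hθ t) h) := dif_pos h

theorem decayAt_diagModel_stft (hθ : Admissible θ) (hΓ : DiagTransversal Γ)
    {t : GSDual θ (ι ⊕ ι)} (ht : t ∈ DualWF θ Γ) (q : Phase ι) (hq : q ≠ 0)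
    (hqΓ : q ∉ diagCone Γ) : DecayAt θ (fun q => ‖diagModel (stft t) q‖) q := by
  have hm := (measurable_stft hθ t).norm
  exact (decayAt_diagBound hθ hΓ hm (fun _ => norm_nonneg _) (moderate_stft hθ t)
    ((mem_DualWF_iff hθ t Γ).1 ht) q hq hqΓ).mono
      (norm_diagModel_le hθ hm (moderate_stft hθ t) (diagRegular_stft hθ hΓ ht) fun _ => le_rfl)

theorem diagPullback_mem (hθ : Admissible θ) (hΓ : DiagTransversal Γ) {t : GSDual θ (ι ⊕ ι)}
    (ht : t ∈ DualWF θ Γ) : diagPullback hθ t ∈ DualWF θ (diagCone Γ) := by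
  rw [diagPullback_eq hθ (diagRegular_stft hθ hΓ ht)]
  exact ofModel_mem_DualWF hθ _ (decayAt_diagModel_stft hθ hΓ ht)

theorem diagModel_sub (hθ : Admissible θ) {W V : Phase (ι ⊕ ι) → ℂ} (hW : IsModel θ W)
    (hV : IsModel θ V) (dW : DiagRegular θ fun p => ‖W p‖) (dV : DiagRegular θ fun p => ‖V p‖)
    (q : Phase ι) : diagModel W q - diagModel V q = diagModel (fun p => W p - V p) q := by
  rw [diagModel, diagModel, diagModel, ← mul_sub, ← integral_sub
    (integrable_mul_diagKernel hθ hW dW q) (integrable_mul_diagKernel hθ hV dV q)]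
  simp only [sub_mul]

theorem tendsto_diagModel (hθ : Admissible θ) (hΓ : DiagTransversal Γ)
    {Wn : ℕ → Phase (ι ⊕ ι) → ℂ} {W : Phase (ι ⊕ ι) → ℂ} (hWn : ∀ n, IsModel θ (Wn n))
    (hW : IsModel θ W) (dW : DiagRegular θ fun p => ‖W p‖) (h : ModelTendsto θ Γ Wn W)
    (q : Phase ι) :
    Filter.Tendsto (fun n => diagModel (Wn n) q) Filter.atTop (𝓝 (diagModel W q)) := by
  obtain ⟨R, hRm, hR0, hRmod, hR, hRd⟩ := h.bound
  have hRr := hΓ.diagRegular hRd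
  refine (tendsto_integral_of_dominated_convergence (fun p => diagConst ι *
      ((‖W p‖ + R p) * Real.exp (-(1 / 6) * ‖diagSource ι p - diagTarget ι q‖ ^ 2)))
    (fun n => (measurable_mul_diagKernel (hWn n).measurable q).aestronglyMeasurable)
    ((integrable_diagBound hθ (hW.measurable.norm.add hRm)
      (fun p => add_nonneg (norm_nonneg _) (hR0 p)) (hW.moderate.add hRmod)
      (fun p hp h0 => (dW p hp h0).add (hRr p hp h0)) q).const_mul _)
    (fun n => Filter.Eventually.of_forall fun p => norm_mul_diagKernel_le (W := Wn n)
      (R := fun p => ‖W p‖ + R p) (fun p => ?_) p q)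
    (Filter.Eventually.of_forall fun p => (h.tendsto p).mul_const _)).const_mul _
  calc ‖Wn n p‖ = ‖W p + (Wn n p - W p)‖ := by rw [add_sub_cancel]
    _ ≤ _ := (norm_add_le _ _).trans (add_le_add_right (hR n p) _)

/-- By linearity of `diagModel`, `diagBound` of a majorant for the differences is a majorant for the
differences of the pull-backs. -/
theorem tendstoWF_diagPullback (hθ : Admissible θ) (hΓ : DiagTransversal Γ)
    {tn : ℕ → GSDual θ (ι ⊕ ι)} {t : GSDual θ (ι ⊕ ι)} (h : TendstoWF Γ tn t) :
    TendstoWF (diagCone Γ) (fun n => diagPullback hθ (tn n)) (diagPullback hθ t) := by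
  have hn := fun n => diagRegular_stft hθ hΓ (h.1 n)
  have ht := diagRegular_stft hθ hΓ h.2.1
  have hmt := h.modelTendsto hθ
  have e : (fun n => diagPullback hθ (tn n)) = fun n =>
      ofModel hθ (isModel_diagModel hθ (isModel_stft hθ (tn n)) (hn n)) :=
    funext fun n => diagPullback_eq hθ (hn n)
  rw [e, diagPullback_eq hθ ht]
  refine tendstoWF_ofModel hθ _ _ (decayAt_diagModel_stft hθ hΓ h.2.1)
    ⟨tendsto_diagModel hθ hΓ (fun n => isModel_stft hθ (tn n)) (isModel_stft hθ t) ht hmt, ?_⟩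
  obtain ⟨R, hRm, hR0, hRmod, hR, hRd⟩ := hmt.bound
  have hRr := hΓ.diagRegular hRd
  refine ⟨diagBound R, measurable_diagBound hRm, fun q => ?_,
    moderate_diagBound hθ hRm hR0 hRmod hRr, fun n q => ?_,
    decayAt_diagBound hθ hΓ hRm hR0 hRmod hRd⟩
  · exact mul_nonneg diagBound_const_nonneg
      (integral_nonneg fun p => mul_nonneg (hR0 p) (Real.exp_pos _).le)
  · rw [diagModel_sub hθ (isModel_stft hθ _) (isModel_stft hθ _) (hn n) ht]
    exact norm_diagModel_le hθ hRm hRmod hRr (hR n) q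

theorem norm_le_norm_pair_self (y : Conf ι) : ‖y‖ ≤ ‖pair y y‖ := norm_leftConf_le (pair y y)

theorem integrable_comp_pair_self (hθ : Admissible θ) {F : Conf (ι ⊕ ι) → ℂ}
    (hF : F ∈ GS θ (ι ⊕ ι)) : Integrable fun y : Conf ι => F (pair y y) := by
  obtain ⟨ε, hε, K, hK, hb⟩ := exists_norm_le_of_mem hθ hF
  refine integrable_of_norm_le_exp (K := K) hθ hε
    ((continuous_of_mem hF).comp continuous_pair_self).aestronglyMeasurable fun y => ?_
  refine (hb _).trans (mul_le_mul_of_nonneg_left (Real.exp_le_exp.2 ?_) hK)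
  have := Real.rpow_le_rpow (norm_nonneg y) (norm_le_norm_pair_self y) hθ.inv_nonneg
  nlinarith

/-- After Fubini the inner integral is the inversion formula for `F` at the diagonal point `(y, y)`.
-/
theorem diagModel_of_mem (hθ : Admissible θ) {F : Conf (ι ⊕ ι) → ℂ} (hF : F ∈ GS θ (ι ⊕ ι))
    (q : Phase ι) : diagModel (fun p => ∫ z, F z * gaborAtom p z) q =
      ∫ y, F (pair y y) * gaborAtom q y := by
  set G : Phase (ι ⊕ ι) → ℂ := fun p => ∫ z, F z * gaborAtom p z with hG
  have hGc : ∀ p, G p = coeff F (p.1, -p.2) := fun p => by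
    simp only [hG, coeff, conj_gaborAtom, neg_neg]
  have hGi : Integrable G := by
    obtain ⟨ε, hε, K, -, hb⟩ := exists_norm_coeff_le hθ hF
    have hm : Measurable fun p : Phase (ι ⊕ ι) => coeff F (p.1, -p.2) :=
      (measurable_coeff (continuous_of_mem hF)).comp measurePreserving_flip.measurable
    rw [funext hGc]
    refine integrable_of_norm_le_exp (K := K) hθ hε hm.aestronglyMeasurable fun p => ?_
    have := hb (p.1, -p.2)
    rwa [norm_flip] at this
  have hk : Continuous fun r : Phase (ι ⊕ ι) × Conf ι =>
      starRingEnd ℂ (gaborAtom r.1 (pair r.2 r.2)) :=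
    Complex.continuous_conj.comp (Continuous.comp
      (g := fun q : Phase (ι ⊕ ι) × Conf (ι ⊕ ι) => gaborAtom q.1 q.2)
      (f := fun r : Phase (ι ⊕ ι) × Conf ι => (r.1, pair r.2 r.2))
      continuous_gaborAtom (continuous_fst.prodMk (continuous_pair_self.comp continuous_snd)))
  have hi := integrable_mul_of_norm_le_one hGi (integrable_norm_gaborAtom q)
    hk.aestronglyMeasurable fun r => by
      rw [RCLike.norm_conj]
      exact norm_gaborAtom_le_one _ _
  calc diagModel G q
      = (synthConst (ι ⊕ ι) : ℂ) * ∫ p, ∫ y, G p * gaborAtom q y *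
          starRingEnd ℂ (gaborAtom p (pair y y)) := by
        rw [diagModel]
        congr 2
        funext p
        simp only [mul_assoc, integral_const_mul]
        rw [diagKernel]
        congr 2
        funext y
        ring
    _ = (synthConst (ι ⊕ ι) : ℂ) * ∫ y, ∫ p, G p * gaborAtom q y *
          starRingEnd ℂ (gaborAtom p (pair y y)) := by
        rw [integral_integral_swap hi]
    _ = _ := by
        rw [← integral_const_mul]
        refine integral_congr_ae (Filter.Eventually.of_forall fun y => ?_)
        simp only []
        rw [eq_integral_conj_gaborAtom hθ hF, mul_assoc, ← integral_mul_const]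
        congr 2
        funext p
        ring

theorem isFunction_diagPullback (hθ : Admissible θ) (hΓ : DiagTransversal Γ)
    {F : Conf (ι ⊕ ι) → ℂ} (hF : F ∈ GS θ (ι ⊕ ι)) {t : GSDual θ (ι ⊕ ι)} (ht : t ∈ DualWF θ Γ)
    (h : IsFunction t F) : IsFunction (diagPullback hθ t) fun y => F (pair y y) := by
  rw [diagPullback_eq hθ (diagRegular_stft hθ hΓ ht)]
  refine isFunction_ofModel_of_eq hθ _ (integrable_comp_pair_self hθ hF) fun q => ?_
  rw [← diagModel_of_mem hθ hF, funext (h.stft_eq hθ)]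

theorem isDiagExtension_diagPullback (hθ : Admissible θ) (hΓ : DiagTransversal Γ) :
    IsDiagExtension Γ (diagPullback hθ : GSDual θ (ι ⊕ ι) → GSDual θ ι) :=
  ⟨fun _ ht => diagPullback_mem hθ hΓ ht, fun _ _ h => tendstoWF_diagPullback hθ hΓ h,
    fun _ hF _ ht h => isFunction_diagPullback hθ hΓ hF ht h⟩

end Pullback

/-- Every element of `S'_{θ,Γ}` is a limit in `S'_{θ,Γ}` of elements of `S_θ`. -/
theorem exists_tendstoWF_isFunction {θ : ℝ} (hθ : Admissible θ) {Γ : Set (Phase ι)}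
    {t : GSDual θ ι} (ht : t ∈ DualWF θ Γ) :
    ∃ tn : ℕ → GSDual θ ι, TendstoWF Γ tn t ∧ ∀ n, ∃ F ∈ GS θ ι, IsFunction (tn n) F := by
  -- Cutting off in phase space keeps `‖stft t‖` as a majorant of the truncations and of the errors;
  -- it decays off `Γ`, so no decay is lost.
  set Wn : ℕ → Phase ι → ℂ := fun n => (Metric.closedBall (0 : Phase ι) n).indicator (stft t)
    with hWn
  have hle : ∀ n p, ‖Wn n p‖ ≤ ‖stft t p‖ := fun n p => norm_indicator_le_norm_self _ _
  have hmod : ∀ n, IsModel θ (Wn n) := fun n =>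
    ⟨(measurable_stft hθ t).indicator Metric.isClosed_closedBall.measurableSet,
      (moderate_stft hθ t).mono (hle n)⟩
  refine ⟨fun n => ofModel hθ (hmod n), ?_, fun n => ?_⟩
  · have h := tendstoWF_ofModel hθ hmod (isModel_stft hθ t) ((mem_DualWF_iff hθ t Γ).1 ht)
      ⟨fun p => ?_, fun p => ‖stft t p‖, (measurable_stft hθ t).norm, fun _ => norm_nonneg _,
        moderate_stft hθ t, fun n p => ?_, (mem_DualWF_iff hθ t Γ).1 ht⟩
    · rwa [ofModel_stft] at h
    · refine tendsto_const_nhds.congr' ?_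
      filter_upwards [Filter.eventually_ge_atTop ⌈‖p‖⌉₊] with n hn
      rw [hWn]
      refine (Set.indicator_of_mem ?_ _).symm
      rw [mem_closedBall_zero_iff]
      exact (Nat.le_ceil _).trans (by exact_mod_cast hn)
    · by_cases hp : p ∈ Metric.closedBall (0 : Phase ι) n
      · rw [hWn]
        simp only []
        rw [Set.indicator_of_mem hp, sub_self, norm_zero]
        exact norm_nonneg _
      · rw [hWn]
        simp only []
        rw [Set.indicator_of_notMem hp, zero_sub, norm_neg]
  · obtain ⟨K, hK, hb⟩ := moderate_stft hθ t 1 one_pos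
    -- On the ball of radius `n`, `exp (‖p‖ ^ (1 / θ)) ≤ exp (2 n ^ (1 / θ)) * exp (-‖p‖ ^ (1 /
    -- θ))`; outside it the model vanishes.
    refine isFunction_ofModel_of_norm_le hθ (hmod n) (ε := 1)
      (K := K * Real.exp (2 * (n : ℝ) ^ (1 / θ))) one_pos fun p => ?_
    by_cases hp : p ∈ Metric.closedBall (0 : Phase ι) n
    · refine ((hle n p).trans (hb p)).trans ?_
      rw [mul_assoc, ← Real.exp_add]
      refine mul_le_mul_of_nonneg_left (Real.exp_le_exp.2 ?_) hK
      rw [mem_closedBall_zero_iff] at hp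
      have := Real.rpow_le_rpow (norm_nonneg p) hp hθ.inv_nonneg
      linarith
    · rw [hWn]
      simp only []
      rw [Set.indicator_of_notMem hp, norm_zero]
      positivity

/-- Two continuous extensions agree on functions, which approximate `t` in `S'_{θ,Γ}`, and weak
limits are unique. The right-hand side involves neither `Γ` nor `P`, whence uniqueness over all
choices together. -/
theorem IsDiagExtension.eq_diagPullback {θ : ℝ} (hθ : Admissible θ) {Γ : Set (Phase (ι ⊕ ι))}
    (hΓ : DiagTransversal Γ) {P : GSDual θ (ι ⊕ ι) → GSDual θ ι} (hP : IsDiagExtension Γ P)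
    {t : GSDual θ (ι ⊕ ι)} (ht : t ∈ DualWF θ Γ) : P t = diagPullback hθ t := by
  obtain ⟨tn, htn, hF⟩ := exists_tendstoWF_isFunction hθ ht
  have hQ := isDiagExtension_diagPullback hθ hΓ
  have e : ∀ n, P (tn n) = diagPullback hθ (tn n) := fun n => by
    obtain ⟨F, hFm, hFn⟩ := hF n
    exact (hP.2.2 F hFm _ (htn.1 n) hFn).eq (hQ.2.2 F hFm _ (htn.1 n) hFn)
  have h1 := hP.2.1 tn t htn
  have h2 := hQ.2.1 tn t htn
  refine Subtype.ext (LinearMap.ext fun f => ?_)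
  have h3 := h1.2.2.1 f
  simp only [e] at h3
  exact tendsto_nhds_unique h3 (h2.2.2.1 f)

/-! ### Products -/

section Product

variable {θ : ℝ} {Γ₁ Γ₂ : Set (Phase ι)}

/-- The terms `Γ₁` and `Γ₂` arise from points at which the other component is the origin. -/
theorem diagCone_tensorCone_subset : diagCone (tensorCone Γ₁ Γ₂) ⊆ productCone Γ₁ Γ₂ := by
  rintro _ ⟨x, ξ, η, h, rfl⟩
  obtain ⟨h0, h1, h2⟩ := mem_tensorCone_iff.1 h
  change (x, ξ) ∈ Γ₁ ∪ {0} at h1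
  change (x, η) ∈ Γ₂ ∪ {0} at h2
  rcases h1 with h1 | h1
  · rcases h2 with h2 | h2
    · exact Or.inl (Or.inl ⟨x, ξ, η, h1, h2, rfl⟩)
    · rw [(Prod.mk_eq_zero.1 h2).2, add_zero]
      exact Or.inl (Or.inr h1)
  · rw [(Prod.mk_eq_zero.1 h1).2, zero_add]
    rcases h2 with h2 | h2
    · exact Or.inr h2
    · exact (h0 (eq_zero_of_left_right h1 h2)).elim

/-- The tensor product is unique, and so is its pull-back for every transversal cone; that cone need
not be related to `tensorCone Γ₁ Γ₂`, which only serves existence. -/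
theorem isProduct_iff (hθ : Admissible θ) (h₁ : IsClosedCone Γ₁) (h₂ : IsClosedCone Γ₂)
    (hΓ : ∀ ξ : Conf ι, (0, ξ) ∈ Γ₁ → (0, -ξ) ∉ Γ₂) {u v : GSDual θ ι} (hu : u ∈ DualWF θ Γ₁)
    (hv : v ∈ DualWF θ Γ₂) (w : GSDual θ ι) :
    IsProduct u v w ↔ w = diagPullback hθ (tensor hθ u v) := by
  constructor
  · rintro ⟨t, ht, Γ, -, hΓt, htΓ, P, hP, rfl⟩
    rw [hP.eq_diagPullback hθ hΓt htΓ, ht.eq_tensor hθ]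
  · rintro rfl
    exact ⟨_, isTensor_tensor hθ u v, tensorCone Γ₁ Γ₂, isClosedCone_tensorCone h₁ h₂,
      notMem_tensorCone hΓ, tensor_mem_DualWF hθ hu hv, _,
      isDiagExtension_diagPullback hθ (notMem_tensorCone hΓ), rfl⟩

theorem product_mem_DualWF (hθ : Admissible θ) (hΓ : ∀ ξ : Conf ι, (0, ξ) ∈ Γ₁ → (0, -ξ) ∉ Γ₂)
    {u v : GSDual θ ι} (hu : u ∈ DualWF θ Γ₁) (hv : v ∈ DualWF θ Γ₂) :
    diagPullback hθ (tensor hθ u v) ∈ DualWF θ (diagCone (tensorCone Γ₁ Γ₂)) :=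
  diagPullback_mem hθ (notMem_tensorCone hΓ) (tensor_mem_DualWF hθ hu hv)

theorem tendstoWF_product (hθ : Admissible θ) (h₁ : IsClosedCone Γ₁) (h₂ : IsClosedCone Γ₂)
    (hΓ : ∀ ξ : Conf ι, (0, ξ) ∈ Γ₁ → (0, -ξ) ∉ Γ₂) {un vn wn : ℕ → GSDual θ ι}
    {u v w : GSDual θ ι} (hu : TendstoWF Γ₁ un u) (hv : TendstoWF Γ₂ vn v)
    (hn : ∀ n, IsProduct (un n) (vn n) (wn n)) (hw : IsProduct u v w) :
    TendstoWF (diagCone (tensorCone Γ₁ Γ₂)) wn w := by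
  have e : wn = fun n => diagPullback hθ (tensor hθ (un n) (vn n)) := funext fun n =>
    (isProduct_iff hθ h₁ h₂ hΓ (hu.1 n) (hv.1 n) _).1 (hn n)
  rw [e, (isProduct_iff hθ h₁ h₂ hΓ hu.2.1 hv.2.1 _).1 hw]
  exact tendstoWF_diagPullback hθ (notMem_tensorCone hΓ) (tendstoWF_tensor hθ hu hv)

end Product

/-! ### Convergence and cones -/

theorem tendstoWF_iff {θ : ℝ} (hθ : Admissible θ) {Γ : Set (Phase ι)} {un : ℕ → GSDual θ ι}
    {u : GSDual θ ι} : TendstoWF Γ un u ↔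
      u ∈ DualWF θ Γ ∧ ModelTendsto θ Γ (fun n => stft (un n)) (stft u) := by
  refine ⟨fun h => ⟨h.2.1, h.modelTendsto hθ⟩, fun h => ?_⟩
  have := tendstoWF_ofModel hθ (fun n => isModel_stft hθ (un n)) (isModel_stft hθ u)
    ((mem_DualWF_iff hθ u Γ).1 h.1) h.2
  simpa only [ofModel_stft] using this

theorem DualWF_mono {θ : ℝ} {Γ Γ' : Set (Phase ι)} (h : ∀ p, p ≠ 0 → p ∈ Γ → p ∈ Γ')
    {u : GSDual θ ι} (hu : u ∈ DualWF θ Γ) : u ∈ DualWF θ Γ' :=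
  fun p hp => h p hp.1 (hu hp)

theorem TendstoWF.mono {θ : ℝ} {Γ Γ' : Set (Phase ι)} (h : ∀ p, p ≠ 0 → p ∈ Γ → p ∈ Γ')
    {un : ℕ → GSDual θ ι} {u : GSDual θ ι} (hu : TendstoWF Γ un u) : TendstoWF Γ' un u :=
  ⟨fun n => DualWF_mono h (hu.1 n), DualWF_mono h hu.2.1, hu.2.2.1,
    fun p hp hpΓ => hu.2.2.2 p hp fun hp' => hpΓ (h p hp hp')⟩

theorem smul_mem_DualWF {θ : ℝ} (hθ : Admissible θ) {Γ : Set (Phase ι)} {u : GSDual θ ι}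
    (hu : u ∈ DualWF θ Γ) (c : ℂ) : c • u ∈ DualWF θ Γ := by
  rw [mem_DualWF_iff hθ] at hu ⊢
  intro p hp hpΓ
  simp only [stft_smul hθ, norm_mul]
  exact (hu p hp hpΓ).const_mul (norm_nonneg c)

theorem TendstoWF.const_smul {θ : ℝ} (hθ : Admissible θ) {Γ : Set (Phase ι)}
    {un : ℕ → GSDual θ ι} {u : GSDual θ ι} (hu : TendstoWF Γ un u) (c : ℂ) :
    TendstoWF Γ (fun n => c • un n) (c • u) := by
  rw [tendstoWF_iff hθ] at hu ⊢
  obtain ⟨hW, ht, R, hRm, hR0, hRmod, hR, hRd⟩ := hu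
  refine ⟨smul_mem_DualWF hθ hW c, ?_, fun p => ‖c‖ * R p, hRm.const_mul _,
    fun p => mul_nonneg (norm_nonneg c) (hR0 p), hRmod.const_mul (norm_nonneg c), fun n p => ?_,
    fun p hp hpΓ => (hRd p hp hpΓ).const_mul (norm_nonneg c)⟩
  · simp only [stft_smul hθ]
    exact fun p => (ht p).const_mul c
  · rw [stft_smul hθ, stft_smul hθ, ← mul_sub, norm_mul]
    exact mul_le_mul_of_nonneg_left (hR n p) (norm_nonneg c)

/-- Decay at a point holds in a whole open cone. The lemma permits `WF u` and `WF v` themselves as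
cones in the statement on convolutions. -/
theorem isClosedCone_WF {θ : ℝ} (hθ : Admissible θ) (u : GSDual θ ι) : IsClosedCone (WF u) := by
  refine ⟨fun h => h.1 rfl, fun p hp t ht => ?_, fun p hp => ?_⟩
  · rw [mem_WF_iff hθ] at hp ⊢
    refine ⟨smul_ne_zero ht.ne' hp.1, fun h => hp.2 ?_⟩
    have := h.smul (inv_pos.2 ht)
    rwa [smul_smul, inv_mul_cancel₀ ht.ne', one_smul] at this
  · by_contra hn
    rw [Set.mem_union, not_or] at hn
    have hd : DecayAt θ (fun q => ‖stft u q‖) p := by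
      by_contra hd
      exact hn.1 ((mem_WF_iff hθ u p).2 ⟨hn.2, hd⟩)
    obtain ⟨L, hL, hpL, hb⟩ := hd
    obtain ⟨q, hqL, hq⟩ := mem_closure_iff.1 hp L hL.1 (Set.singleton_subset_iff.1 hpL)
    exact ((mem_WF_iff hθ u q).1 hq).2 ⟨L, hL, Set.singleton_subset_iff.2 hqL, hb⟩

/-! ### The Fourier transform of Gabor atoms -/

/-- The symplectic rotation `(x, ξ) ↦ (-ξ, x)`. -/
def rotate (ι : Type) [Fintype ι] : Phase ι →L[ℝ] Phase ι :=
  (-ContinuousLinearMap.snd ℝ _ _).prod (ContinuousLinearMap.fst ℝ _ _)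

theorem rotate_apply (p : Phase ι) : rotate ι p = (-p.2, p.1) := rfl

theorem norm_rotate (p : Phase ι) : ‖rotate ι p‖ = ‖p‖ := by
  rw [rotate_apply, Prod.norm_def, Prod.norm_def, norm_neg, max_comm]

theorem integral_rotate (f : Phase ι → ℂ) : ∫ p, f (rotate ι p) = ∫ p, f p := by
  have h1 : MeasurePreserving (MeasurableEquiv.prodComm (α := Conf ι) (β := Conf ι))
      volume volume := Measure.measurePreserving_swap
  have h2 : MeasurePreserving
      ((MeasurableEquiv.neg (Conf ι)).prodCongr (MeasurableEquiv.refl (Conf ι))) volume volume :=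
    (Measure.measurePreserving_neg (volume : Measure (Conf ι))).prod (MeasurePreserving.id _)
  exact (h2.integral_comp' (fun p => f p) |>.symm.trans
    (h1.integral_comp' (fun p : Phase ι => f (-p.1, p.2))).symm).symm

/-- The phase factor `exp (-i ⟨x, ξ⟩)`. -/
def rotatePhase (p : Phase ι) : ℂ := Complex.exp (-Complex.I * ((inner ℝ p.1 p.2 : ℝ) : ℂ))

theorem norm_rotatePhase (p : Phase ι) : ‖rotatePhase p‖ = 1 := by
  rw [rotatePhase, neg_mul, ← mul_neg, mul_comm, ← Complex.ofReal_neg]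
  exact Complex.norm_exp_ofReal_mul_I _

theorem continuous_rotatePhase : Continuous (rotatePhase : Phase ι → ℂ) := by
  unfold rotatePhase
  fun_prop

theorem rotatePhase_mul_rotate (p : Phase ι) : rotatePhase p * rotatePhase (rotate ι p) = 1 := by
  rw [rotatePhase, rotatePhase, rotate_apply, ← Complex.exp_add, inner_neg_left,
    real_inner_comm p.1]
  push_cast
  ring_nf
  exact Complex.exp_zero

/-- In the unitary normalisation the Gaussian is its own Fourier transform; translation and
modulation are interchanged, leaving a phase factor. -/
theorem fourierFun_gaborAtom (p : Phase ι) (η : Conf ι) :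
    fourierFun (gaborAtom p) η = rotatePhase p * gaborAtom (rotate ι p) η := by
  have e : ∀ y : Conf ι, Complex.exp (-Complex.I * ((inner ℝ y η : ℝ) : ℂ)) * gaborAtom p y =
      Complex.exp (-((1 / 2 * ‖y - p.1‖ ^ 2 : ℝ) : ℂ) +
        Complex.I * ((inner ℝ (-(p.2 + η)) y : ℝ) : ℂ)) := fun y => by
    rw [gaborAtom, ← Complex.exp_add, inner_neg_left, inner_add_left, real_inner_comm y η]
    congr 1
    push_cast
    ring
  rw [fourierFun]
  simp only [e]
  rw [integral_gaussian (by norm_num), ← mul_assoc, ← Complex.ofReal_mul,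
    show Real.pi / (1 / 2) = 2 * Real.pi by ring, ← Real.rpow_add (by positivity), neg_div,
    neg_add_cancel, Real.rpow_zero, Complex.ofReal_one, one_mul, rotatePhase, gaborAtom,
    ← Complex.exp_add, rotate_apply]
  congr 1
  rw [norm_neg, inner_neg_left, inner_add_left, real_inner_comm p.1 p.2, real_inner_comm p.1 η,
    sub_neg_eq_add, add_comm η]
  push_cast
  ring

theorem integrable_coeff_mul_fourierAtom {G : Phase ι → ℂ} (hG : Integrable G) (η : Conf ι) :
    Integrable (fun r : Phase ι × Conf ι =>
      Complex.exp (-Complex.I * ((inner ℝ r.2 η : ℝ) : ℂ)) * (G r.1 * gaborAtom r.1 r.2))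
      (volume.prod volume) := by
  have hn : ∀ r : Phase ι × Conf ι,
      ‖Complex.exp (-Complex.I * ((inner ℝ r.2 η : ℝ) : ℂ)) * (G r.1 * gaborAtom r.1 r.2)‖ =
        ‖G r.1‖ * Real.exp (-(‖r.2 - r.1.1‖ ^ 2 / 2)) := fun r => by
    rw [norm_mul, norm_mul, norm_gaborAtom, neg_mul, ← mul_neg, mul_comm Complex.I,
      ← Complex.ofReal_neg, Complex.norm_exp_ofReal_mul_I, one_mul]
  have hm : AEStronglyMeasurable (fun r : Phase ι × Conf ι =>
      Complex.exp (-Complex.I * ((inner ℝ r.2 η : ℝ) : ℂ)) * (G r.1 * gaborAtom r.1 r.2))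
      (volume.prod volume) :=
    (by fun_prop : Continuous fun r : Phase ι × Conf ι =>
      Complex.exp (-Complex.I * ((inner ℝ r.2 η : ℝ) : ℂ))).aestronglyMeasurable.mul
      (hG.aestronglyMeasurable.comp_fst.mul continuous_gaborAtom.aestronglyMeasurable)
  rw [integrable_prod_iff hm]
  constructor
  · refine Filter.Eventually.of_forall fun p => ?_
    refine ((integrable_norm_gaborAtom p).const_mul (G p)).bdd_mul (c := 1)
      (by fun_prop : Continuous fun y : Conf ι =>
        Complex.exp (-Complex.I * ((inner ℝ y η : ℝ) : ℂ))).aestronglyMeasurable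
      (Filter.Eventually.of_forall fun y => ?_)
    rw [neg_mul, ← mul_neg, mul_comm Complex.I, ← Complex.ofReal_neg,
      Complex.norm_exp_ofReal_mul_I]
  · have e : ∀ p : Phase ι, ∫ y : Conf ι, ‖G p‖ * Real.exp (-(‖y - p.1‖ ^ 2 / 2)) =
        ‖G p‖ * ∫ y : Conf ι, Real.exp (-(‖y‖ ^ 2 / 2)) := fun p => by
      rw [integral_const_mul,
        integral_sub_right_eq_self (fun y : Conf ι => Real.exp (-(‖y‖ ^ 2 / 2))) p.1]
    exact (hG.norm.mul_const _).congr (Filter.Eventually.of_forall fun p =>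
      ((integral_congr_ae (Filter.Eventually.of_forall fun y => hn (p, y))).trans (e p)).symm)

theorem fourierFun_synth {G : Phase ι → ℂ} (hG : Integrable G) (η : Conf ι) :
    fourierFun (synth G) η = ∫ p, G p * (rotatePhase p * gaborAtom (rotate ι p) η) := by
  set k := (((2 * Real.pi) ^ (-(Fintype.card ι : ℝ) / 2) : ℝ) : ℂ) with hk
  calc fourierFun (synth G) η
      = k * ∫ y : Conf ι, ∫ p : Phase ι,
          Complex.exp (-Complex.I * ((inner ℝ y η : ℝ) : ℂ)) * (G p * gaborAtom p y) := by
        simp only [integral_const_mul]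
        rfl
    _ = k * ∫ p : Phase ι, ∫ y : Conf ι,
          Complex.exp (-Complex.I * ((inner ℝ y η : ℝ) : ℂ)) * (G p * gaborAtom p y) := by
        rw [integral_integral_swap (f := fun (p : Phase ι) (y : Conf ι) =>
          Complex.exp (-Complex.I * ((inner ℝ y η : ℝ) : ℂ)) * (G p * gaborAtom p y))
          (integrable_coeff_mul_fourierAtom hG η)]
    _ = _ := by
        rw [← integral_const_mul]
        refine integral_congr_ae (Filter.Eventually.of_forall fun p => ?_)
        simp only []
        rw [← fourierFun_gaborAtom, fourierFun, ← hk, mul_left_comm, ← integral_const_mul (G p)]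
        congr 2
        funext y
        ring

theorem fourierFun_smul (c : ℂ) (f : Conf ι → ℂ) : fourierFun (c • f) = c • fourierFun f := by
  funext η
  simp only [fourierFun, Pi.smul_apply, smul_eq_mul, mul_left_comm _ c, integral_const_mul]

theorem neg_rotate_rotate (p : Phase ι) : -rotate ι (rotate ι p) = p := by
  simp [rotate_apply]

/-- The Gabor coefficients of the Fourier transform. -/
def fourierCoeff (f : Conf ι → ℂ) (q : Phase ι) : ℂ :=
  coeff f (-rotate ι q) * rotatePhase (-rotate ι q)

theorem measurable_fourierCoeff {f : Conf ι → ℂ} (hf : Continuous f) :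
    Measurable (fourierCoeff f) := by
  have h : Measurable fun q : Phase ι => -rotate ι q := (rotate ι).continuous.neg.measurable
  exact ((measurable_coeff hf).comp h).mul (continuous_rotatePhase.measurable.comp h)

/-- The inversion formula is transformed atom by atom, and a change of variables under `rotate`
makes it a superposition again. Since `fourierCoeff` decays, the Fourier transform stays in `S_θ`.
-/
theorem fourierFun_eq {θ : ℝ} (hθ : Admissible θ) {f : Conf ι → ℂ} (hf : f ∈ GS θ ι) :
    fourierFun f = (synthConst ι : ℂ) • synth (fourierCoeff f) := by
  obtain ⟨ε, hε, K, -, hK⟩ := exists_norm_coeff_le hθ hf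
  have hc : Integrable (coeff f) := integrable_of_norm_le_exp hθ hε
    (measurable_coeff (continuous_of_mem hf)).aestronglyMeasurable hK
  have e : f = (synthConst ι : ℂ) • synth (coeff f) := funext fun y => eq_synth_coeff hθ hf y
  conv_lhs => rw [e, fourierFun_smul]
  congr 1
  funext η
  rw [fourierFun_synth hc, synth,
    ← integral_rotate fun q => fourierCoeff f q * gaborAtom q η]
  simp only [fourierCoeff, neg_rotate_rotate, mul_assoc]

theorem exists_integrable_fourierCoeff {θ : ℝ} (hθ : Admissible θ) {f : Conf ι → ℂ}
    (hf : f ∈ GS θ ι) : ∃ ε > 0,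
      Integrable fun q : Phase ι => ‖fourierCoeff f q‖ * Real.exp (ε * ‖q‖ ^ (1 / θ)) := by
  obtain ⟨ε, hε, K, -, hK⟩ := exists_norm_coeff_le hθ hf
  refine ⟨ε / 2, by positivity, integrable_mul_exp_of_norm_le_exp (ε := ε) (K := K) hθ
    (by linarith) (measurable_fourierCoeff (continuous_of_mem hf)).aestronglyMeasurable
    fun q => ?_⟩
  rw [fourierCoeff, norm_mul, norm_rotatePhase, mul_one]
  have := hK (-rotate ι q)
  rwa [norm_neg, norm_rotate] at this

/-! ### The Fourier transform of ultradistributions -/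

section Fourier

variable {θ : ℝ}

theorem isModel_fourier (hθ : Admissible θ) (u : GSDual θ ι) :
    IsModel θ fun p => rotatePhase p * stft u (rotate ι p) := by
  refine ⟨continuous_rotatePhase.measurable.mul
    ((measurable_stft hθ u).comp (rotate ι).continuous.measurable), fun ε hε => ?_⟩
  obtain ⟨K, hK, hb⟩ := moderate_stft hθ u ε hε
  refine ⟨K, hK, fun p => ?_⟩
  have := hb (rotate ι p)
  rw [norm_rotate] at this
  simp only [norm_mul, norm_rotatePhase, one_mul]
  exact this

/-- The Fourier transform of an ultradistribution. -/
def fourier (hθ : Admissible θ) (u : GSDual θ ι) : GSDual θ ι := ofModel hθ (isModel_fourier hθ u)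

theorem isFourier_fourier (hθ : Admissible θ) (u : GSDual θ ι) : IsFourier u (fourier hθ u) := by
  intro f
  have hm := (measurable_fourierCoeff (continuous_of_mem f.2)).aestronglyMeasurable
    (μ := (volume : Measure (Phase ι)))
  obtain ⟨ε, hε, hi⟩ := exists_integrable_fourierCoeff hθ f.2
  have h1 : pairing u (fourierFun (f : Conf ι → ℂ)) =
      (synthConst ι : ℂ) * ∫ q, fourierCoeff (f : Conf ι → ℂ) q * stft u q := by
    rw [fourierFun_eq hθ f.2, ← apply_synth hθ hε u hm hi,
      pairing_of_mem u ((GS θ ι).smul_mem _ (synth_mem hθ hε hm hi)), ← smul_eq_mul, ← map_smul]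
    rfl
  rw [h1, fourier, ofModel_apply,
    ← integral_rotate fun q => fourierCoeff (f : Conf ι → ℂ) q * stft u q]
  simp only [fourierCoeff, neg_rotate_rotate, mul_assoc]

theorem isFourier_iff (hθ : Admissible θ) (u v : GSDual θ ι) :
    IsFourier u v ↔ v = fourier hθ u := by
  constructor
  · intro h
    exact Subtype.ext (LinearMap.ext fun f => (h f).trans (isFourier_fourier hθ u f).symm)
  · rintro rfl
    exact isFourier_fourier hθ u

theorem stft_fourier (hθ : Admissible θ) (u : GSDual θ ι) (p : Phase ι) :
    stft (fourier hθ u) p = rotatePhase p * stft u (rotate ι p) := by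
  have e : fourierFun (gaborAtom p) = rotatePhase p • gaborAtom (rotate ι p) :=
    funext fun η => fourierFun_gaborAtom p η
  rw [stft_eq hθ, isFourier_fourier hθ u]
  simp only [e]
  rw [pairing_of_mem u ((GS θ ι).smul_mem _ (gaborAtom_mem hθ _)), stft_eq hθ, ← smul_eq_mul,
    ← map_smul]
  rfl

/-- The two phase factors cancel and two rotations are the reflection at the origin. Hence the
fourth power of the Fourier transform is the identity and its cube is the inverse. -/
theorem stft_fourier_fourier (hθ : Admissible θ) (u : GSDual θ ι) (p : Phase ι) :
    stft (fourier hθ (fourier hθ u)) p = stft u (-p) := by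
  rw [stft_fourier, stft_fourier, ← mul_assoc, rotatePhase_mul_rotate, one_mul,
    ← neg_rotate_rotate (-p), map_neg, map_neg, neg_neg]

/-- The inverse Fourier transform of an ultradistribution. -/
def fourierInv (hθ : Admissible θ) (u : GSDual θ ι) : GSDual θ ι :=
  fourier hθ (fourier hθ (fourier hθ u))

theorem fourier_eq_iff (hθ : Admissible θ) (u v : GSDual θ ι) :
    u = fourier hθ v ↔ v = fourierInv hθ u := by
  have h : ∀ w : GSDual θ ι, fourier hθ (fourier hθ (fourier hθ (fourier hθ w))) = w := fun w =>
    ext_of_stft hθ fun p => by rw [stft_fourier_fourier, stft_fourier_fourier, neg_neg]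
  constructor
  · rintro rfl
    exact (h v).symm
  · rintro rfl
    exact (h u).symm

theorem decayAt_comp_rotate {N : Phase ι → ℝ} {p : Phase ι} (h : DecayAt θ N (rotate ι p)) :
    DecayAt θ (fun q => N (rotate ι q)) p := by
  obtain ⟨L, hL, hpL, ε, hε, C, hC, hb⟩ := h
  refine ⟨rotate ι ⁻¹' L, ⟨hL.1.preimage (rotate ι).continuous, fun z hz t ht => ?_⟩,
    Set.singleton_subset_iff.2 (Set.singleton_subset_iff.1 hpL :), ε, hε, C, hC, fun z hz => ?_⟩
  · rw [Set.mem_preimage, map_smul]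
    exact hL.2 _ hz t ht
  · rw [← norm_rotate z]
    exact hb _ hz

theorem rotate_ne_zero {p : Phase ι} (hp : p ≠ 0) : rotate ι p ≠ 0 := by
  rwa [← norm_ne_zero_iff, norm_rotate, norm_ne_zero_iff]

theorem norm_stft_fourier (hθ : Admissible θ) (u : GSDual θ ι) (p : Phase ι) :
    ‖stft (fourier hθ u) p‖ = ‖stft u (rotate ι p)‖ := by
  rw [stft_fourier, norm_mul, norm_rotatePhase, one_mul]

theorem fourier_mem_DualWF (hθ : Admissible θ) {Γ : Set (Phase ι)} {u : GSDual θ ι}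
    (hu : u ∈ DualWF θ Γ) : fourier hθ u ∈ DualWF θ (rotate ι ⁻¹' Γ) := by
  rw [mem_DualWF_iff hθ] at hu ⊢
  intro p hp hpΓ
  simp only [norm_stft_fourier]
  exact decayAt_comp_rotate (hu _ (rotate_ne_zero hp) hpΓ)

theorem tendstoWF_fourier (hθ : Admissible θ) {Γ : Set (Phase ι)} {un : ℕ → GSDual θ ι}
    {u : GSDual θ ι} (hu : TendstoWF Γ un u) :
    TendstoWF (rotate ι ⁻¹' Γ) (fun n => fourier hθ (un n)) (fourier hθ u) := by
  rw [tendstoWF_iff hθ] at hu ⊢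
  obtain ⟨hW, ht, R, hRm, hR0, hRmod, hR, hRd⟩ := hu
  refine ⟨fourier_mem_DualWF hθ hW, ?_, fun p => R (rotate ι p),
    hRm.comp (rotate ι).continuous.measurable, fun p => hR0 _, fun ε hε => ?_, fun n p => ?_,
    fun p hp hpΓ => decayAt_comp_rotate (hRd _ (rotate_ne_zero hp) hpΓ)⟩
  · simp only [stft_fourier]
    exact fun p => (ht _).const_mul _
  · obtain ⟨K, hK, hb⟩ := hRmod ε hε
    refine ⟨K, hK, fun p => ?_⟩
    have := hb (rotate ι p)
    rwa [norm_rotate] at this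
  · rw [stft_fourier, stft_fourier, ← mul_sub, norm_mul, norm_rotatePhase, one_mul]
    exact hR n _

theorem isClosedCone_preimage_rotate {Γ : Set (Phase ι)} (h : IsClosedCone Γ) :
    IsClosedCone (rotate ι ⁻¹' Γ) := by
  refine ⟨fun h0 => h.1 (by rwa [Set.mem_preimage, map_zero] at h0), fun p hp t ht => ?_,
    fun p hp => ?_⟩
  · rw [Set.mem_preimage, map_smul]
    exact h.2.1 _ hp t ht
  · by_cases h0 : p = 0
    · exact Or.inr h0
    · have := h.2.2 ((rotate ι).continuous.closure_preimage_subset Γ hp)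
      exact Or.inl (this.resolve_right (rotate_ne_zero h0))

end Fourier

/-! ### Convolutions -/

section Convolution

variable {θ : ℝ} {Γ₁ Γ₂ : Set (Phase ι)}

/-- `(2π)^{d/2}`. -/
def convConst (ι : Type) [Fintype ι] : ℂ := (((2 * Real.pi) ^ ((Fintype.card ι : ℝ) / 2) : ℝ) : ℂ)

theorem isConvolution_iff (hθ : Admissible θ) (u v w : GSDual θ ι) : IsConvolution u v w ↔
    ∃ p, IsProduct (fourier hθ u) (fourier hθ v) p ∧ w = fourierInv hθ (convConst ι • p) := by
  constructor
  · rintro ⟨uhat, vhat, p, hu, hv, hp, hw⟩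
    rw [isFourier_iff hθ] at hu hv hw
    subst hu hv
    exact ⟨p, hp, (fourier_eq_iff hθ _ _).1 hw⟩
  · rintro ⟨p, hp, hw⟩
    exact ⟨_, _, p, isFourier_fourier hθ u, isFourier_fourier hθ v, hp,
      (isFourier_iff hθ _ _).2 ((fourier_eq_iff hθ _ _).2 hw)⟩

theorem notMem_preimage_rotate (hΓ : ∀ ξ : Conf ι, (ξ, 0) ∈ Γ₁ → (-ξ, 0) ∉ Γ₂) (ξ : Conf ι)
    (h : (0, ξ) ∈ rotate ι ⁻¹' Γ₁) : (0, -ξ) ∉ rotate ι ⁻¹' Γ₂ :=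
  hΓ (-ξ) h

/-- The three outer rotations belong to the inverse Fourier transform. A fourth one gives back `q`,
so `q = (-ξ - η, x)`, while the inner preimages say that `(-ξ, x)` and `(-η, x)` lie in `Γ₁ ∪ {0}`
and `Γ₂ ∪ {0}`. -/
theorem mem_convolutionCone (q : Phase ι) (hq : q ≠ 0)
    (h : q ∈ rotate ι ⁻¹' (rotate ι ⁻¹' (rotate ι ⁻¹'
      diagCone (tensorCone (rotate ι ⁻¹' Γ₁) (rotate ι ⁻¹' Γ₂))))) :
    q ∈ convolutionCone Γ₁ Γ₂ := by
  obtain ⟨x, ξ, η, hm, he⟩ := h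
  obtain ⟨-, h1, h2⟩ := mem_tensorCone_iff.1 hm
  change (x, ξ) ∈ _ at h1
  change (x, η) ∈ _ at h2
  have hq' : q = (-ξ + -η, x) := by
    have h3 : rotate ι (rotate ι (rotate ι (rotate ι q))) = q := by simp [rotate_apply]
    rw [he, rotate_apply] at h3
    rw [← h3, neg_add]
  have hz : ∀ {Γ : Set (Phase ι)} {ζ : Conf ι}, (x, ζ) ∈ rotate ι ⁻¹' Γ ∪ {0} →
      (-ζ, x) ∈ Γ ∪ {0} := by
    rintro Γ ζ (h | h)
    · exact Or.inl h
    · obtain ⟨rfl, rfl⟩ := Prod.mk_eq_zero.1 h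
      exact Or.inr (by rw [neg_zero]; rfl)
  exact ⟨⟨-ξ, -η, x, hz h1, hz h2, hq'⟩, hq⟩

theorem existsUnique_convolution (hθ : Admissible θ) (h₁ : IsClosedCone Γ₁)
    (h₂ : IsClosedCone Γ₂) (hΓ : ∀ ξ : Conf ι, (ξ, 0) ∈ Γ₁ → (-ξ, 0) ∉ Γ₂) {u v : GSDual θ ι}
    (hu : u ∈ DualWF θ Γ₁) (hv : v ∈ DualWF θ Γ₂) : ∃! w, IsConvolution u v w := by
  have key := isProduct_iff hθ (isClosedCone_preimage_rotate h₁) (isClosedCone_preimage_rotate h₂)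
    (notMem_preimage_rotate hΓ) (fourier_mem_DualWF hθ hu) (fourier_mem_DualWF hθ hv)
  refine ⟨_, (isConvolution_iff hθ u v _).2 ⟨_, (key _).2 rfl, rfl⟩, fun w hw => ?_⟩
  obtain ⟨p, hp, rfl⟩ := (isConvolution_iff hθ u v w).1 hw
  rw [(key p).1 hp]

theorem convolution_mem_DualWF (hθ : Admissible θ) (h₁ : IsClosedCone Γ₁)
    (h₂ : IsClosedCone Γ₂) (hΓ : ∀ ξ : Conf ι, (ξ, 0) ∈ Γ₁ → (-ξ, 0) ∉ Γ₂) {u v w : GSDual θ ι}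
    (hu : u ∈ DualWF θ Γ₁) (hv : v ∈ DualWF θ Γ₂) (hw : IsConvolution u v w) :
    w ∈ DualWF θ (convolutionCone Γ₁ Γ₂) := by
  have hu' := fourier_mem_DualWF hθ hu
  have hv' := fourier_mem_DualWF hθ hv
  obtain ⟨p, hp, rfl⟩ := (isConvolution_iff hθ u v w).1 hw
  rw [isProduct_iff hθ (isClosedCone_preimage_rotate h₁) (isClosedCone_preimage_rotate h₂)
    (notMem_preimage_rotate hΓ) hu' hv'] at hp
  have h1 := smul_mem_DualWF hθ (product_mem_DualWF hθ (notMem_preimage_rotate hΓ) hu' hv')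
    (convConst ι)
  rw [← hp] at h1
  exact DualWF_mono mem_convolutionCone
    (fourier_mem_DualWF hθ (fourier_mem_DualWF hθ (fourier_mem_DualWF hθ h1)))

theorem tendstoWF_convolution (hθ : Admissible θ) (h₁ : IsClosedCone Γ₁)
    (h₂ : IsClosedCone Γ₂) (hΓ : ∀ ξ : Conf ι, (ξ, 0) ∈ Γ₁ → (-ξ, 0) ∉ Γ₂)
    {un vn wn : ℕ → GSDual θ ι} {u v w : GSDual θ ι} (hu : TendstoWF Γ₁ un u)
    (hv : TendstoWF Γ₂ vn v) (hn : ∀ n, IsConvolution (un n) (vn n) (wn n))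
    (hw : IsConvolution u v w) : TendstoWF (convolutionCone Γ₁ Γ₂) wn w := by
  simp only [isConvolution_iff hθ] at hn
  choose pn hpn hwn using hn
  obtain ⟨p, hp, rfl⟩ := (isConvolution_iff hθ u v w).1 hw
  have h1 := tendstoWF_product hθ (isClosedCone_preimage_rotate h₁)
    (isClosedCone_preimage_rotate h₂) (notMem_preimage_rotate hΓ) (tendstoWF_fourier hθ hu)
    (tendstoWF_fourier hθ hv) hpn hp
  rw [funext hwn]
  exact (tendstoWF_fourier hθ (tendstoWF_fourier hθ (tendstoWF_fourier hθ
    (h1.const_smul hθ (convConst ι))))).mono mem_convolutionCone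

end Convolution

end GelfandShilov
end

open GelfandShilov in
theorem mainTheorem4 (d : ℕ) (θ : ℝ) (hθ : 1 / 2 ≤ θ) (hθ' : θ < 1) :
    -- products
    (∀ Γ₁ Γ₂ : Set (Phase (Fin d)), IsClosedCone Γ₁ → IsClosedCone Γ₂ →
      (∀ ξ : Conf (Fin d), (0, ξ) ∈ Γ₁ → (0, -ξ) ∉ Γ₂) →
      (∀ u ∈ DualWF θ Γ₁, ∀ v ∈ DualWF θ Γ₂,
        (∃! w : GSDual θ (Fin d), IsProduct u v w) ∧
        ∀ w : GSDual θ (Fin d), IsProduct u v w →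
          w ∈ DualWF θ (diagCone (tensorCone Γ₁ Γ₂)) ∧ WF w ⊆ productCone Γ₁ Γ₂) ∧
      ∀ (un vn wn : ℕ → GSDual θ (Fin d)) (u v w : GSDual θ (Fin d)),
        TendstoWF Γ₁ un u → TendstoWF Γ₂ vn v →
        (∀ n, IsProduct (un n) (vn n) (wn n)) → IsProduct u v w →
        TendstoWF (diagCone (tensorCone Γ₁ Γ₂)) wn w) ∧
    -- convolutions
    (∀ u v : GSDual θ (Fin d),
      (∀ ξ : Conf (Fin d), (ξ, 0) ∈ WF u → (-ξ, 0) ∉ WF v) →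
        (∃! w : GSDual θ (Fin d), IsConvolution u v w) ∧
        ∀ w : GSDual θ (Fin d), IsConvolution u v w → WF w ⊆ convolutionCone (WF u) (WF v)) ∧
    (∀ Γ₁ Γ₂ : Set (Phase (Fin d)), IsClosedCone Γ₁ → IsClosedCone Γ₂ →
      (∀ ξ : Conf (Fin d), (ξ, 0) ∈ Γ₁ → (-ξ, 0) ∉ Γ₂) →
      ∀ (un vn wn : ℕ → GSDual θ (Fin d)) (u v w : GSDual θ (Fin d)),
        TendstoWF Γ₁ un u → TendstoWF Γ₂ vn v →
        (∀ n, IsConvolution (un n) (vn n) (wn n)) → IsConvolution u v w →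
        TendstoWF (convolutionCone Γ₁ Γ₂) wn w) := by
  have h : Admissible θ := ⟨hθ, hθ'⟩
  refine ⟨fun Γ₁ Γ₂ h₁ h₂ hΓ => ⟨fun u hu v hv => ?_, fun un vn wn u v w hu hv hn hw =>
    tendstoWF_product h h₁ h₂ hΓ hu hv hn hw⟩, fun u v huv => ?_,
    fun Γ₁ Γ₂ h₁ h₂ hΓ un vn wn u v w hu hv hn hw =>
      tendstoWF_convolution h h₁ h₂ hΓ hu hv hn hw⟩
  · have key := isProduct_iff h h₁ h₂ hΓ hu hv
    refine ⟨⟨_, (key _).2 rfl, fun w hw => (key w).1 hw⟩, fun w hw => ?_⟩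
    have hm := product_mem_DualWF h hΓ hu hv
    rw [← (key w).1 hw] at hm
    exact ⟨hm, Set.Subset.trans hm diagCone_tensorCone_subset⟩
  -- The wave front sets themselves serve as `Γ₁` and `Γ₂`.
  · have h₁ := isClosedCone_WF h u
    have h₂ := isClosedCone_WF h v
    have hu : u ∈ DualWF θ (WF u) := fun _ hp => hp
    have hv : v ∈ DualWF θ (WF v) := fun _ hp => hp
    exact ⟨existsUnique_convolution h h₁ h₂ huv hu hv, fun w hw =>
      convolution_mem_DualWF h h₁ h₂ huv hu hv hw⟩
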